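/- Let $\phi:\mathbb R\to\mathbb R$ be a $C^2$ function of period $1$ and let $f\in\mathbb R$, $f\neq 0$. Put $$w_0(x)=\int_0^1 e^{\phi(x+s)-\phi(x)-fs}\,ds,\qquad M_0=\int_0^1 w_0(x)\,dx,\qquad u_0=\frac{w_0}{M_0},\qquad J_0=\frac{1-e^{-f}}{M_0},$$ $$w_1(x)=\int_0^1 w_0(x+s)^2\,e^{\phi(x+s)-\phi(x)-fs}\,ds,\qquad M_1=\int_0^1 w_1(x)\,dx,$$ $$u_1(x)=\Bigl(\frac{M_1}{M_0^3J_0}+\frac12\Bigr)u_0(x)-u_0(x)\int_0^x u_0(s)\,ds-\frac{w_1(x)}{M_0^3J_0}.$$ (1) The function $u_1$ is differentiable and its flux is, for all $x\in\mathbb R$, $$-\bigl((\phi'(x)-f)u_1(x)+u_1'(x)\bigr)=\frac{M_1}{M_0^3}+\frac{J_0}{2}-J_0\int_0^x u_0(s)\,ds .$$ (2) $u_1$ is a steady state of the problem $$\partial_t p+J_0u_0=\partial_x\bigl((\phi'-f)p+\partial_x p\bigr),\quad p(x+1,t)=p(x,t)-u_0(x),\quad \int_0^1 p(x,t)\,dx=0,$$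 that is, $\bigl((\phi'-f)u_1+u_1'\bigr)'=J_0u_0$, $u_1(x+1)=u_1(x)-u_0(x)$ for all $x\in\mathbb R$, and $\int_0^1u_1(x)\,dx=0$. (3) Let $\rho(x,t)$, $x\in\mathbb R$, $t>0$, be a classical solution (with $\rho,\partial_t\rho,\partial_x\rho,\partial_x^2\rho$ continuous on $\mathbb R\times(0,\infty)$) of the Fokker–Planck equation $$\partial_t\rho=\partial_x\bigl((\phi'-f)\rho+\partial_x\rho\bigr)$$ such that $\rho(\cdot,t)$ is a probability density for every $t>0$ and $\rho(\cdot,t)\to u_0\mathbf 1_{[0,1]}$ in $L^1(\mathbb R)$ as $t\to0^+$. Then the series $\rho_1(x,t)=\sum_{j\in\mathbb Z}j\,\rho(j+x,t)$ converges absolutely for all $x\in\mathbb R$ and $t>0$, and $$\rho_1(x,t)-u_0(x)J_0t\;\longrightarrow\;u_1(x)\qquad(t\to\infty),$$ uniformly in $x\in\mathbb R$. -/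

import Mathlib

open Real Set Filter Topology MeasureTheory

namespace PeriodicPotential

noncomputable section

/-- `w₀(x) = ∫₀¹ exp(φ(x+s) - φ(x) - f s) ds`. -/
def w0 (φ : ℝ → ℝ) (f : ℝ) (x : ℝ) : ℝ :=
  ∫ s in (0 : ℝ)..1, Real.exp (φ (x + s) - φ x - f * s)

/-- `M₀ = ∫₀¹ w₀(x) dx`. -/
def M0 (φ : ℝ → ℝ) (f : ℝ) : ℝ := ∫ x in (0 : ℝ)..1, w0 φ f x

/-- The steady state `u₀ = w₀ / M₀` of the zeroth periodized moment. -/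
def u0 (φ : ℝ → ℝ) (f : ℝ) (x : ℝ) : ℝ := w0 φ f x / M0 φ f

/-- The (constant) flux `J₀ = (1 - exp(-f)) / M₀` of `u₀`. -/
def J0 (φ : ℝ → ℝ) (f : ℝ) : ℝ := (1 - Real.exp (-f)) / M0 φ f

/-- `w₁(x) = ∫₀¹ w₀(x+s)² exp(φ(x+s) - φ(x) - f s) ds`. -/
def w1 (φ : ℝ → ℝ) (f : ℝ) (x : ℝ) : ℝ :=
  ∫ s in (0 : ℝ)..1, w0 φ f (x + s) ^ 2 * Real.exp (φ (x + s) - φ x - f * s)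

/-- `M₁ = ∫₀¹ w₁(x) dx`. -/
def M1 (φ : ℝ → ℝ) (f : ℝ) : ℝ := ∫ x in (0 : ℝ)..1, w1 φ f x

/-- `u₁ = (M₁ / (M₀³ J₀) + 1/2) u₀ - u₀ ∫₀ˣ u₀ - w₁ / (M₀³ J₀)`. -/
def u1 (φ : ℝ → ℝ) (f : ℝ) (x : ℝ) : ℝ :=
  (M1 φ f / (M0 φ f ^ 3 * J0 φ f) + 1 / 2) * u0 φ f x
    - u0 φ f x * (∫ s in (0 : ℝ)..x, u0 φ f s)
    - w1 φ f x / (M0 φ f ^ 3 * J0 φ f)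

/-- The probability flux `-((φ' - f) u + u')` of a profile `u`. -/
def flux (φ : ℝ → ℝ) (f : ℝ) (u : ℝ → ℝ) (x : ℝ) : ℝ :=
  -((deriv φ x - f) * u x + deriv u x)

/-- The initial density: `u₀` on `[0, 1]` and `0` elsewhere. -/
def initialDensity (φ : ℝ → ℝ) (f : ℝ) : ℝ → ℝ := (Icc (0 : ℝ) 1).indicator (u0 φ f)

/-- `ρ x t` is, for `t > 0`, a probability density in `x` which is a classical solution
(of class `C²` in `x` and `C¹` in `t`) of the Fokker-Planck equation
`∂ρ/∂t = ∂/∂x ((φ' - f) ρ + ∂ρ/∂x)` on the whole line, and which attains the initial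
density `ρ₀` in `L¹` as `t → 0+`. The values `ρ x t` for `t ≤ 0` play no role. -/
structure IsFokkerPlanckDensity (φ : ℝ → ℝ) (f : ℝ) (ρ₀ : ℝ → ℝ) (ρ : ℝ → ℝ → ℝ) : Prop where
  differentiableAt_time : ∀ x : ℝ, ∀ t : ℝ, 0 < t → DifferentiableAt ℝ (fun s => ρ x s) t
  contDiff_space : ∀ t : ℝ, 0 < t → ContDiff ℝ 2 (fun y => ρ y t)
  continuousOn : ContinuousOn (fun p : ℝ × ℝ => ρ p.1 p.2) (univ ×ˢ Ioi 0)
  continuousOn_deriv_time :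
    ContinuousOn (fun p : ℝ × ℝ => deriv (fun s => ρ p.1 s) p.2) (univ ×ˢ Ioi 0)
  continuousOn_deriv_space :
    ContinuousOn (fun p : ℝ × ℝ => deriv (fun y => ρ y p.2) p.1) (univ ×ˢ Ioi 0)
  continuousOn_deriv_space_two :
    ContinuousOn (fun p : ℝ × ℝ => deriv (deriv (fun y => ρ y p.2)) p.1) (univ ×ˢ Ioi 0)
  equation : ∀ x : ℝ, ∀ t : ℝ, 0 < t →
    deriv (fun s => ρ x s) t
      = deriv (fun y => (deriv φ y - f) * ρ y t + deriv (fun z => ρ z t) y) x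
  nonneg : ∀ x : ℝ, ∀ t : ℝ, 0 < t → 0 ≤ ρ x t
  integrable : ∀ t : ℝ, 0 < t → Integrable (fun x => ρ x t)
  mass : ∀ t : ℝ, 0 < t → ∫ x, ρ x t = 1
  initial : Tendsto (fun t => ∫ x, |ρ x t - ρ₀ x|) (𝓝[>] 0) (𝓝 0)

/-- The periodized moments `ρ_k(x, t) = ∑_{j ∈ ℤ} j^k ρ(j + x, t)`. -/
def periodizedMoment (k : ℕ) (ρ : ℝ → ℝ → ℝ) (x t : ℝ) : ℝ :=
  ∑' j : ℤ, (j : ℝ) ^ k * ρ (j + x) t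

end

end PeriodicPotential

open PeriodicPotential

/-!
Write `b = φ' - f`. Multiplying by `exp (φ - f x)` turns the averages `w₀` and `w₁` into integrals
over a moving unit interval, so that `u₀` and `u₁` solve the first order equations
`b u₀ + u₀' = -J₀` and `b u₁ + u₁' = -M₁/M₀³ - J₀/2 + J₀ ∫₀ˣ u₀`; see `hasDerivAt_exp_average` and
`hasDerivAt_u1`. This gives the statements on the steady states.

For the convergence, the periodized density `R(x, t) = ∑ⱼ ρ(j + x, t)` is a periodic solution which
starts from `u₀`, and the `L¹` distance between periodic solutions does not increase, so `R` stays
equal to `u₀`. As `ρ₁(x + 1, t) = ρ₁(x, t) - R(x, t)`, the difference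
`q = ρ₁ - u₀ J₀ t - u₁` is a periodic solution. Its mass over a period is conserved, and vanishes
because no first moment escapes from the unit cell as `t → 0`
(`IsFokkerPlanckDensity.tendsto_moment_outside`). A periodic solution of mean zero decays
exponentially: writing it as `u₀ g`, the entropy `∫ u₀ g²` is dissipated at the rate `2 ∫ u₀ (g')²`
(`IsFluxSolution.hasDerivAt_entropy`), which dominates it by a Poincaré inequality. The entropies
`∫ u₀ √(g² + δ²)` give the contraction in `L¹`.

Two tools make this rigorous for `ρ`, about which only classical regularity and integrability are
known. The first is a pointwise bound by local averages. The factor `exp ((φ - f x) / 2)` removes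
the drift, and a nonnegative subsolution of the heat equation is bounded by testing it against a
truncated backward heat kernel (`heat_subsolution_bound`). With the first moment bound
(`IsFokkerPlanckDensity.exists_moment_bound`, from compactly supported test functions) it yields
locally uniform absolute convergence of the series for `ρ₁`; it also turns `L²` decay into uniform
decay. The second tool is integration in time. No bounds are at hand for the derivatives of the
terms of `ρ₁`, but the time integrals of these terms have derivatives which are controlled by the
values of the terms alone (`IsFokkerPlanckDensity.isMildSolution_periodizedSum`). The estimates are
therefore proved for averages over `[t, t + ε]`, with constants independent of `ε`, and pass to the
limit `ε → 0`.
-/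

namespace PeriodicPotential

/-! ### Integrals depending on a parameter -/

theorem continuousOn_intervalIntegral_param {X : Type*} [TopologicalSpace X]
    {U : Set X} {g : ℝ → X → ℝ} {a b : ℝ}
    (hg : ContinuousOn (fun z : ℝ × X => g z.1 z.2) (uIcc a b ×ˢ U)) :
    ContinuousOn (fun t => ∫ x in a..b, g x t) U := by
  have hle : min a b ≤ max a b := min_le_max
  rw [continuousOn_iff_continuous_domRestrict]
  have h1 : Continuous (Function.uncurry fun (u : U) (x : ℝ) =>
      g (projIcc (min a b) (max a b) hle x) u) := by
    have hc : Continuous fun z : U × ℝ =>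
        ((projIcc (min a b) (max a b) hle z.2 : ℝ), (z.1 : X)) := by
      refine Continuous.prodMk ?_ ?_
      · exact continuous_subtype_val.comp (continuous_projIcc.comp continuous_snd)
      · exact continuous_subtype_val.comp continuous_fst
    refine hg.comp_continuous hc fun z => ⟨?_, z.1.2⟩
    exact (projIcc (min a b) (max a b) hle z.2).2
  refine (intervalIntegral.continuous_parametric_intervalIntegral_of_continuous'
    (μ := volume) h1 a b).congr fun u => ?_
  refine intervalIntegral.integral_congr fun x hx => ?_
  rw [projIcc_of_mem hle hx]

theorem hasDerivAt_intervalIntegral_param {U : Set ℝ} (hU : IsOpen U)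
    {g g' : ℝ → ℝ → ℝ} {a b t₀ : ℝ} (ht₀ : t₀ ∈ U)
    (hg : ContinuousOn (fun z : ℝ × ℝ => g z.1 z.2) (uIcc a b ×ˢ U))
    (hg' : ContinuousOn (fun z : ℝ × ℝ => g' z.1 z.2) (uIcc a b ×ˢ U))
    (hd : ∀ x ∈ uIcc a b, ∀ t ∈ U, HasDerivAt (fun s => g x s) (g' x t) t) :
    HasDerivAt (fun t => ∫ x in a..b, g x t) (∫ x in a..b, g' x t₀) t₀ := by
  obtain ⟨ε, hε, hεU⟩ := Metric.nhds_basis_closedBall.mem_iff.1 (hU.mem_nhds ht₀)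
  have hK : IsCompact (uIcc a b ×ˢ Metric.closedBall t₀ ε) :=
    isCompact_uIcc.prod (isCompact_closedBall _ _)
  obtain ⟨C, hC⟩ := hK.exists_bound_of_continuousOn
    (hg'.mono (prod_mono subset_rfl hεU))
  have hsec : ∀ {k : ℝ → ℝ → ℝ},
      ContinuousOn (fun z : ℝ × ℝ => k z.1 z.2) (uIcc a b ×ˢ U) → ∀ t ∈ U,
      ContinuousOn (fun x => k x t) (uIcc a b) := fun {k} hk t ht =>
    hk.comp (f := fun x => (x, t)) (by fun_prop) fun x hx => ⟨hx, ht⟩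
  refine (intervalIntegral.hasDerivAt_integral_of_dominated_loc_of_deriv_le
    (F := fun t x => g x t) (F' := fun t x => g' x t) (bound := fun _ => C)
    (Metric.closedBall_mem_nhds t₀ hε) ?_ ?_ ?_ ?_ ?_ ?_).2
  · filter_upwards [hU.mem_nhds ht₀] with t ht
    exact ((hsec hg t ht).mono uIoc_subset_uIcc).aestronglyMeasurable measurableSet_uIoc
  · exact (hsec hg t₀ ht₀).intervalIntegrable
  · exact ((hsec hg' t₀ ht₀).mono uIoc_subset_uIcc).aestronglyMeasurable measurableSet_uIoc
  · exact ae_of_all _ fun x hx t ht => hC (x, t) ⟨uIoc_subset_uIcc hx, ht⟩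
  · exact intervalIntegrable_const
  · exact ae_of_all _ fun x hx t ht => hd x (uIoc_subset_uIcc hx) t (hεU ht)

/-! ### A local bound for nonnegative subsolutions of the heat equation -/

/-- The one-dimensional heat kernel at time `r`, up to the constant factor `1 / (2 √π)`. -/
noncomputable def heatKernel (y r : ℝ) : ℝ := (√r)⁻¹ * Real.exp (-(y ^ 2 / (4 * r)))

theorem heatKernel_nonneg (y r : ℝ) : 0 ≤ heatKernel y r := by
  unfold heatKernel; positivity

theorem hasDerivAt_heatKernel_space (y : ℝ) {r : ℝ} (hr : 0 < r) :
    HasDerivAt (fun z => heatKernel z r) (-(y / (2 * r)) * heatKernel y r) y := by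
  have h : HasDerivAt (fun z : ℝ => -(z ^ 2 / (4 * r))) (-(2 * y / (4 * r))) y := by
    simpa using (((hasDerivAt_id y).fun_pow 2).div_const (4 * r)).fun_neg
  refine (h.exp.const_mul (√r)⁻¹).congr_deriv ?_
  unfold heatKernel
  field_simp
  ring

theorem hasDerivAt_heatKernel_space_two (y : ℝ) {r : ℝ} (hr : 0 < r) :
    HasDerivAt (fun z => -(z / (2 * r)) * heatKernel z r)
      ((y ^ 2 / (4 * r ^ 2) - 1 / (2 * r)) * heatKernel y r) y := by
  have h : HasDerivAt (fun z : ℝ => -(z / (2 * r))) (-(1 / (2 * r))) y :=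
    ((hasDerivAt_id y).div_const (2 * r)).neg
  refine (h.mul (hasDerivAt_heatKernel_space y hr)).congr_deriv ?_
  field_simp
  ring

theorem hasDerivAt_heatKernel_time (y : ℝ) {r : ℝ} (hr : 0 < r) :
    HasDerivAt (fun s => heatKernel y s)
      ((y ^ 2 / (4 * r ^ 2) - 1 / (2 * r)) * heatKernel y r) r := by
  have h1 : HasDerivAt (fun s : ℝ => (√s)⁻¹) (-(1 / (2 * √r)) / √r ^ 2) r :=
    (Real.hasDerivAt_sqrt hr.ne').inv (Real.sqrt_pos.2 hr).ne'
  have h2 : HasDerivAt (fun s : ℝ => -(y ^ 2 / (4 * s))) (y ^ 2 / (4 * r ^ 2)) r := by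
    have := ((hasDerivAt_inv hr.ne').const_mul (y ^ 2 / 4)).neg
    refine (this.congr_deriv ?_).congr_of_eventuallyEq ?_
    · field_simp
    · exact Eventually.of_forall fun s => by simp only [Pi.neg_apply]; ring
  refine (h1.mul h2.exp).congr_deriv ?_
  unfold heatKernel
  rw [Real.sq_sqrt hr.le]
  have := (Real.sqrt_pos.2 hr).ne'
  field_simp
  ring

theorem continuousOn_heatKernel :
    ContinuousOn (fun z : ℝ × ℝ => heatKernel z.1 z.2) (univ ×ˢ Ioi 0) := by
  unfold heatKernel
  refine ContinuousOn.mul (ContinuousOn.inv₀ (by fun_prop) ?_) ?_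
  · rintro ⟨y, r⟩ ⟨-, hr⟩
    exact (Real.sqrt_pos.2 hr).ne'
  · refine Real.continuous_exp.comp_continuousOn (f := fun z : ℝ × ℝ => -(z.1 ^ 2 / (4 * z.2))) ?_
    refine ContinuousOn.neg (ContinuousOn.div (by fun_prop) (by fun_prop) ?_)
    rintro ⟨y, r⟩ ⟨-, hr⟩
    have : (0 : ℝ) < r := hr
    simp only; positivity

theorem heatKernel_le_of_le {τ r : ℝ} (hτ : 0 < τ) (h : τ ≤ r) (y : ℝ) :
    heatKernel y r ≤ (√τ)⁻¹ := by
  have h1 : (√r)⁻¹ ≤ (√τ)⁻¹ := by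
    gcongr
  have h2 : Real.exp (-(y ^ 2 / (4 * r))) ≤ 1 := by
    rw [Real.exp_le_one_iff]
    have : 0 < r := hτ.trans_le h
    have : 0 ≤ y ^ 2 / (4 * r) := by positivity
    linarith
  calc heatKernel y r ≤ (√τ)⁻¹ * 1 := by unfold heatKernel; gcongr
    _ = _ := mul_one _

/-- Away from the origin the heat kernel is bounded uniformly in time, with room for one more
factor `1 / r`. -/
theorem heatKernel_off_diagonal {y r : ℝ} (hr : 0 < r) (hy : 1 / 2 ≤ |y|) :
    heatKernel y r ≤ 600 ∧ heatKernel y r / r ≤ 600 := by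
  set u := 1 / (16 * r) with hu
  have hu0 : 0 < u := by positivity
  have hr' : 1 / r = 16 * u := by rw [hu]; field_simp
  have h1 : (√r)⁻¹ ≤ 1 + 16 * u := by
    rw [← hr', ← one_div]
    have hs := Real.sqrt_pos.2 hr
    have : 1 / r = (1 / √r) ^ 2 := by
      rw [div_pow, Real.sq_sqrt hr.le]; norm_num
    rw [this]
    nlinarith [sq_nonneg (1 / √r - 1 / 2)]
  have h2 : Real.exp (-(y ^ 2 / (4 * r))) ≤ Real.exp (-u) := by
    rw [Real.exp_le_exp, neg_le_neg_iff, hu, div_le_div_iff₀ (by positivity) (by positivity)]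
    have : 1 / 4 ≤ y ^ 2 := by
      rw [← sq_abs]; nlinarith
    nlinarith
  have hE : Real.exp (-u) * Real.exp u = 1 := by rw [← Real.exp_add]; simp
  have hq := Real.quadratic_le_exp_of_nonneg hu0.le
  have hp := Real.exp_pos (-u)
  have e0 : Real.exp (-u) ≤ 1 := by nlinarith
  have e1 : u * Real.exp (-u) ≤ 1 := by nlinarith
  have e2 : u ^ 2 * Real.exp (-u) ≤ 2 := by nlinarith [mul_le_mul_of_nonneg_left hq hp.le]
  have hk : heatKernel y r ≤ (1 + 16 * u) * Real.exp (-u) := by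
    unfold heatKernel; gcongr
  refine ⟨by nlinarith, ?_⟩
  calc heatKernel y r / r = heatKernel y r * (1 / r) := by ring
    _ ≤ ((1 + 16 * u) * Real.exp (-u)) * (16 * u) := by rw [hr']; gcongr
    _ ≤ 600 := by nlinarith

/-- A cutoff function: it is `1` near the origin and vanishes to first order at the ends of
`[-1, 1]`; its derivatives are supported in `1/2 ≤ |y|`. -/
theorem exists_cutoff : ∃ χ χ₁ χ₂ : ℝ → ℝ, ∃ C : ℝ, 0 ≤ C ∧
    (∀ y, HasDerivAt χ (χ₁ y) y) ∧ (∀ y, HasDerivAt χ₁ (χ₂ y) y) ∧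
    Continuous χ₂ ∧ (∀ y, 0 ≤ χ y) ∧ (∀ y, χ y ≤ 1) ∧
    (∀ y, |y| ≤ 1 / 2 → χ y = 1) ∧ (∀ y, |y| < 1 / 2 → χ₁ y = 0 ∧ χ₂ y = 0) ∧
    (∀ y, 1 ≤ |y| → χ y = 0) ∧ (∀ y, 1 ≤ |y| → χ₁ y = 0 ∧ χ₂ y = 0) ∧
    (∀ y, |χ₁ y| ≤ C ∧ |χ₂ y| ≤ C) := by
  let B : ContDiffBump (0 : ℝ) := ⟨1 / 2, 1, by norm_num, by norm_num⟩
  have hB : ContDiff ℝ 2 (B : ℝ → ℝ) := B.contDiff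
  have hB1 : ContDiff ℝ 1 (deriv (B : ℝ → ℝ)) :=
    ((contDiff_succ_iff_deriv (n := 1)).1 hB).2.2
  have hB2 : Continuous (deriv (deriv (B : ℝ → ℝ))) :=
    hB1.continuous_deriv le_rfl
  have hz : ∀ y : ℝ, 1 ≤ |y| → B y = 0 := fun y hy =>
    B.zero_of_le_dist (by simpa [B] using hy)
  have h1 : ∀ y : ℝ, |y| ≤ 1 / 2 → B y = 1 := fun y hy =>
    B.one_of_mem_closedBall (by simpa [B] using hy)
  have hd : ∀ y, HasDerivAt (B : ℝ → ℝ) (deriv B y) y := fun y =>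
    ((hB.differentiable (by norm_num)) y).hasDerivAt
  have hd1 : ∀ y, HasDerivAt (deriv (B : ℝ → ℝ)) (deriv (deriv B) y) y := fun y =>
    ((hB1.differentiable (by norm_num)) y).hasDerivAt
  have hin : ∀ y : ℝ, |y| < 1 / 2 → deriv B y = 0 ∧ deriv (deriv B) y = 0 := by
    have hopen : IsOpen {y : ℝ | |y| < 1 / 2} := isOpen_lt continuous_abs continuous_const
    have e1 : ∀ y : ℝ, |y| < 1 / 2 → deriv B y = 0 := fun y hy => by
      have : (B : ℝ → ℝ) =ᶠ[𝓝 y] fun _ => 1 := by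
        filter_upwards [hopen.mem_nhds hy] with z hz using h1 z (le_of_lt hz)
      rw [this.deriv_eq]; simp
    refine fun y hy => ⟨e1 y hy, ?_⟩
    have : (deriv B : ℝ → ℝ) =ᶠ[𝓝 y] fun _ => 0 := by
      filter_upwards [hopen.mem_nhds hy] with z hz using e1 z hz
    rw [this.deriv_eq]; simp
  have hout : ∀ y : ℝ, 1 ≤ |y| → deriv B y = 0 ∧ deriv (deriv B) y = 0 := by
    have hopen : IsOpen {y : ℝ | 1 < |y|} := isOpen_lt continuous_const continuous_abs
    have e1 : ∀ y : ℝ, 1 ≤ |y| → deriv B y = 0 := fun y hy => by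
      have : IsLocalMin (B : ℝ → ℝ) y := by
        refine Eventually.of_forall fun z => ?_
        rw [hz y hy]; exact B.nonneg
      exact this.deriv_eq_zero
    have e2 : ∀ y : ℝ, 1 < |y| → deriv (deriv B) y = 0 := fun y hy => by
      have : (deriv B : ℝ → ℝ) =ᶠ[𝓝 y] fun _ => 0 := by
        filter_upwards [hopen.mem_nhds hy] with z hz using e1 z (le_of_lt hz)
      rw [this.deriv_eq]; simp
    refine fun y hy => ⟨e1 y hy, ?_⟩
    have hcl : IsClosed {y : ℝ | deriv (deriv B) y = 0} := isClosed_eq hB2 continuous_const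
    have hsub : closure {y : ℝ | 1 < |y|} ⊆ {y : ℝ | deriv (deriv B) y = 0} :=
      hcl.closure_subset_iff.2 e2
    refine hsub (mem_closure_iff_nhds.2 ?_)
    have hy0 : y ≠ 0 := by rintro rfl; norm_num at hy
    intro t ht
    have hc : Tendsto (fun ε : ℝ => (1 + ε) * y) (𝓝[>] 0) (𝓝 y) := by
      have : Continuous fun ε : ℝ => (1 + ε) * y := by fun_prop
      simpa using (this.tendsto 0).mono_left nhdsWithin_le_nhds
    obtain ⟨ε, h1, h2⟩ := ((hc.eventually ht).and self_mem_nhdsWithin).exists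
    refine ⟨_, h1, ?_⟩
    have h2 : (0 : ℝ) < ε := h2
    simp only [mem_ofPred_eq, abs_mul, abs_of_pos (by linarith : 0 < 1 + ε)]
    nlinarith
  obtain ⟨C₁, hC₁⟩ := (isCompact_Icc (a := (-1 : ℝ)) (b := 1)).exists_bound_of_continuousOn
    hB1.continuous.continuousOn
  obtain ⟨C₂, hC₂⟩ := (isCompact_Icc (a := (-1 : ℝ)) (b := 1)).exists_bound_of_continuousOn
    hB2.continuousOn
  have hC0 : 0 ≤ max C₁ C₂ := ((norm_nonneg _).trans (hC₁ 0 (by norm_num))).trans (le_max_left _ _)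
  refine ⟨B, deriv B, deriv (deriv B), max C₁ C₂, hC0, hd, hd1, hB2, fun y => B.nonneg,
    fun y => B.le_one, h1, hin, hz, hout, fun y => ?_⟩
  by_cases hy : 1 ≤ |y|
  · rw [(hout y hy).1, (hout y hy).2]; simpa using hC0
  · have hy' : y ∈ Icc (-1 : ℝ) 1 := abs_le.1 (not_le.1 hy).le
    exact ⟨(hC₁ y hy').trans (le_max_left _ _), (hC₂ y hy').trans (le_max_right _ _)⟩

theorem tendsto_integral_mul_heatKernel {g : ℝ → ℝ} (hg : Continuous g) {C : ℝ}
    (hC : ∀ y, |g y| ≤ C) :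
    Tendsto (fun δ : ℝ => ∫ y, g y * heatKernel y (δ ^ 2)) (𝓝[>] 0)
      (𝓝 (g 0 * √(π / (1 / 4)))) := by
  have hgauss : Integrable fun z : ℝ => Real.exp (-(1 / 4) * z ^ 2) :=
    integrable_exp_neg_mul_sq (by norm_num)
  have key : ∀ δ : ℝ, 0 < δ → ∫ y, g y * heatKernel y (δ ^ 2)
      = ∫ z, g (δ * z) * Real.exp (-(1 / 4) * z ^ 2) := by
    intro δ hδ
    have h := Measure.integral_comp_mul_left (fun y => g y * heatKernel y (δ ^ 2)) δ
    rw [abs_of_pos (inv_pos.2 hδ), smul_eq_mul] at h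
    rw [← mul_right_inj' (inv_ne_zero hδ.ne'), ← h, ← integral_const_mul]
    refine integral_congr_ae (ae_of_all _ fun z => ?_)
    simp only [heatKernel, Real.sqrt_sq hδ.le]
    have : (δ * z) ^ 2 / (4 * δ ^ 2) = 1 / 4 * z ^ 2 := by field_simp
    rw [this, neg_mul]; ring
  have hlim : Tendsto (fun δ : ℝ => ∫ z, g (δ * z) * Real.exp (-(1 / 4) * z ^ 2)) (𝓝[>] 0)
      (𝓝 (∫ z, g 0 * Real.exp (-(1 / 4) * z ^ 2))) := by
    refine tendsto_integral_filter_of_dominated_convergence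
      (fun z => C * Real.exp (-(1 / 4) * z ^ 2)) ?_ ?_ (hgauss.const_mul C) ?_
    · refine Eventually.of_forall fun δ => Continuous.aestronglyMeasurable ?_
      fun_prop
    · refine Eventually.of_forall fun δ => ae_of_all _ fun z => ?_
      rw [norm_mul, Real.norm_eq_abs, Real.norm_eq_abs, Real.abs_exp]
      gcongr
      exact hC _
    · refine ae_of_all _ fun z => ?_
      have : Continuous fun δ : ℝ => g (δ * z) * Real.exp (-(1 / 4) * z ^ 2) := by fun_prop
      simpa using (this.tendsto 0).mono_left nhdsWithin_le_nhds
  rw [integral_const_mul, integral_gaussian] at hlim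
  refine hlim.congr' ?_
  filter_upwards [self_mem_nhdsWithin] with δ hδ using (key δ hδ).symm

theorem ContinuousOn.slice_left {g : ℝ → ℝ → ℝ}
    (hg : ContinuousOn (fun z : ℝ × ℝ => g z.1 z.2) (univ ×ˢ Ioi 0)) {t : ℝ} (ht : 0 < t) :
    Continuous fun x => g x t :=
  hg.comp_continuous (f := fun x => (x, t)) (by fun_prop) fun _ => ⟨mem_univ _, ht⟩

/-- Bound at the origin for nonnegative subsolutions of the heat equation. The subsolution is
tested against the backward heat kernel times a cutoff; the commutator with the cutoff only
involves the kernel away from its pole, where it is bounded. -/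
theorem heat_subsolution_bound_zero {τ : ℝ} (hτ : 0 < τ) : ∃ C : ℝ, 0 ≤ C ∧
    ∀ h hₜ h₁ h₂ : ℝ → ℝ → ℝ,
    ContinuousOn (fun z : ℝ × ℝ => h z.1 z.2) (univ ×ˢ Ioi 0) →
    ContinuousOn (fun z : ℝ × ℝ => hₜ z.1 z.2) (univ ×ˢ Ioi 0) →
    (∀ y t, 0 < t → HasDerivAt (fun s => h y s) (hₜ y t) t) →
    (∀ y t, 0 < t → HasDerivAt (fun x => h x t) (h₁ y t) y) →
    (∀ y t, 0 < t → HasDerivAt (fun x => h₁ x t) (h₂ y t) y) →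
    (∀ t, 0 < t → Continuous fun y => h₂ y t) →
    (∀ y t, 0 < t → 0 ≤ h y t) →
    (∀ y t, 0 < t → hₜ y t ≤ h₂ y t) →
    ∀ s₀ t₀ : ℝ, 0 < s₀ → s₀ + τ ≤ t₀ →
      h 0 t₀ ≤ C * ((∫ y in (-1)..1, h y s₀) + ∫ s in s₀..t₀, ∫ y in (-1)..1, h y s) := by
  obtain ⟨χ, χ₁, χ₂, C, hC0, hχ, hχ₁, hχ₂, hχnn, hχle, hχin, hχ₁in, hχout, hχ₁out, hχC⟩ :=
    exists_cutoff
  refine ⟨(√τ)⁻¹ + 1200 * C, by positivity, ?_⟩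
  intro h hₜ h₁ h₂ hc hct hdt hd1 hd2 hc2 hnn hsub s₀ t₀ hs₀ hst
  have hst' : s₀ ≤ t₀ := by linarith
  have ht₀ : 0 < t₀ := hs₀.trans_le hst'
  have hχc : Continuous χ := continuous_iff_continuousAt.2 fun y => (hχ y).continuousAt
  have hχ₁c : Continuous χ₁ := continuous_iff_continuousAt.2 fun y => (hχ₁ y).continuousAt
  have hhc : ∀ t, 0 < t → Continuous fun y => h y t := fun t ht => ContinuousOn.slice_left hc ht
  have hmc : ContinuousOn (fun s => ∫ y in (-1 : ℝ)..1, h y s) (Ioi 0) :=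
    continuousOn_intervalIntegral_param (hc.mono (prod_mono (subset_univ _) subset_rfl))
  have hm0 : ∀ s, 0 < s → 0 ≤ ∫ y in (-1 : ℝ)..1, h y s := fun s hs =>
    intervalIntegral.integral_nonneg (by norm_num) fun y _ => hnn y s hs
  -- the bound for the approximate point evaluation
  have main : ∀ δ : ℝ, 0 < δ → ∫ y in (-1 : ℝ)..1, h y t₀ * (χ y * heatKernel y (δ ^ 2))
      ≤ (√τ)⁻¹ * (∫ y in (-1 : ℝ)..1, h y s₀)
        + 1200 * C * ∫ s in s₀..t₀, ∫ y in (-1 : ℝ)..1, h y s := by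
    intro δ hδ
    set U : Set ℝ := Ioo 0 (t₀ + δ ^ 2) with hU
    have hUo : IsOpen U := isOpen_Ioo
    have hδ2 : 0 < δ ^ 2 := by positivity
    have hr : ∀ s ∈ U, 0 < t₀ - s + δ ^ 2 := fun s hs => by linarith [hs.2]
    set ψ : ℝ → ℝ → ℝ := fun y s => χ y * heatKernel y (t₀ - s + δ ^ 2) with hψ
    set ψₜ : ℝ → ℝ → ℝ := fun y s => -(χ y * ((y ^ 2 / (4 * (t₀ - s + δ ^ 2) ^ 2)
      - 1 / (2 * (t₀ - s + δ ^ 2))) * heatKernel y (t₀ - s + δ ^ 2))) with hψₜ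
    have hkc : ContinuousOn (fun z : ℝ × ℝ => heatKernel z.1 (t₀ - z.2 + δ ^ 2))
        (uIcc (-1) 1 ×ˢ U) :=
      continuousOn_heatKernel.comp (f := fun z : ℝ × ℝ => (z.1, t₀ - z.2 + δ ^ 2))
        (by fun_prop) fun z hz => ⟨mem_univ _, hr z.2 hz.2⟩
    have hsubU : uIcc (-1 : ℝ) 1 ×ˢ U ⊆ univ ×ˢ Ioi 0 :=
      prod_mono (subset_univ _) fun s hs => hs.1
    have hψc : ContinuousOn (fun z : ℝ × ℝ => ψ z.1 z.2) (uIcc (-1) 1 ×ˢ U) :=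
      (hχc.comp continuous_fst).continuousOn.mul hkc
    have hψₜc : ContinuousOn (fun z : ℝ × ℝ => ψₜ z.1 z.2) (uIcc (-1) 1 ×ˢ U) := by
      refine ((hχc.comp continuous_fst).continuousOn.mul (ContinuousOn.mul ?_ hkc)).neg
      refine ContinuousOn.sub (ContinuousOn.div (by fun_prop) (by fun_prop) ?_)
        (ContinuousOn.div (by fun_prop) (by fun_prop) ?_)
      all_goals
        intro z hz
        have := hr z.2 hz.2
        positivity
    have hψd : ∀ y, ∀ s ∈ U, HasDerivAt (fun s => ψ y s) (ψₜ y s) s := by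
      intro y s hs
      have h1 := hasDerivAt_heatKernel_time y (hr s hs)
      have h2 : HasDerivAt (fun s : ℝ => t₀ - s + δ ^ 2) (-1) s :=
        ((hasDerivAt_id s).const_sub t₀).add_const _
      refine ((h1.comp s h2).const_mul (χ y)).congr_deriv ?_
      simp only [hψₜ]; ring
    have hG : ∀ s ∈ U, HasDerivAt (fun s => ∫ y in (-1 : ℝ)..1, h y s * ψ y s)
        (∫ y in (-1 : ℝ)..1, (hₜ y s * ψ y s + h y s * ψₜ y s)) s := by
      intro s hs
      exact hasDerivAt_intervalIntegral_param hUo hs ((hc.mono hsubU).mul hψc)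
        (((hct.mono hsubU).mul hψc).add ((hc.mono hsubU).mul hψₜc))
        fun y _ s hs => (hdt y s hs.1).mul (hψd y s hs)
    have hG' : ∀ s ∈ U, ∫ y in (-1 : ℝ)..1, (hₜ y s * ψ y s + h y s * ψₜ y s)
        ≤ 1200 * C * ∫ y in (-1 : ℝ)..1, h y s := by
      intro s hs
      have hs0 : 0 < s := hs.1
      set r := t₀ - s + δ ^ 2 with hrdef
      have hr0 : 0 < r := hr s hs
      have hk1 := fun y => hasDerivAt_heatKernel_space y hr0
      have hk2 := fun y => hasDerivAt_heatKernel_space_two y hr0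
      have hkyc : Continuous fun y => heatKernel y r :=
        continuous_iff_continuousAt.2 fun y => (hk1 y).continuousAt
      have hp1 : ∀ y, HasDerivAt (fun y => χ y * heatKernel y r)
          (χ₁ y * heatKernel y r + χ y * (-(y / (2 * r)) * heatKernel y r)) y := fun y =>
        (hχ y).mul (hk1 y)
      have hp2 : ∀ y, HasDerivAt
          (fun y => χ₁ y * heatKernel y r + χ y * (-(y / (2 * r)) * heatKernel y r))
          (χ₂ y * heatKernel y r + 2 * (χ₁ y * (-(y / (2 * r)) * heatKernel y r))
            + χ y * ((y ^ 2 / (4 * r ^ 2) - 1 / (2 * r)) * heatKernel y r)) y := fun y =>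
        (((hχ₁ y).mul (hk1 y)).add ((hχ y).mul (hk2 y))).congr_deriv (by ring)
      have hbig : ∀ y, HasDerivAt (fun y => h₁ y s * (χ y * heatKernel y r)
          - h y s * (χ₁ y * heatKernel y r + χ y * (-(y / (2 * r)) * heatKernel y r)))
          (h₂ y s * (χ y * heatKernel y r) - h y s *
            (χ₂ y * heatKernel y r + 2 * (χ₁ y * (-(y / (2 * r)) * heatKernel y r))
            + χ y * ((y ^ 2 / (4 * r ^ 2) - 1 / (2 * r)) * heatKernel y r))) y := fun y =>
        (((hd2 y s hs0).mul (hp1 y)).sub ((hd1 y s hs0).mul (hp2 y))).congr_deriv (by ring)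
      have hcs := hc2 s hs0
      have hhs := hhc s hs0
      have hbigc : Continuous fun y => h₂ y s * (χ y * heatKernel y r) - h y s *
            (χ₂ y * heatKernel y r + 2 * (χ₁ y * (-(y / (2 * r)) * heatKernel y r))
            + χ y * ((y ^ 2 / (4 * r ^ 2) - 1 / (2 * r)) * heatKernel y r)) := by
        fun_prop
      have hzero := intervalIntegral.integral_eq_sub_of_hasDerivAt (a := -1) (b := 1)
        (fun y _ => hbig y) (hbigc.intervalIntegrable _ _)
      rw [hχout 1 (by norm_num), hχout (-1) (by norm_num), (hχ₁out 1 (by norm_num)).1,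
        (hχ₁out (-1) (by norm_num)).1] at hzero
      simp only [zero_mul, mul_zero, add_zero, sub_zero] at hzero
      rw [← add_zero (1200 * C * _), ← hzero, ← intervalIntegral.integral_const_mul,
        ← intervalIntegral.integral_add ((hhs.const_mul _).intervalIntegrable _ _)
          (hbigc.intervalIntegrable _ _)]
      have hsl : ∀ {k : ℝ → ℝ → ℝ},
          ContinuousOn (fun z : ℝ × ℝ => k z.1 z.2) (uIcc (-1) 1 ×ˢ U) →
          ContinuousOn (fun x => k x s) (uIcc (-1) 1) := fun {k} hk =>
        hk.comp (f := fun x => (x, s)) (by fun_prop) fun x hx => ⟨hx, hs⟩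
      refine intervalIntegral.integral_mono_on (by norm_num) ?_ ?_ ?_
      · exact (hsl (k := fun y s => hₜ y s * ψ y s + h y s * ψₜ y s)
          (((hct.mono hsubU).mul hψc).add ((hc.mono hsubU).mul hψₜc))).intervalIntegrable
      · exact ((hhs.const_mul _).add hbigc).intervalIntegrable _ _
      · intro y hy
        have hk0 := heatKernel_nonneg y r
        have hψ0 : 0 ≤ χ y * heatKernel y r := mul_nonneg (hχnn y) hk0
        have hy1 : |y| ≤ 1 := abs_le.2 hy
        have hcomm : |χ₂ y * heatKernel y r + 2 * (χ₁ y * (-(y / (2 * r)) * heatKernel y r))|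
            ≤ 1200 * C := by
          by_cases hy2 : |y| < 1 / 2
          · rw [(hχ₁in y hy2).1, (hχ₁in y hy2).2]; simp; positivity
          · obtain ⟨b1, b2⟩ := heatKernel_off_diagonal hr0 (not_lt.1 hy2)
            have e : 2 * (χ₁ y * (-(y / (2 * r)) * heatKernel y r))
                = -(χ₁ y * (y * (heatKernel y r / r))) := by field_simp
            have hk0' : 0 ≤ heatKernel y r / r := by positivity
            calc _ ≤ |χ₂ y * heatKernel y r|
                  + |2 * (χ₁ y * (-(y / (2 * r)) * heatKernel y r))| := abs_add_le _ _
              _ = |χ₂ y| * heatKernel y r + |χ₁ y| * (|y| * (heatKernel y r / r)) := by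
                  rw [e, abs_neg, abs_mul, abs_mul, abs_mul, abs_of_nonneg hk0,
                    abs_of_nonneg hk0']
              _ ≤ C * 600 + C * (1 * 600) := by
                  gcongr
                  · exact (hχC y).2
                  · exact (hχC y).1
              _ = 1200 * C := by ring
        have h1 : hₜ y s * (χ y * heatKernel y r) ≤ h₂ y s * (χ y * heatKernel y r) :=
          mul_le_mul_of_nonneg_right (hsub y s hs0) hψ0
        have h2 : -(1200 * C * h y s) ≤ h y s *
            (χ₂ y * heatKernel y r + 2 * (χ₁ y * (-(y / (2 * r)) * heatKernel y r))) ∧ h y s *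
            (χ₂ y * heatKernel y r + 2 * (χ₁ y * (-(y / (2 * r)) * heatKernel y r)))
            ≤ 1200 * C * h y s := by
          rw [← abs_le, abs_mul, abs_of_nonneg (hnn y s hs0), mul_comm]
          exact mul_le_mul_of_nonneg_right hcomm (hnn y s hs0)
        simp only [hψ, hψₜ]
        linarith [h2.2]
    -- hence the tested mass minus its bound is nonincreasing in time
    have hIU : Icc s₀ t₀ ⊆ U := fun s hs => ⟨hs₀.trans_le hs.1, by linarith [hs.2]⟩
    have hanti : AntitoneOn (fun s => (∫ y in (-1 : ℝ)..1, h y s * ψ y s)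
        - 1200 * C * ∫ σ in s₀..s, ∫ y in (-1 : ℝ)..1, h y σ) (Icc s₀ t₀) := by
      have hder : ∀ s ∈ Icc s₀ t₀, HasDerivAt (fun s => (∫ y in (-1 : ℝ)..1, h y s * ψ y s)
          - 1200 * C * ∫ σ in s₀..s, ∫ y in (-1 : ℝ)..1, h y σ)
          ((∫ y in (-1 : ℝ)..1, (hₜ y s * ψ y s + h y s * ψₜ y s))
            - 1200 * C * ∫ y in (-1 : ℝ)..1, h y s) s := by
        intro s hs
        refine (hG s (hIU hs)).sub (HasDerivAt.const_mul _ ?_)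
        have hs0 : 0 < s := hs₀.trans_le hs.1
        refine intervalIntegral.integral_hasDerivAt_right ?_ ?_ ?_
        · refine (hmc.mono fun σ hσ => ?_).intervalIntegrable
          rw [uIcc_of_le hs.1] at hσ
          exact hs₀.trans_le hσ.1
        · exact hmc.stronglyMeasurableAtFilter isOpen_Ioi s hs0
        · exact hmc.continuousAt (Ioi_mem_nhds hs0)
      refine antitoneOn_of_deriv_nonpos (convex_Icc _ _)
        (fun s hs => (hder s hs).continuousAt.continuousWithinAt) ?_ ?_
      · intro s hs
        exact (hder s (interior_subset hs)).differentiableAt.differentiableWithinAt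
      · intro s hs
        rw [(hder s (interior_subset hs)).deriv]
        linarith [hG' s (hIU (interior_subset hs))]
    have hle := hanti (left_mem_Icc.2 hst') (right_mem_Icc.2 hst') hst'
    simp only [hψ, intervalIntegral.integral_same, mul_zero, sub_zero, sub_self, zero_add] at hle
    have hstart : ∫ y in (-1 : ℝ)..1, h y s₀ * (χ y * heatKernel y (t₀ - s₀ + δ ^ 2))
        ≤ (√τ)⁻¹ * ∫ y in (-1 : ℝ)..1, h y s₀ := by
      rw [← intervalIntegral.integral_const_mul]
      have hr0 : 0 < t₀ - s₀ + δ ^ 2 := by linarith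
      have hkyc : Continuous fun y => heatKernel y (t₀ - s₀ + δ ^ 2) :=
        continuous_iff_continuousAt.2 fun y => (hasDerivAt_heatKernel_space y hr0).continuousAt
      have hhs := hhc s₀ hs₀
      refine intervalIntegral.integral_mono_on (by norm_num)
        (Continuous.intervalIntegrable (by fun_prop) _ _)
        (Continuous.intervalIntegrable (by fun_prop) _ _) fun y _ => ?_
      rw [mul_comm]
      refine mul_le_mul_of_nonneg_right ?_ (hnn y s₀ hs₀)
      calc χ y * heatKernel y (t₀ - s₀ + δ ^ 2) ≤ 1 * (√τ)⁻¹ :=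
            mul_le_mul (hχle y) (heatKernel_le_of_le hτ (by linarith) y) (heatKernel_nonneg _ _)
              zero_le_one
        _ = _ := one_mul _
    linarith
  -- the limit `δ → 0`
  have hgc : Continuous fun y => h y t₀ * χ y := (hhc t₀ ht₀).mul hχc
  have hsupp : ∀ y, y ∉ Ioc (-1 : ℝ) 1 → χ y = 0 := fun y hy => hχout y (by
    by_contra hcon
    have := abs_lt.1 (not_le.1 hcon)
    exact hy ⟨this.1, this.2.le⟩)
  obtain ⟨D, hD⟩ := (isCompact_Icc (a := (-1 : ℝ)) (b := 1)).exists_bound_of_continuousOn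
    hgc.continuousOn
  have hDb : ∀ y, |h y t₀ * χ y| ≤ D := by
    intro y
    by_cases hy : y ∈ Ioc (-1 : ℝ) 1
    · exact hD y (Ioc_subset_Icc_self hy)
    · rw [hsupp y hy, mul_zero, abs_zero]
      exact (norm_nonneg _).trans (hD 0 (by norm_num))
  have hlim := tendsto_integral_mul_heatKernel hgc hDb
  have hle := le_of_tendsto hlim (b := (√τ)⁻¹ * (∫ y in (-1 : ℝ)..1, h y s₀)
        + 1200 * C * ∫ s in s₀..t₀, ∫ y in (-1 : ℝ)..1, h y s) (by
    filter_upwards [self_mem_nhdsWithin] with δ hδ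
    refine le_trans (le_of_eq ?_) (main δ hδ)
    rw [intervalIntegral.integral_of_le (by norm_num),
      ← integral_indicator measurableSet_Ioc]
    refine integral_congr_ae (ae_of_all _ fun y => ?_)
    by_cases hy : y ∈ Ioc (-1 : ℝ) 1
    · simp only [indicator_of_mem hy]; ring
    · simp only [indicator_of_notMem hy, hsupp y hy]; ring)
  rw [hχin 0 (by norm_num), mul_one] at hle
  have hsq : 1 ≤ √(π / (1 / 4)) := by
    rw [Real.one_le_sqrt]
    linarith [Real.pi_gt_three]
  have h3 : h 0 t₀ * 1 ≤ h 0 t₀ * √(π / (1 / 4)) :=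
    mul_le_mul_of_nonneg_left hsq (hnn 0 t₀ ht₀)
  have hI : 0 ≤ ∫ s in s₀..t₀, ∫ y in (-1 : ℝ)..1, h y s :=
    intervalIntegral.integral_nonneg hst' fun s hs => hm0 s (hs₀.trans_le hs.1)
  have hτ' : 0 ≤ (√τ)⁻¹ := by positivity
  nlinarith [mul_nonneg hτ' hI, mul_nonneg hC0 (hm0 s₀ hs₀)]

/-- A nonnegative subsolution of `∂h/∂t = ∂²h/∂x² + κ h` is bounded at a point by its mass on a
unit neighbourhood at an earlier time and in between. The constant only depends on the time lag. -/
theorem heat_subsolution_bound {τ : ℝ} (hτ : 0 < τ) (T : ℝ) {κ : ℝ} (hκ : 0 ≤ κ) : ∃ C : ℝ, 0 ≤ C ∧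
    ∀ h hₜ h₁ h₂ : ℝ → ℝ → ℝ,
    ContinuousOn (fun z : ℝ × ℝ => h z.1 z.2) (univ ×ˢ Ioi 0) →
    ContinuousOn (fun z : ℝ × ℝ => hₜ z.1 z.2) (univ ×ˢ Ioi 0) →
    (∀ y t, 0 < t → HasDerivAt (fun s => h y s) (hₜ y t) t) →
    (∀ y t, 0 < t → HasDerivAt (fun x => h x t) (h₁ y t) y) →
    (∀ y t, 0 < t → HasDerivAt (fun x => h₁ x t) (h₂ y t) y) →
    (∀ t, 0 < t → Continuous fun y => h₂ y t) →
    (∀ y t, 0 < t → 0 ≤ h y t) →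
    (∀ y t, 0 < t → hₜ y t ≤ h₂ y t + κ * h y t) →
    ∀ x₀ s₀ t₀ : ℝ, 0 < s₀ → s₀ + τ ≤ t₀ → t₀ ≤ s₀ + T →
      h x₀ t₀ ≤ C * ((∫ y in (x₀ - 1)..(x₀ + 1), h y s₀)
        + ∫ s in s₀..t₀, ∫ y in (x₀ - 1)..(x₀ + 1), h y s) := by
  obtain ⟨C, hC0, hC⟩ := heat_subsolution_bound_zero hτ
  refine ⟨Real.exp (κ * T) * C, by positivity, ?_⟩
  intro h hₜ h₁ h₂ hc hct hdt hd1 hd2 hc2 hnn hsub x₀ s₀ t₀ hs₀ hst htT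
  have hst' : s₀ ≤ t₀ := by linarith
  set e : ℝ → ℝ := fun s => Real.exp (-(κ * (s - s₀))) with he
  have hec : Continuous e := by fun_prop
  have hed : ∀ s, HasDerivAt e (-κ * e s) s := fun s => by
    have : HasDerivAt (fun s : ℝ => -(κ * (s - s₀))) (-κ) s := by
      simpa using (((hasDerivAt_id s).sub_const s₀).const_mul κ).fun_neg
    exact this.exp.congr_deriv (by rw [mul_comm])
  have hepos : ∀ s, 0 < e s := fun s => Real.exp_pos _
  have hshift : ∀ {k : ℝ → ℝ → ℝ}, ContinuousOn (fun z : ℝ × ℝ => k z.1 z.2) (univ ×ˢ Ioi 0) →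
      ContinuousOn (fun z : ℝ × ℝ => k (x₀ + z.1) z.2) (univ ×ˢ Ioi 0) := fun {k} hk =>
    hk.comp (f := fun z : ℝ × ℝ => (x₀ + z.1, z.2)) (by fun_prop) fun z hz => ⟨mem_univ _, hz.2⟩
  have hecon : ContinuousOn (fun z : ℝ × ℝ => e z.2) (univ ×ˢ Ioi 0) := by fun_prop
  have key := hC (fun y s => e s * h (x₀ + y) s)
    (fun y s => -κ * e s * h (x₀ + y) s + e s * hₜ (x₀ + y) s)
    (fun y s => e s * h₁ (x₀ + y) s) (fun y s => e s * h₂ (x₀ + y) s)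
    (hecon.mul (hshift hc))
    (((continuousOn_const.mul hecon).mul (hshift hc)).add (hecon.mul (hshift hct)))
    (fun y t ht => (hed t).mul (hdt (x₀ + y) t ht))
    (fun y t ht => ((hd1 (x₀ + y) t ht).comp_const_add x₀ y).const_mul _)
    (fun y t ht => ((hd2 (x₀ + y) t ht).comp_const_add x₀ y).const_mul _)
    (fun t ht => by have := hc2 t ht; fun_prop)
    (fun y t ht => mul_nonneg (hepos t).le (hnn _ t ht))
    (fun y t ht => by nlinarith [mul_le_mul_of_nonneg_left (hsub (x₀ + y) t ht) (hepos t).le])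
    s₀ t₀ hs₀ hst
  have hsl : ∀ s, 0 < s → Continuous fun y => h (x₀ + y) s := fun s hs =>
    (ContinuousOn.slice_left hc hs).comp (by fun_prop)
  have hint : ∀ s, s₀ ≤ s → ∫ y in (-1 : ℝ)..1, e s * h (x₀ + y) s
      ≤ ∫ y in (x₀ - 1)..(x₀ + 1), h y s := by
    intro s hs
    have hs0 : 0 < s := hs₀.trans_le hs
    have e1 : ∫ y in (x₀ - 1)..(x₀ + 1), h y s = ∫ y in (-1 : ℝ)..1, h (x₀ + y) s := by
      rw [intervalIntegral.integral_comp_add_left (fun y => h y s)]; rfl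
    rw [e1]
    refine intervalIntegral.integral_mono_on (by norm_num)
      (((hsl s hs0).const_mul _).intervalIntegrable _ _) ((hsl s hs0).intervalIntegrable _ _)
      fun y _ => mul_le_of_le_one_left (hnn _ s hs0) ?_
    rw [he, Real.exp_le_one_iff]
    nlinarith
  have hsubI : ∀ a b : ℝ, uIcc a b ×ˢ Ioi (0 : ℝ) ⊆ univ ×ˢ Ioi 0 := fun a b =>
    prod_mono (subset_univ _) subset_rfl
  have hIcc : uIcc s₀ t₀ ⊆ Ioi 0 := by
    rw [uIcc_of_le hst']; exact fun s hs => hs₀.trans_le hs.1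
  have hint2 : ∫ s in s₀..t₀, ∫ y in (-1 : ℝ)..1, e s * h (x₀ + y) s
      ≤ ∫ s in s₀..t₀, ∫ y in (x₀ - 1)..(x₀ + 1), h y s := by
    refine intervalIntegral.integral_mono_on hst' ?_ ?_ fun s hs => hint s hs.1
    · exact ((continuousOn_intervalIntegral_param (g := fun y s => e s * h (x₀ + y) s)
        ((hecon.mul (hshift hc)).mono (hsubI _ _))).mono hIcc).intervalIntegrable
    · exact ((continuousOn_intervalIntegral_param
        (hc.mono (hsubI _ _))).mono hIcc).intervalIntegrable
  have h1 : e t₀ * h x₀ t₀ ≤ C * ((∫ y in (x₀ - 1)..(x₀ + 1), h y s₀)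
        + ∫ s in s₀..t₀, ∫ y in (x₀ - 1)..(x₀ + 1), h y s) := by
    simp only [add_zero] at key
    refine key.trans (mul_le_mul_of_nonneg_left (add_le_add (hint s₀ le_rfl) hint2) hC0)
  have h2 : Real.exp (κ * T) * e t₀ ≥ 1 := by
    rw [he, ← Real.exp_add, ge_iff_le, Real.one_le_exp_iff]
    nlinarith
  calc h x₀ t₀ ≤ (Real.exp (κ * T) * e t₀) * h x₀ t₀ :=
        le_mul_of_one_le_left (hnn _ _ (hs₀.trans_le hst')) h2
    _ = Real.exp (κ * T) * (e t₀ * h x₀ t₀) := by ring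
    _ ≤ _ := by
      rw [mul_assoc]
      exact mul_le_mul_of_nonneg_left h1 (Real.exp_pos _).le

theorem Periodic.exists_abs_le {g : ℝ → ℝ} (hp : Function.Periodic g 1) (hg : Continuous g) :
    ∃ K : ℝ, 0 ≤ K ∧ ∀ x, |g x| ≤ K := by
  obtain ⟨K, hK⟩ := (isCompact_Icc (a := (0 : ℝ)) (b := 1)).exists_bound_of_continuousOn
    hg.continuousOn
  refine ⟨K, (norm_nonneg _).trans (hK 0 (by norm_num)), fun x => ?_⟩
  obtain ⟨y, hy, hxy⟩ := hp.exists_mem_Ico₀ one_pos x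
  rw [hxy]
  exact hK y ⟨hy.1, hy.2.le⟩

theorem Periodic.deriv {g : ℝ → ℝ} (hp : Function.Periodic g 1) :
    Function.Periodic (deriv g) 1 := fun x => by
  rw [← deriv_comp_add_const]
  congr 1
  exact funext hp

/-! ### Flux solutions of the Fokker-Planck equation -/

/-- `p` solves `∂p/∂t = ∂F/∂x` on `ℝ × (0, ∞)` with `F = (φ' - f) p + ∂p/∂x`; here `pₜ` is the
time derivative of `p`, and `p`, `pₜ` are jointly continuous. This is the Fokker-Planck equation
as a first order system. -/
structure IsFluxSolution (φ : ℝ → ℝ) (f : ℝ) (p pₜ F : ℝ → ℝ → ℝ) : Prop where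
  continuousOn : ContinuousOn (fun z : ℝ × ℝ => p z.1 z.2) (univ ×ˢ Ioi 0)
  continuousOn_time : ContinuousOn (fun z : ℝ × ℝ => pₜ z.1 z.2) (univ ×ˢ Ioi 0)
  time : ∀ x t, 0 < t → HasDerivAt (fun s => p x s) (pₜ x t) t
  space : ∀ x t, 0 < t → HasDerivAt (fun y => p y t) (F x t - (deriv φ x - f) * p x t) x
  flux : ∀ x t, 0 < t → HasDerivAt (fun y => F y t) (pₜ x t) x

section Weight

variable {φ : ℝ → ℝ} {f : ℝ}

/-- The weight `exp ((φ x - f x) / 2)` which removes the drift term. -/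
noncomputable def halfWeight (φ : ℝ → ℝ) (f x : ℝ) : ℝ := Real.exp ((φ x - f * x) / 2)

theorem halfWeight_pos (x : ℝ) : 0 < halfWeight φ f x := Real.exp_pos _

theorem hasDerivAt_phi (hφ : ContDiff ℝ 2 φ) (x : ℝ) : HasDerivAt φ (deriv φ x) x :=
  (hφ.differentiable (by norm_num) x).hasDerivAt

theorem contDiff_deriv_phi (hφ : ContDiff ℝ 2 φ) : ContDiff ℝ 1 (deriv φ) :=
  ((contDiff_succ_iff_deriv (n := 1)).1 hφ).2.2

theorem hasDerivAt_deriv_phi (hφ : ContDiff ℝ 2 φ) (x : ℝ) :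
    HasDerivAt (deriv φ) (deriv (deriv φ) x) x :=
  ((contDiff_deriv_phi hφ).differentiable (by norm_num) x).hasDerivAt

theorem hasDerivAt_halfWeight (hφ : ContDiff ℝ 2 φ) (x : ℝ) :
    HasDerivAt (halfWeight φ f) (halfWeight φ f x * ((deriv φ x - f) / 2)) x := by
  have h : HasDerivAt (fun x => (φ x - f * x) / 2) ((deriv φ x - f) / 2) x := by
    simpa using ((hasDerivAt_phi hφ x).fun_sub ((hasDerivAt_id x).const_mul f)).div_const 2
  exact h.exp

theorem continuous_halfWeight (hφ : ContDiff ℝ 2 φ) : Continuous (halfWeight φ f) :=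
  continuous_iff_continuousAt.2 fun x => (hasDerivAt_halfWeight hφ x).continuousAt

/-- The weight is not periodic, but its oscillation over unit distances is bounded. -/
theorem exists_halfWeight_le (hφ : ContDiff ℝ 2 φ) (hper : Function.Periodic φ 1) (f : ℝ) :
    ∃ L : ℝ, 0 < L ∧ ∀ x y, |y - x| ≤ 1 → halfWeight φ f y ≤ L * halfWeight φ f x := by
  obtain ⟨K, hK0, hK⟩ := Periodic.exists_abs_le hper hφ.continuous
  refine ⟨Real.exp (K + |f|), Real.exp_pos _, fun x y hxy => ?_⟩
  unfold halfWeight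
  rw [← Real.exp_add, Real.exp_le_exp]
  have h1 := abs_le.1 (hK x)
  have h2 := abs_le.1 (hK y)
  have h3 : |f * (y - x)| ≤ |f| := by
    rw [abs_mul]; exact mul_le_of_le_one_right (abs_nonneg _) hxy
  have h4 := abs_le.1 h3
  have h5 := abs_nonneg f
  linarith [h1.1, h2.2, h4.1]

end Weight

section LocalBounds

variable {φ : ℝ → ℝ} {f : ℝ} {p pₜ F : ℝ → ℝ → ℝ}

theorem IsFluxSolution.continuous_slice (hp : IsFluxSolution φ f p pₜ F) {t : ℝ} (ht : 0 < t) :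
    Continuous fun x => p x t := ContinuousOn.slice_left hp.continuousOn ht

theorem IsFluxSolution.continuous_slice_time (hp : IsFluxSolution φ f p pₜ F) {t : ℝ}
    (ht : 0 < t) : Continuous fun x => pₜ x t := ContinuousOn.slice_left hp.continuousOn_time ht

theorem IsFluxSolution.continuous_flux (hp : IsFluxSolution φ f p pₜ F) {t : ℝ} (ht : 0 < t) :
    Continuous fun x => F x t :=
  continuous_iff_continuousAt.2 fun x => (hp.flux x t ht).continuousAt

/-- `v = exp ((φ - f x) / 2) p` solves `∂v/∂t = ∂²v/∂x² - c v`, where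
`c = (φ' - f)² / 4 - φ'' / 2`: these are its first two space derivatives. -/
theorem IsFluxSolution.hasDerivAt_weighted (hφ : ContDiff ℝ 2 φ) (hp : IsFluxSolution φ f p pₜ F)
    {t : ℝ} (ht : 0 < t) (x : ℝ) :
    HasDerivAt (fun y => halfWeight φ f y * p y t)
      (halfWeight φ f x * (F x t - (deriv φ x - f) / 2 * p x t)) x ∧
    HasDerivAt (fun y => halfWeight φ f y * (F y t - (deriv φ y - f) / 2 * p y t))
      (halfWeight φ f x * (pₜ x t + ((deriv φ x - f) ^ 2 / 4 - deriv (deriv φ) x / 2) * p x t))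
      x := by
  have hE := hasDerivAt_halfWeight (f := f) hφ x
  have hb : HasDerivAt (fun y => (deriv φ y - f) / 2) (deriv (deriv φ) x / 2) x :=
    ((hasDerivAt_deriv_phi hφ x).sub_const f).div_const 2
  refine ⟨(hE.mul (hp.space x t ht)).congr_deriv (by ring), ?_⟩
  refine (hE.mul ((hp.flux x t ht).fun_sub (hb.fun_mul (hp.space x t ht)))).congr_deriv ?_
  ring

/-- The zeroth order coefficient left after the drift has been removed is bounded. -/
theorem exists_abs_zeroth_order_le (hφ : ContDiff ℝ 2 φ) (hper : Function.Periodic φ 1) (f : ℝ) :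
    ∃ κ : ℝ, 0 ≤ κ ∧ ∀ x, |(deriv φ x - f) ^ 2 / 4 - deriv (deriv φ) x / 2| ≤ κ := by
  have h1 := (contDiff_deriv_phi hφ).continuous
  have h2 := (contDiff_deriv_phi hφ).continuous_deriv le_rfl
  have hp1 := Periodic.deriv hper
  have hp2 := Periodic.deriv hp1
  refine Periodic.exists_abs_le
    (g := fun x => (deriv φ x - f) ^ 2 / 4 - deriv (deriv φ) x / 2) (fun x => ?_) (by fun_prop)
  simp only [hp1 x, hp2 x]

/-- Compares the weighted local masses of `q` around `x₀` with the unweighted ones. -/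
theorem weighted_mass_le {w q : ℝ → ℝ → ℝ} {W : ℝ → ℝ} {L : ℝ} {x₀ s₀ t₀ : ℝ}
    (hW : Continuous W) (hq : ContinuousOn (fun z : ℝ × ℝ => q z.1 z.2) (univ ×ˢ Ioi 0))
    (hwq : ∀ y t, w y t = W y * q y t)
    (hqnn : ∀ y t, 0 < t → 0 ≤ q y t) (hL : ∀ y, |y - x₀| ≤ 1 → W y ≤ L)
    (hs₀ : 0 < s₀) (hst : s₀ ≤ t₀) :
    (∫ y in (x₀ - 1)..(x₀ + 1), w y s₀) + ∫ s in s₀..t₀, ∫ y in (x₀ - 1)..(x₀ + 1), w y s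
    ≤ L * ((∫ y in (x₀ - 1)..(x₀ + 1), q y s₀)
        + ∫ s in s₀..t₀, ∫ y in (x₀ - 1)..(x₀ + 1), q y s) := by
  have hw : ContinuousOn (fun z : ℝ × ℝ => w z.1 z.2) (univ ×ˢ Ioi 0) := by
    simp only [hwq]
    exact (hW.comp continuous_fst).continuousOn.mul hq
  have hsubI : uIcc (x₀ - 1) (x₀ + 1) ×ˢ Ioi (0 : ℝ) ⊆ univ ×ˢ Ioi 0 :=
    prod_mono (subset_univ _) subset_rfl
  have hIcc : uIcc s₀ t₀ ⊆ Ioi 0 := by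
    rw [uIcc_of_le hst]; exact fun s hs => hs₀.trans_le hs.1
  have h1 : ∀ s, 0 < s → ∫ y in (x₀ - 1)..(x₀ + 1), w y s
      ≤ L * ∫ y in (x₀ - 1)..(x₀ + 1), q y s := by
    intro s hs
    rw [← intervalIntegral.integral_const_mul]
    refine intervalIntegral.integral_mono_on (by linarith)
      ((ContinuousOn.slice_left hw hs).intervalIntegrable _ _)
      (((ContinuousOn.slice_left hq hs).const_mul _).intervalIntegrable _ _) fun y hy => ?_
    rw [hwq]
    refine mul_le_mul_of_nonneg_right (hL y (abs_le.2 ⟨?_, ?_⟩)) (hqnn y s hs)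
    · linarith [hy.1]
    · linarith [hy.2]
  rw [mul_add]
  refine add_le_add (h1 s₀ hs₀) ?_
  rw [← intervalIntegral.integral_const_mul]
  refine intervalIntegral.integral_mono_on hst ?_ ?_ fun s hs => h1 s (hs₀.trans_le hs.1)
  · exact ((continuousOn_intervalIntegral_param
      (hw.mono hsubI)).mono hIcc).intervalIntegrable
  · exact (((continuousOn_intervalIntegral_param
      (hq.mono hsubI)).mono hIcc).const_mul _).intervalIntegrable

/-- Nonnegative solutions are controlled pointwise by their local mass. -/
theorem IsFluxSolution.exists_local_bound_of_nonneg (hφ : ContDiff ℝ 2 φ)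
    (hper : Function.Periodic φ 1) (f : ℝ) {τ : ℝ} (hτ : 0 < τ) (T : ℝ) : ∃ C : ℝ, 0 ≤ C ∧
    ∀ p pₜ F : ℝ → ℝ → ℝ, IsFluxSolution φ f p pₜ F → (∀ x t, 0 < t → 0 ≤ p x t) →
    ∀ x₀ s₀ t₀ : ℝ, 0 < s₀ → s₀ + τ ≤ t₀ → t₀ ≤ s₀ + T →
      p x₀ t₀ ≤ C * ((∫ y in (x₀ - 1)..(x₀ + 1), p y s₀)
        + ∫ s in s₀..t₀, ∫ y in (x₀ - 1)..(x₀ + 1), p y s) := by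
  obtain ⟨κ, hκ0, hκ⟩ := exists_abs_zeroth_order_le hφ hper f
  obtain ⟨L, hL0, hL⟩ := exists_halfWeight_le hφ hper f
  obtain ⟨C, hC0, hC⟩ := heat_subsolution_bound hτ T hκ0
  refine ⟨C * L, by positivity, fun p pₜ F hp hnn x₀ s₀ t₀ hs₀ hst htT => ?_⟩
  have hEc := continuous_halfWeight (f := f) hφ
  have hEon : ContinuousOn (fun z : ℝ × ℝ => halfWeight φ f z.1) (univ ×ˢ Ioi 0) :=
    (hEc.comp continuous_fst).continuousOn
  have h1c := (contDiff_deriv_phi hφ).continuous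
  have h2c := (contDiff_deriv_phi hφ).continuous_deriv le_rfl
  have key := hC (fun y s => halfWeight φ f y * p y s) (fun y s => halfWeight φ f y * pₜ y s) _ _
    (hEon.mul hp.continuousOn) (hEon.mul hp.continuousOn_time)
    (fun y t ht => (hp.time y t ht).const_mul _)
    (fun y t ht => (hp.hasDerivAt_weighted hφ ht y).1)
    (fun y t ht => (hp.hasDerivAt_weighted hφ ht y).2)
    (fun t ht => by
      have := hp.continuous_slice ht
      have := hp.continuous_slice_time ht
      fun_prop)
    (fun y t ht => mul_nonneg (halfWeight_pos y).le (hnn y t ht))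
    (fun y t ht => by
      have h := (abs_le.1 (hκ y)).1
      nlinarith [mul_nonneg (halfWeight_pos (φ := φ) (f := f) y).le (hnn y t ht)])
    x₀ s₀ t₀ hs₀ hst htT
  have h2 := weighted_mass_le (w := fun y s => halfWeight φ f y * p y s) (q := p)
    (L := L * halfWeight φ f x₀) (x₀ := x₀) hEc hp.continuousOn
    (fun _ _ => rfl) hnn (fun y hy => hL x₀ y hy) hs₀ (by linarith : s₀ ≤ t₀)
  have hE := halfWeight_pos (φ := φ) (f := f) x₀
  refine le_of_mul_le_mul_left (key.trans ((mul_le_mul_of_nonneg_left h2 hC0).trans ?_)) hE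
  exact le_of_eq (by ring)

/-- Solutions are controlled pointwise by their local `L²` norm. -/
theorem IsFluxSolution.exists_local_bound_sq (hφ : ContDiff ℝ 2 φ)
    (hper : Function.Periodic φ 1) (f : ℝ) {τ : ℝ} (hτ : 0 < τ) (T : ℝ) : ∃ C : ℝ, 0 ≤ C ∧
    ∀ p pₜ F : ℝ → ℝ → ℝ, IsFluxSolution φ f p pₜ F →
    ∀ x₀ s₀ t₀ : ℝ, 0 < s₀ → s₀ + τ ≤ t₀ → t₀ ≤ s₀ + T →
      p x₀ t₀ ^ 2 ≤ C * ((∫ y in (x₀ - 1)..(x₀ + 1), p y s₀ ^ 2)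
        + ∫ s in s₀..t₀, ∫ y in (x₀ - 1)..(x₀ + 1), p y s ^ 2) := by
  obtain ⟨κ, hκ0, hκ⟩ := exists_abs_zeroth_order_le hφ hper f
  obtain ⟨L, hL0, hL⟩ := exists_halfWeight_le hφ hper f
  obtain ⟨C, hC0, hC⟩ := heat_subsolution_bound hτ T (κ := 2 * κ) (by positivity)
  refine ⟨C * L ^ 2, by positivity, fun p pₜ F hp x₀ s₀ t₀ hs₀ hst htT => ?_⟩
  have hEc := continuous_halfWeight (f := f) hφ
  have hEon : ContinuousOn (fun z : ℝ × ℝ => halfWeight φ f z.1) (univ ×ˢ Ioi 0) :=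
    (hEc.comp continuous_fst).continuousOn
  have h1c := (contDiff_deriv_phi hφ).continuous
  have h2c := (contDiff_deriv_phi hφ).continuous_deriv le_rfl
  have hd1 := fun y t (ht : 0 < t) => (hp.hasDerivAt_weighted hφ ht y).1
  have hd2 := fun y t (ht : 0 < t) => (hp.hasDerivAt_weighted hφ ht y).2
  have key := hC (fun y s => (halfWeight φ f y * p y s) * (halfWeight φ f y * p y s))
    (fun y s => (halfWeight φ f y * pₜ y s) * (halfWeight φ f y * p y s)
      + (halfWeight φ f y * p y s) * (halfWeight φ f y * pₜ y s)) _ _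
    ((hEon.mul hp.continuousOn).mul (hEon.mul hp.continuousOn))
    (((hEon.mul hp.continuousOn_time).mul (hEon.mul hp.continuousOn)).add
      ((hEon.mul hp.continuousOn).mul (hEon.mul hp.continuousOn_time)))
    (fun y t ht => ((hp.time y t ht).const_mul _).fun_mul ((hp.time y t ht).const_mul _))
    (fun y t ht => (hd1 y t ht).fun_mul (hd1 y t ht))
    (fun y t ht => ((hd2 y t ht).fun_mul (hd1 y t ht)).fun_add ((hd1 y t ht).fun_mul (hd2 y t ht)))
    (fun t ht => by
      have := hp.continuous_slice ht
      have := hp.continuous_slice_time ht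
      have := hp.continuous_flux ht
      fun_prop)
    (fun y t ht => mul_self_nonneg _)
    (fun y t ht => by
      have h := (abs_le.1 (hκ y)).1
      have h3 := mul_nonneg (mul_self_nonneg (halfWeight φ f y * p y t))
        (by linarith : 0 ≤ (deriv φ y - f) ^ 2 / 4 - deriv (deriv φ) y / 2 + κ)
      nlinarith [mul_self_nonneg (halfWeight φ f y * (F y t - (deriv φ y - f) / 2 * p y t))])
    x₀ s₀ t₀ hs₀ hst htT
  have hE := halfWeight_pos (φ := φ) (f := f) x₀
  have h2 := weighted_mass_le
    (w := fun y s => (halfWeight φ f y * p y s) * (halfWeight φ f y * p y s))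
    (q := fun y s => p y s ^ 2) (W := fun y => halfWeight φ f y ^ 2)
    (L := (L * halfWeight φ f x₀) ^ 2) (x₀ := x₀) (by fun_prop) (hp.continuousOn.pow 2)
    (fun _ _ => by ring) (fun y t _ => sq_nonneg _)
    (fun y hy => pow_le_pow_left₀ (halfWeight_pos y).le (hL x₀ y hy) 2) hs₀ (by linarith : s₀ ≤ t₀)
  refine le_of_mul_le_mul_left (a := halfWeight φ f x₀ ^ 2)
    (le_trans (le_of_eq (by ring)) (key.trans ((mul_le_mul_of_nonneg_left h2 hC0).trans
      (le_of_eq (by ring))))) (by positivity)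

end LocalBounds

/-! ### The steady states -/

section Steady

variable {φ : ℝ → ℝ} {f : ℝ}

/-- The averages `∫₀¹ r(x+s) exp(φ(x+s) - φ(x) - f s) ds` with a periodic factor `r` solve the
first order equation `(φ' - f) W + W' = -(1 - exp(-f)) r`. -/
theorem hasDerivAt_exp_average (hφ : ContDiff ℝ 2 φ) (hper : Function.Periodic φ 1) (f : ℝ)
    {r : ℝ → ℝ} (hr : Continuous r) (hrp : Function.Periodic r 1) (x : ℝ) :
    HasDerivAt (fun x => ∫ s in (0 : ℝ)..1, r (x + s) * Real.exp (φ (x + s) - φ x - f * s))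
      (-((1 - Real.exp (-f)) * r x) - (deriv φ x - f) *
        ∫ s in (0 : ℝ)..1, r (x + s) * Real.exp (φ (x + s) - φ x - f * s)) x := by
  have hφc := hφ.continuous
  set G : ℝ → ℝ := fun y => r y * Real.exp (φ y - f * y) with hG
  have hGc : Continuous G := by fun_prop
  have hform : ∀ x, ∫ s in (0 : ℝ)..1, r (x + s) * Real.exp (φ (x + s) - φ x - f * s)
      = Real.exp (-(φ x - f * x)) * ((∫ y in (0 : ℝ)..(x + 1), G y) - ∫ y in (0 : ℝ)..x, G y) := by
    intro x
    rw [intervalIntegral.integral_interval_sub_left (hGc.intervalIntegrable _ _)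
      (hGc.intervalIntegrable _ _)]
    have := intervalIntegral.integral_comp_add_left (a := 0) (b := 1) G x
    rw [add_zero] at this
    rw [← this, ← intervalIntegral.integral_const_mul]
    refine intervalIntegral.integral_congr fun s _ => ?_
    simp only [hG]
    rw [mul_left_comm, ← Real.exp_add]
    congr 2; ring
  have h1 : HasDerivAt (fun x => Real.exp (-(φ x - f * x)))
      (-(deriv φ x - f) * Real.exp (-(φ x - f * x))) x := by
    have : HasDerivAt (fun x => -(φ x - f * x)) (-(deriv φ x - f)) x := by
      simpa using ((hasDerivAt_phi hφ x).fun_sub ((hasDerivAt_id x).const_mul f)).fun_neg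
    exact this.exp.congr_deriv (mul_comm _ _)
  have h2 : ∀ y, HasDerivAt (fun x => ∫ y in (0 : ℝ)..x, G y) (G y) y := fun y =>
    intervalIntegral.integral_hasDerivAt_right (hGc.intervalIntegrable _ _)
      (hGc.stronglyMeasurableAtFilter _ _) hGc.continuousAt
  have h3 : HasDerivAt (fun x => ∫ y in (0 : ℝ)..(x + 1), G y) (G (x + 1)) x :=
    (h2 (x + 1)).comp_add_const x 1
  have hG1 : G (x + 1) = Real.exp (-f) * G x := by
    simp only [hG, hrp x, hper x]
    rw [mul_left_comm, ← Real.exp_add]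
    congr 2; ring
  have hG2 : Real.exp (-(φ x - f * x)) * G x = r x := by
    simp only [hG]
    rw [mul_left_comm, ← Real.exp_add]; simp
  simp only [hform]
  refine (h1.mul (h3.fun_sub (h2 x))).congr_deriv ?_
  rw [hG1, ← hG2]; ring

theorem hasDerivAt_w0 (hφ : ContDiff ℝ 2 φ) (hper : Function.Periodic φ 1) (f x : ℝ) :
    HasDerivAt (w0 φ f) (-(1 - Real.exp (-f)) - (deriv φ x - f) * w0 φ f x) x := by
  have := hasDerivAt_exp_average hφ hper f (r := fun _ => 1) continuous_const (fun _ => rfl) x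
  simp only [one_mul, mul_one] at this
  exact this

theorem continuous_w0 (hφ : ContDiff ℝ 2 φ) (hper : Function.Periodic φ 1) (f : ℝ) :
    Continuous (w0 φ f) :=
  continuous_iff_continuousAt.2 fun x => (hasDerivAt_w0 hφ hper f x).continuousAt

theorem periodic_w0 (hper : Function.Periodic φ 1) (f : ℝ) : Function.Periodic (w0 φ f) 1 := by
  intro x
  unfold w0
  refine intervalIntegral.integral_congr fun s _ => ?_
  rw [add_right_comm, hper, hper]

theorem w0_pos (hφ : ContDiff ℝ 2 φ) (f x : ℝ) : 0 < w0 φ f x := by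
  have hφc := hφ.continuous
  exact intervalIntegral.intervalIntegral_pos_of_pos
    (Continuous.intervalIntegrable (by fun_prop) _ _) (fun s => Real.exp_pos _) zero_lt_one

theorem M0_pos (hφ : ContDiff ℝ 2 φ) (hper : Function.Periodic φ 1) (f : ℝ) : 0 < M0 φ f :=
  intervalIntegral.intervalIntegral_pos_of_pos
    ((continuous_w0 hφ hper f).intervalIntegrable _ _) (w0_pos hφ f) zero_lt_one

theorem J0_ne_zero (hφ : ContDiff ℝ 2 φ) (hper : Function.Periodic φ 1) (hf : f ≠ 0) :
    J0 φ f ≠ 0 := by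
  refine div_ne_zero (sub_ne_zero.2 fun h => hf ?_) (M0_pos hφ hper f).ne'
  have := Real.exp_eq_one_iff (-f) |>.1 h.symm
  linarith

theorem hasDerivAt_w1 (hφ : ContDiff ℝ 2 φ) (hper : Function.Periodic φ 1) (f x : ℝ) :
    HasDerivAt (w1 φ f)
      (-((1 - Real.exp (-f)) * w0 φ f x ^ 2) - (deriv φ x - f) * w1 φ f x) x :=
  hasDerivAt_exp_average hφ hper f (r := fun x => w0 φ f x ^ 2)
    ((continuous_w0 hφ hper f).pow 2) (fun x => by simp only [periodic_w0 hper f x]) x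

theorem continuous_w1 (hφ : ContDiff ℝ 2 φ) (hper : Function.Periodic φ 1) (f : ℝ) :
    Continuous (w1 φ f) :=
  continuous_iff_continuousAt.2 fun x => (hasDerivAt_w1 hφ hper f x).continuousAt

theorem periodic_w1 (hper : Function.Periodic φ 1) (f : ℝ) : Function.Periodic (w1 φ f) 1 := by
  intro x
  unfold w1
  refine intervalIntegral.integral_congr fun s _ => ?_
  rw [add_right_comm, hper, hper, periodic_w0 hper]

theorem hasDerivAt_u0 (hφ : ContDiff ℝ 2 φ) (hper : Function.Periodic φ 1) (f x : ℝ) :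
    HasDerivAt (u0 φ f) (-J0 φ f - (deriv φ x - f) * u0 φ f x) x := by
  refine ((hasDerivAt_w0 hφ hper f x).div_const (M0 φ f)).congr_deriv ?_
  unfold J0 u0; ring

theorem continuous_u0 (hφ : ContDiff ℝ 2 φ) (hper : Function.Periodic φ 1) (f : ℝ) :
    Continuous (u0 φ f) :=
  continuous_iff_continuousAt.2 fun x => (hasDerivAt_u0 hφ hper f x).continuousAt

theorem periodic_u0 (hper : Function.Periodic φ 1) (f : ℝ) : Function.Periodic (u0 φ f) 1 :=
  fun x => by simp only [u0, periodic_w0 hper f x]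

theorem u0_pos (hφ : ContDiff ℝ 2 φ) (hper : Function.Periodic φ 1) (f x : ℝ) : 0 < u0 φ f x :=
  div_pos (w0_pos hφ f x) (M0_pos hφ hper f)

theorem integral_u0 (hφ : ContDiff ℝ 2 φ) (hper : Function.Periodic φ 1) (f : ℝ) :
    ∫ x in (0 : ℝ)..1, u0 φ f x = 1 := by
  unfold u0
  rw [intervalIntegral.integral_div]
  exact div_self (M0_pos hφ hper f).ne'

theorem hasDerivAt_integral_u0 (hφ : ContDiff ℝ 2 φ) (hper : Function.Periodic φ 1) (f x : ℝ) :
    HasDerivAt (fun x => ∫ s in (0 : ℝ)..x, u0 φ f s) (u0 φ f x) x :=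
  have hc := continuous_u0 hφ hper f
  intervalIntegral.integral_hasDerivAt_right (hc.intervalIntegrable _ _)
    (hc.stronglyMeasurableAtFilter _ _) hc.continuousAt

/-- The flux of `u₁`, up to sign. -/
noncomputable def flux1 (φ : ℝ → ℝ) (f x : ℝ) : ℝ :=
  -(M1 φ f / M0 φ f ^ 3) - J0 φ f / 2 + J0 φ f * ∫ s in (0 : ℝ)..x, u0 φ f s

theorem hasDerivAt_flux1 (hφ : ContDiff ℝ 2 φ) (hper : Function.Periodic φ 1) (f x : ℝ) :
    HasDerivAt (flux1 φ f) (J0 φ f * u0 φ f x) x :=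
  ((hasDerivAt_integral_u0 hφ hper f x).const_mul (J0 φ f)).const_add _

theorem hasDerivAt_u1 (hφ : ContDiff ℝ 2 φ) (hper : Function.Periodic φ 1) (hf : f ≠ 0) (x : ℝ) :
    HasDerivAt (u1 φ f) (flux1 φ f x - (deriv φ x - f) * u1 φ f x) x := by
  have hu := hasDerivAt_u0 hφ hper f x
  refine (((hu.const_mul (M1 φ f / (M0 φ f ^ 3 * J0 φ f) + 1 / 2)).sub
    (hu.mul (hasDerivAt_integral_u0 hφ hper f x))).sub
    ((hasDerivAt_w1 hφ hper f x).div_const (M0 φ f ^ 3 * J0 φ f))).congr_deriv ?_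
  have hM := (M0_pos hφ hper f).ne'
  have hJ := J0_ne_zero hφ hper hf
  have h1 : 1 - Real.exp (-f) = J0 φ f * M0 φ f := by unfold J0; field_simp
  have h2 : w0 φ f x = u0 φ f x * M0 φ f := by unfold u0; field_simp
  rw [h1, h2]
  unfold flux1 u1
  field_simp
  ring

theorem continuous_u1 (hφ : ContDiff ℝ 2 φ) (hper : Function.Periodic φ 1) (hf : f ≠ 0) :
    Continuous (u1 φ f) :=
  continuous_iff_continuousAt.2 fun x => (hasDerivAt_u1 hφ hper hf x).continuousAt

theorem u1_add_one (hφ : ContDiff ℝ 2 φ) (hper : Function.Periodic φ 1) (f x : ℝ) :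
    u1 φ f (x + 1) = u1 φ f x - u0 φ f x := by
  have hc := continuous_u0 hφ hper f
  have h : ∫ s in (0 : ℝ)..(x + 1), u0 φ f s = (∫ s in (0 : ℝ)..x, u0 φ f s) + 1 := by
    rw [← intervalIntegral.integral_add_adjacent_intervals (hc.intervalIntegrable 0 x)
      (hc.intervalIntegrable x (x + 1)),
      (periodic_u0 hper f).intervalIntegral_add_eq x 0, zero_add, integral_u0 hφ hper f]
  unfold u1
  rw [h, periodic_u0 hper f, periodic_w1 hper f]
  ring

theorem integral_u1 (hφ : ContDiff ℝ 2 φ) (hper : Function.Periodic φ 1) (f : ℝ) :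
    ∫ x in (0 : ℝ)..1, u1 φ f x = 0 := by
  have hc := continuous_u0 hφ hper f
  have hw := continuous_w1 hφ hper f
  have hU : Continuous fun x => ∫ s in (0 : ℝ)..x, u0 φ f s :=
    continuous_iff_continuousAt.2 fun x => (hasDerivAt_integral_u0 hφ hper f x).continuousAt
  have hhalf : ∫ x in (0 : ℝ)..1, u0 φ f x * (∫ s in (0 : ℝ)..x, u0 φ f s) = 1 / 2 := by
    have hd : ∀ x, HasDerivAt (fun x => (∫ s in (0 : ℝ)..x, u0 φ f s) ^ 2 / 2)
        (u0 φ f x * (∫ s in (0 : ℝ)..x, u0 φ f s)) x := fun x =>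
      (((hasDerivAt_integral_u0 hφ hper f x).fun_pow 2).div_const 2).congr_deriv (by
        push_cast; ring)
    rw [intervalIntegral.integral_eq_sub_of_hasDerivAt (fun x _ => hd x)
      ((hc.mul hU).intervalIntegrable _ _), integral_u0 hφ hper f]
    simp
  unfold u1
  rw [intervalIntegral.integral_sub, intervalIntegral.integral_sub, hhalf,
    intervalIntegral.integral_const_mul, integral_u0 hφ hper f, intervalIntegral.integral_div]
  · unfold M1; ring
  · exact (hc.const_mul _).intervalIntegrable _ _
  · exact (hc.mul hU).intervalIntegrable _ _
  · exact ((hc.const_mul _).sub (hc.mul hU)).intervalIntegrable _ _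
  · exact (hw.div_const _).intervalIntegrable _ _

end Steady

/-! ### Entropy dissipation for periodic flux solutions -/

section Entropy

variable {φ : ℝ → ℝ} {f : ℝ} {p pₜ F : ℝ → ℝ → ℝ}

theorem IsFluxSolution.periodic_flux (hper : Function.Periodic φ 1)
    (hp : IsFluxSolution φ f p pₜ F)
    (hpp : ∀ t, 0 < t → Function.Periodic (fun x => p x t) 1) {t : ℝ} (ht : 0 < t) :
    Function.Periodic (fun x => F x t) 1 := fun x => by
  have h1 := (hp.space (x + 1) t ht).comp_add_const x 1
  have h2 : HasDerivAt (fun y => p (y + 1) t) (F x t - (deriv φ x - f) * p x t) x :=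
    (hp.space x t ht).congr_of_eventuallyEq (Eventually.of_forall fun y => hpp t ht y)
  have h3 := h1.unique h2
  have h4 : p (x + 1) t = p x t := hpp t ht x
  rw [Periodic.deriv hper x, h4] at h3
  simpa using h3

/-- For `g = p / u₀`, the entropy `∫ u₀ Φ(g)` is dissipated at the rate `∫ u₀ Φ''(g) (g')²`. Here
`g' = (F + J₀ g) / u₀`; the contribution of the flux `J₀` of `u₀` is an exact derivative. -/
theorem IsFluxSolution.hasDerivAt_entropy (hφ : ContDiff ℝ 2 φ) (hper : Function.Periodic φ 1)
    (hp : IsFluxSolution φ f p pₜ F) (hpp : ∀ t, 0 < t → Function.Periodic (fun x => p x t) 1)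
    {Φ Φ₁ Φ₂ : ℝ → ℝ} (hΦ : ∀ y, HasDerivAt Φ (Φ₁ y) y) (hΦ₁ : ∀ y, HasDerivAt Φ₁ (Φ₂ y) y)
    (hΦ₂ : Continuous Φ₂) {t : ℝ} (ht : 0 < t) :
    HasDerivAt (fun t => ∫ x in (0 : ℝ)..1, u0 φ f x * Φ (p x t / u0 φ f x))
      (-∫ x in (0 : ℝ)..1, u0 φ f x * (Φ₂ (p x t / u0 φ f x) *
        ((F x t + J0 φ f * (p x t / u0 φ f x)) / u0 φ f x) ^ 2)) t := by
  have hu := continuous_u0 hφ hper f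
  have hu0 := fun x => (u0_pos hφ hper f x).ne'
  have hΦc : Continuous Φ := continuous_iff_continuousAt.2 fun x => (hΦ x).continuousAt
  have hΦ₁c : Continuous Φ₁ := continuous_iff_continuousAt.2 fun x => (hΦ₁ x).continuousAt
  have hsubI : uIcc (0 : ℝ) 1 ×ˢ Ioi (0 : ℝ) ⊆ univ ×ˢ Ioi 0 :=
    prod_mono (subset_univ _) subset_rfl
  have huon : ContinuousOn (fun z : ℝ × ℝ => u0 φ f z.1) (univ ×ˢ Ioi 0) :=
    (hu.comp continuous_fst).continuousOn
  have hgon : ContinuousOn (fun z : ℝ × ℝ => p z.1 z.2 / u0 φ f z.1) (univ ×ˢ Ioi 0) :=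
    hp.continuousOn.div huon fun z _ => hu0 _
  have hder := hasDerivAt_intervalIntegral_param (a := 0) (b := 1) isOpen_Ioi (mem_Ioi.2 ht)
    (g := fun x t => u0 φ f x * Φ (p x t / u0 φ f x))
    (g' := fun x t => Φ₁ (p x t / u0 φ f x) * pₜ x t)
    ((huon.mul (hΦc.comp_continuousOn hgon)).mono hsubI)
    (((hΦ₁c.comp_continuousOn hgon).mul hp.continuousOn_time).mono hsubI)
    (fun x _ t ht => by
      refine (((hΦ _).comp t ((hp.time x t ht).div_const _)).const_mul (u0 φ f x)).congr_deriv ?_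
      have := hu0 x
      field_simp)
  refine hder.congr_deriv ?_
  rw [eq_neg_iff_add_eq_zero]
  have hpc := hp.continuous_slice ht
  have hptc := hp.continuous_slice_time ht
  have hFc := hp.continuous_flux ht
  have hgc : Continuous fun x => p x t / u0 φ f x := hpc.div hu hu0
  have hg'c : Continuous fun x => (F x t + J0 φ f * (p x t / u0 φ f x)) / u0 φ f x :=
    (hFc.add (hgc.const_mul _)).div hu hu0
  have hgd : ∀ x, HasDerivAt (fun x => p x t / u0 φ f x)
      ((F x t + J0 φ f * (p x t / u0 φ f x)) / u0 φ f x) x := fun x => by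
    refine ((hp.space x t ht).div (hasDerivAt_u0 hφ hper f x) (hu0 x)).congr_deriv ?_
    have := hu0 x
    field_simp
    ring
  have hbig : ∀ x, HasDerivAt (fun x => Φ₁ (p x t / u0 φ f x) * F x t
      + J0 φ f * (p x t / u0 φ f x * Φ₁ (p x t / u0 φ f x) - Φ (p x t / u0 φ f x)))
      (Φ₁ (p x t / u0 φ f x) * pₜ x t + u0 φ f x * (Φ₂ (p x t / u0 φ f x) *
        ((F x t + J0 φ f * (p x t / u0 φ f x)) / u0 φ f x) ^ 2)) x := fun x => by
    have h1 := (hΦ₁ _).comp x (hgd x)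
    have h0 := (hΦ _).comp x (hgd x)
    refine ((h1.fun_mul (hp.flux x t ht)).fun_add
      ((((hgd x).fun_mul h1).fun_sub h0).const_mul (J0 φ f))).congr_deriv ?_
    have := hu0 x
    simp only [Function.comp_apply]
    field_simp
    ring
  have hc1 : Continuous fun x => Φ₁ (p x t / u0 φ f x) * pₜ x t :=
    (hΦ₁c.comp hgc).mul hptc
  have hc2 : Continuous fun x => u0 φ f x * (Φ₂ (p x t / u0 φ f x) *
        ((F x t + J0 φ f * (p x t / u0 φ f x)) / u0 φ f x) ^ 2) :=
    hu.mul ((hΦ₂.comp hgc).mul (hg'c.pow 2))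
  rw [← intervalIntegral.integral_add (hc1.intervalIntegrable _ _) (hc2.intervalIntegrable _ _),
    intervalIntegral.integral_eq_sub_of_hasDerivAt (fun x _ => hbig x)
      ((hc1.add hc2).intervalIntegrable _ _)]
  have e1 : p 1 t = p 0 t := by simpa using hpp t ht 0
  have e2 : F 1 t = F 0 t := by simpa using hp.periodic_flux hper hpp ht 0
  have e3 : u0 φ f 1 = u0 φ f 0 := by simpa using periodic_u0 hper f 0
  rw [e1, e2, e3, sub_self]

theorem IsFluxSolution.entropy_antitone (hφ : ContDiff ℝ 2 φ) (hper : Function.Periodic φ 1)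
    (hp : IsFluxSolution φ f p pₜ F) (hpp : ∀ t, 0 < t → Function.Periodic (fun x => p x t) 1)
    {Φ Φ₁ Φ₂ : ℝ → ℝ} (hΦ : ∀ y, HasDerivAt Φ (Φ₁ y) y) (hΦ₁ : ∀ y, HasDerivAt Φ₁ (Φ₂ y) y)
    (hΦ₂ : Continuous Φ₂) (hnn : ∀ y, 0 ≤ Φ₂ y) :
    AntitoneOn (fun t => ∫ x in (0 : ℝ)..1, u0 φ f x * Φ (p x t / u0 φ f x)) (Ioi 0) := by
  have hd := fun t (ht : t ∈ Ioi (0 : ℝ)) =>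
    hp.hasDerivAt_entropy hφ hper hpp hΦ hΦ₁ hΦ₂ (mem_Ioi.1 ht)
  refine antitoneOn_of_deriv_nonpos (convex_Ioi 0)
    (fun t ht => (hd t ht).continuousAt.continuousWithinAt)
    (fun t ht => (hd t (interior_subset ht)).differentiableAt.differentiableWithinAt)
    fun t ht => ?_
  rw [(hd t (interior_subset ht)).deriv, neg_nonpos]
  refine intervalIntegral.integral_nonneg zero_le_one fun x _ => ?_
  exact mul_nonneg (u0_pos hφ hper f x).le (mul_nonneg (hnn _) (sq_nonneg _))

/-- The `L¹` norm over a period does not increase: the entropies `√(y² + δ²)`, `δ → 0`. -/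
theorem IsFluxSolution.integral_abs_le (hφ : ContDiff ℝ 2 φ) (hper : Function.Periodic φ 1)
    (hp : IsFluxSolution φ f p pₜ F) (hpp : ∀ t, 0 < t → Function.Periodic (fun x => p x t) 1)
    {s t : ℝ} (hs : 0 < s) (hst : s ≤ t) :
    ∫ x in (0 : ℝ)..1, |p x t| ≤ ∫ x in (0 : ℝ)..1, |p x s| := by
  have ht : 0 < t := hs.trans_le hst
  have hu := continuous_u0 hφ hper f
  have hupos := u0_pos hφ hper f
  have hu0 := fun x => (hupos x).ne'
  refine le_of_forall_pos_le_add fun δ hδ => ?_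
  have hq : ∀ y : ℝ, 0 < y ^ 2 + δ ^ 2 := fun y => by positivity
  have hq' : ∀ y : ℝ, √(y ^ 2 + δ ^ 2) ≠ 0 := fun y => (Real.sqrt_pos.2 (hq y)).ne'
  have hΦ : ∀ y : ℝ, HasDerivAt (fun y => √(y ^ 2 + δ ^ 2)) (y / √(y ^ 2 + δ ^ 2)) y := fun y => by
    have : HasDerivAt (fun y : ℝ => y ^ 2 + δ ^ 2) (2 * y) y := by
      simpa using ((hasDerivAt_id y).fun_pow 2).add_const (δ ^ 2)
    refine (this.sqrt (hq y).ne').congr_deriv ?_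
    field_simp
  have hΦ₁ : ∀ y : ℝ, HasDerivAt (fun y => y / √(y ^ 2 + δ ^ 2))
      (δ ^ 2 / √(y ^ 2 + δ ^ 2) ^ 3) y := fun y => by
    refine ((hasDerivAt_id y).div (hΦ y) (hq' y)).congr_deriv ?_
    have h1 := hq' y
    have h2 := Real.sq_sqrt (hq y).le
    simp only [id]
    field_simp
    rw [h2]; ring
  have hanti := hp.entropy_antitone hφ hper hpp hΦ hΦ₁
    (Continuous.div (by fun_prop) (by fun_prop) fun y => pow_ne_zero 3 (hq' y))
    (fun y => by positivity) (mem_Ioi.2 hs) (mem_Ioi.2 ht) hst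
  simp only at hanti
  have hcont : ∀ t, 0 < t → Continuous fun x =>
      u0 φ f x * √((p x t / u0 φ f x) ^ 2 + δ ^ 2) := fun t ht => by
    have := (hp.continuous_slice ht).div hu hu0
    exact hu.mul (Real.continuous_sqrt.comp ((this.pow 2).add continuous_const))
  have hlow : ∫ x in (0 : ℝ)..1, |p x t|
      ≤ ∫ x in (0 : ℝ)..1, u0 φ f x * √((p x t / u0 φ f x) ^ 2 + δ ^ 2) := by
    refine intervalIntegral.integral_mono_on zero_le_one
      ((hp.continuous_slice ht).abs.intervalIntegrable _ _)
      ((hcont t ht).intervalIntegrable _ _) fun x _ => ?_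
    have h1 : |p x t / u0 φ f x| ≤ √((p x t / u0 φ f x) ^ 2 + δ ^ 2) :=
      Real.abs_le_sqrt (by nlinarith)
    have h2 := mul_le_mul_of_nonneg_left h1 (hupos x).le
    rwa [abs_div, abs_of_pos (hupos x), mul_div_cancel₀ _ (hu0 x)] at h2
  have hup : ∫ x in (0 : ℝ)..1, u0 φ f x * √((p x s / u0 φ f x) ^ 2 + δ ^ 2)
      ≤ (∫ x in (0 : ℝ)..1, |p x s|) + δ := by
    have e : (∫ x in (0 : ℝ)..1, |p x s|) + δ
        = ∫ x in (0 : ℝ)..1, (|p x s| + δ * u0 φ f x) := by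
      rw [intervalIntegral.integral_add ((hp.continuous_slice hs).abs.intervalIntegrable _ _)
        ((hu.const_mul δ).intervalIntegrable _ _), intervalIntegral.integral_const_mul,
        integral_u0 hφ hper f, mul_one]
    rw [e]
    refine intervalIntegral.integral_mono_on zero_le_one ((hcont s hs).intervalIntegrable _ _)
      (((hp.continuous_slice hs).abs.add (hu.const_mul δ)).intervalIntegrable _ _) fun x _ => ?_
    have h1 : √((p x s / u0 φ f x) ^ 2 + δ ^ 2) ≤ |p x s / u0 φ f x| + δ := by
      rw [Real.sqrt_le_left (by positivity), ← sq_abs (p x s / u0 φ f x)]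
      nlinarith [abs_nonneg (p x s / u0 φ f x)]
    have h2 := mul_le_mul_of_nonneg_left h1 (hupos x).le
    rw [abs_div, abs_of_pos (hupos x), mul_add, mul_div_cancel₀ _ (hu0 x)] at h2
    linarith
  linarith

/-- Poincaré inequality on `[0, 1]` for functions with a zero. -/
theorem sq_le_integral_sq_deriv {g g' : ℝ → ℝ} (hg : ∀ x, HasDerivAt g (g' x) x)
    (hg' : Continuous g') {z x : ℝ} (hz : z ∈ Icc (0 : ℝ) 1) (hgz : g z = 0)
    (hx : x ∈ Icc (0 : ℝ) 1) : g x ^ 2 ≤ ∫ y in (0 : ℝ)..1, g' y ^ 2 := by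
  set m := ∫ y in (0 : ℝ)..1, |g' y| with hm
  have h1 : |g x| ≤ m := by
    have e : ∫ y in z..x, g' y = g x - g z :=
      intervalIntegral.integral_eq_sub_of_hasDerivAt (fun y _ => hg y)
        (hg'.intervalIntegrable _ _)
    rw [hgz, sub_zero] at e
    rw [← e, hm, intervalIntegral.integral_of_le zero_le_one]
    refine (intervalIntegral.norm_integral_le_integral_norm_uIoc (f := g')).trans ?_
    refine setIntegral_mono_set (hg'.abs.integrableOn_Ioc) (ae_of_all _ fun y => abs_nonneg _)
      (Eventually.of_forall fun y hy => ?_)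
    rcases mem_uIoc.1 hy with hy | hy
    · exact ⟨hz.1.trans_lt hy.1, hy.2.trans hx.2⟩
    · exact ⟨hx.1.trans_lt hy.1, hy.2.trans hz.2⟩
  have h2 : 0 ≤ ∫ y in (0 : ℝ)..1, (|g' y| - m) ^ 2 :=
    intervalIntegral.integral_nonneg zero_le_one fun y _ => sq_nonneg _
  have h3 : ∫ y in (0 : ℝ)..1, (|g' y| - m) ^ 2 = (∫ y in (0 : ℝ)..1, g' y ^ 2) - m ^ 2 := by
    have e : ∀ y, (|g' y| - m) ^ 2 = g' y ^ 2 - (2 * m * |g' y| - m ^ 2) := fun y => by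
      rw [← sq_abs (g' y)]; ring
    simp only [e]
    rw [intervalIntegral.integral_sub, intervalIntegral.integral_sub,
      intervalIntegral.integral_const_mul, ← hm, intervalIntegral.integral_const]
    · simp; ring
    all_goals exact Continuous.intervalIntegrable (by fun_prop) _ _
  have h4 : g x ^ 2 ≤ m ^ 2 := by
    rw [← sq_abs]
    exact pow_le_pow_left₀ (abs_nonneg _) h1 2
  linarith

theorem exists_u0_bounds (hφ : ContDiff ℝ 2 φ) (hper : Function.Periodic φ 1) (f : ℝ) :
    ∃ l U : ℝ, 0 < l ∧ 0 < U ∧ ∀ x, l ≤ u0 φ f x ∧ u0 φ f x ≤ U := by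
  have hu := continuous_u0 hφ hper f
  obtain ⟨z, -, hz⟩ := (isCompact_Icc (a := (0 : ℝ)) (b := 1)).exists_isMinOn
    (nonempty_Icc.2 zero_le_one) hu.continuousOn
  obtain ⟨U, hU0, hU⟩ := Periodic.exists_abs_le (periodic_u0 hper f) hu
  have hz0 := u0_pos hφ hper f z
  refine ⟨u0 φ f z, U, hz0, (hz0.trans_le (le_abs_self _)).trans_le (hU z),
    fun x => ⟨?_, (le_abs_self _).trans (hU x)⟩⟩
  obtain ⟨y, hy, hxy⟩ := (periodic_u0 hper f).exists_mem_Ico₀ one_pos x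
  rw [hxy]
  exact hz ⟨hy.1, hy.2.le⟩

/-- Spectral gap: the quadratic entropy of periodic solutions with mean zero decays
exponentially, at a rate given by a Poincaré inequality. -/
theorem IsFluxSolution.quadratic_entropy_decay (hφ : ContDiff ℝ 2 φ)
    (hper : Function.Periodic φ 1) (hp : IsFluxSolution φ f p pₜ F)
    (hpp : ∀ t, 0 < t → Function.Periodic (fun x => p x t) 1)
    (hmean : ∀ t, 0 < t → ∫ x in (0 : ℝ)..1, p x t = 0)
    {l : ℝ} (hl0 : 0 < l) (hl : ∀ x, l ≤ u0 φ f x) {s t : ℝ} (hs : 0 < s) (hst : s ≤ t) :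
    ∫ x in (0 : ℝ)..1, u0 φ f x * (p x t / u0 φ f x) ^ 2
      ≤ Real.exp (-(2 * l * (t - s))) * ∫ x in (0 : ℝ)..1, u0 φ f x * (p x s / u0 φ f x) ^ 2 := by
  have hu := continuous_u0 hφ hper f
  have hupos := u0_pos hφ hper f
  have hu0 := fun x => (hupos x).ne'
  have hd := fun t (ht : t ∈ Ioi (0 : ℝ)) =>
    hp.hasDerivAt_entropy hφ hper hpp (Φ := fun y => y ^ 2) (Φ₁ := fun y => 2 * y)
      (Φ₂ := fun _ => 2) (fun y => by simpa using (hasDerivAt_id y).fun_pow 2)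
      (fun y => by simpa using (hasDerivAt_id y).const_mul 2) continuous_const (mem_Ioi.1 ht)
  have hgap : ∀ t, 0 < t → 2 * l * (∫ x in (0 : ℝ)..1, u0 φ f x * (p x t / u0 φ f x) ^ 2)
      ≤ ∫ x in (0 : ℝ)..1, u0 φ f x * (2 *
        ((F x t + J0 φ f * (p x t / u0 φ f x)) / u0 φ f x) ^ 2) := by
    intro t ht
    have hpc := hp.continuous_slice ht
    have hFc := hp.continuous_flux ht
    have hgc : Continuous fun x => p x t / u0 φ f x := hpc.div hu hu0
    have hg'c : Continuous fun x => (F x t + J0 φ f * (p x t / u0 φ f x)) / u0 φ f x :=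
      (hFc.add (hgc.const_mul _)).div hu hu0
    have hgd : ∀ x, HasDerivAt (fun x => p x t / u0 φ f x)
        ((F x t + J0 φ f * (p x t / u0 φ f x)) / u0 φ f x) x := fun x => by
      refine ((hp.space x t ht).div (hasDerivAt_u0 hφ hper f x) (hu0 x)).congr_deriv ?_
      have := hu0 x
      field_simp
      ring
    -- a continuous function of mean zero vanishes somewhere
    obtain ⟨z, hz, hpz⟩ : ∃ z ∈ Ioo (0 : ℝ) 1, p z t = 0 := by
      have hP : ∀ x, HasDerivAt (fun x => ∫ y in (0 : ℝ)..x, p y t) (p x t) x := fun x =>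
        intervalIntegral.integral_hasDerivAt_right (hpc.intervalIntegrable _ _)
          (hpc.stronglyMeasurableAtFilter _ _) hpc.continuousAt
      obtain ⟨z, hz, h⟩ := exists_hasDerivAt_eq_slope (fun x => ∫ y in (0 : ℝ)..x, p y t)
        (fun x => p x t) zero_lt_one (fun x _ => (hP x).continuousAt.continuousWithinAt)
        fun x _ => hP x
      refine ⟨z, hz, ?_⟩
      rw [h, hmean t ht]; simp
    set D := ∫ x in (0 : ℝ)..1, ((F x t + J0 φ f * (p x t / u0 φ f x)) / u0 φ f x) ^ 2 with hD
    have h1 : ∫ x in (0 : ℝ)..1, u0 φ f x * (p x t / u0 φ f x) ^ 2 ≤ D := by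
      have : ∫ x in (0 : ℝ)..1, u0 φ f x * (p x t / u0 φ f x) ^ 2
          ≤ ∫ x in (0 : ℝ)..1, u0 φ f x * D := by
        refine intervalIntegral.integral_mono_on zero_le_one
          ((hu.mul (hgc.pow 2)).intervalIntegrable _ _)
          ((hu.mul continuous_const).intervalIntegrable _ _) fun x hx => ?_
        exact mul_le_mul_of_nonneg_left (sq_le_integral_sq_deriv hgd hg'c
          (Ioo_subset_Icc_self hz) (by rw [hpz, zero_div]) hx) (hupos x).le
      rwa [intervalIntegral.integral_mul_const, integral_u0 hφ hper f, one_mul] at this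
    have h2 : 2 * l * D ≤ ∫ x in (0 : ℝ)..1, u0 φ f x * (2 *
        ((F x t + J0 φ f * (p x t / u0 φ f x)) / u0 φ f x) ^ 2) := by
      rw [hD, ← intervalIntegral.integral_const_mul]
      refine intervalIntegral.integral_mono_on zero_le_one
        ((hg'c.pow 2).const_mul _ |>.intervalIntegrable _ _)
        ((hu.mul ((hg'c.pow 2).const_mul 2)).intervalIntegrable _ _) fun x _ => ?_
      nlinarith [mul_le_mul_of_nonneg_right (hl x)
        (sq_nonneg ((F x t + J0 φ f * (p x t / u0 φ f x)) / u0 φ f x))]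
    nlinarith
  have hd2 := fun t (ht : t ∈ Ioi (0 : ℝ)) => by
    have h : HasDerivAt (fun t : ℝ => Real.exp (2 * l * t)) (2 * l * Real.exp (2 * l * t)) t := by
      have : HasDerivAt (fun t : ℝ => 2 * l * t) (2 * l) t := by
        simpa using (hasDerivAt_id t).const_mul (2 * l)
      exact this.exp.congr_deriv (mul_comm _ _)
    exact h.mul (hd t ht)
  have hanti := antitoneOn_of_deriv_nonpos (convex_Ioi 0)
    (fun t ht => (hd2 t ht).continuousAt.continuousWithinAt)
    (fun t ht => (hd2 t (interior_subset ht)).differentiableAt.differentiableWithinAt)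
    (fun t ht => by
      have ht' : (0 : ℝ) < t := interior_subset ht
      rw [(hd2 t (interior_subset ht)).deriv]
      nlinarith [mul_le_mul_of_nonneg_left (hgap t ht') (Real.exp_pos (2 * l * t)).le])
    (mem_Ioi.2 hs) (mem_Ioi.2 (hs.trans_le hst)) hst
  simp only [Pi.mul_apply] at hanti
  have e1 : Real.exp (-(2 * l * (t - s))) = Real.exp (2 * l * s) / Real.exp (2 * l * t) := by
    rw [← Real.exp_sub]; congr 1; ring
  rw [e1, div_mul_eq_mul_div, le_div_iff₀ (Real.exp_pos _), mul_comm]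
  exact hanti

end Entropy

/-! ### Mild solutions and their time averages -/

section Mild

variable {φ : ℝ → ℝ} {f : ℝ} {S : ℝ → ℝ → ℝ}

/-- `S` is a continuous function on `ℝ × (0, ∞)` which solves the Fokker-Planck equation after
integration in time: `∫ₐᶜ S` has a differentiable flux `F` with `F' = S(·, c) - S(·, a)`. -/
structure IsMildSolution (φ : ℝ → ℝ) (f : ℝ) (S : ℝ → ℝ → ℝ) : Prop where
  continuousOn : ContinuousOn (fun z : ℝ × ℝ => S z.1 z.2) (univ ×ˢ Ioi 0)
  integrated : ∀ a c, 0 < a → a < c → ∃ F : ℝ → ℝ, ∀ x,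
    HasDerivAt (fun y => ∫ s in a..c, S y s) (F x - (deriv φ x - f) * ∫ s in a..c, S x s) x ∧
    HasDerivAt F (S x c - S x a) x

/-- The average of `S` over the time interval `[t, t + ε]`. -/
noncomputable def timeAverage (ε : ℝ) (S : ℝ → ℝ → ℝ) (x t : ℝ) : ℝ :=
  ε⁻¹ * ∫ s in t..(t + ε), S x s

theorem ContinuousOn.slice_right {S : ℝ → ℝ → ℝ}
    (hS : ContinuousOn (fun z : ℝ × ℝ => S z.1 z.2) (univ ×ˢ Ioi 0)) (x : ℝ) :
    ContinuousOn (fun t => S x t) (Ioi 0) :=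
  hS.comp (f := fun t => (x, t)) (by fun_prop) fun _ ht => ⟨mem_univ _, ht⟩

theorem ContinuousOn.intervalIntegrable_Ioi {g : ℝ → ℝ} (hg : ContinuousOn g (Ioi 0)) {a b : ℝ}
    (ha : 0 < a) (hb : 0 < b) : IntervalIntegrable g volume a b :=
  (hg.mono fun _ hx => (lt_min ha hb).trans_le hx.1).intervalIntegrable

theorem IsMildSolution.sub {S' : ℝ → ℝ → ℝ} (hS : IsMildSolution φ f S)
    (hS' : IsMildSolution φ f S') : IsMildSolution φ f (fun x t => S x t - S' x t) := by
  refine ⟨hS.continuousOn.sub hS'.continuousOn, fun a c ha hac => ?_⟩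
  obtain ⟨F, hF⟩ := hS.integrated a c ha hac
  obtain ⟨F', hF'⟩ := hS'.integrated a c ha hac
  have e : ∀ y, ∫ s in a..c, (S y s - S' y s) = (∫ s in a..c, S y s) - ∫ s in a..c, S' y s :=
    fun y => intervalIntegral.integral_sub
      (ContinuousOn.intervalIntegrable_Ioi (ContinuousOn.slice_right hS.continuousOn y) ha
        (ha.trans hac))
      (ContinuousOn.intervalIntegrable_Ioi (ContinuousOn.slice_right hS'.continuousOn y) ha
        (ha.trans hac))
  refine ⟨fun x => F x - F' x, fun x => ⟨?_, ?_⟩⟩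
  · simp only [e]
    exact ((hF x).1.fun_sub (hF' x).1).congr_deriv (by ring)
  · exact ((hF x).2.fun_sub (hF' x).2).congr_deriv (by ring)

theorem IsMildSolution.isFluxSolution_timeAverage (hS : IsMildSolution φ f S) {ε : ℝ}
    (hε : 0 < ε) : ∃ F : ℝ → ℝ → ℝ, IsFluxSolution φ f (timeAverage ε S)
      (fun x t => ε⁻¹ * (S x (t + ε) - S x t)) F := by
  have hF : ∀ t : ℝ, ∃ F : ℝ → ℝ, 0 < t → ∀ x,
      HasDerivAt (fun y => ∫ s in t..(t + ε), S y s)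
        (F x - (deriv φ x - f) * ∫ s in t..(t + ε), S x s) x ∧
      HasDerivAt F (S x (t + ε) - S x t) x := fun t => by
    by_cases ht : 0 < t
    · obtain ⟨F, hF⟩ := hS.integrated t (t + ε) ht (by linarith)
      exact ⟨F, fun _ => hF⟩
    · exact ⟨0, fun h => absurd h ht⟩
  choose F hF using hF
  have hsl := fun x => ContinuousOn.slice_right hS.continuousOn x
  have hshift : ContinuousOn (fun z : ℝ × ℝ => S z.1 (z.2 + ε)) (univ ×ˢ Ioi 0) :=
    hS.continuousOn.comp (f := fun z : ℝ × ℝ => (z.1, z.2 + ε)) (by fun_prop)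
      fun z hz => ⟨mem_univ _, mem_Ioi.2 (by linarith [mem_Ioi.1 hz.2])⟩
  refine ⟨fun x t => ε⁻¹ * F t x, ?_, ?_, ?_, ?_, ?_⟩
  · have e : ∀ z : ℝ × ℝ, timeAverage ε S z.1 z.2 = ε⁻¹ * ∫ s in (0 : ℝ)..ε, S z.1 (z.2 + s) :=
      fun z => by
        have := intervalIntegral.integral_comp_add_left (a := 0) (b := ε) (fun s => S z.1 s) z.2
        rw [add_zero] at this
        rw [timeAverage, this]
    simp only [e]
    refine continuousOn_const.mul (continuousOn_intervalIntegral_param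
      (g := fun s (z : ℝ × ℝ) => S z.1 (z.2 + s)) ?_)
    refine hS.continuousOn.comp (f := fun z : ℝ × ℝ × ℝ => (z.2.1, z.2.2 + z.1)) (by fun_prop)
      fun z hz => ⟨mem_univ _, ?_⟩
    have h1 := hz.1.1
    rw [min_eq_left hε.le] at h1
    exact mem_Ioi.2 (by linarith [mem_Ioi.1 hz.2.2])
  · exact continuousOn_const.mul (hshift.sub hS.continuousOn)
  · intro x t ht
    have hprim : ∀ u, 0 < u → HasDerivAt (fun u => ∫ s in t..u, S x s) (S x u) u := fun u hu =>
      intervalIntegral.integral_hasDerivAt_right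
        (ContinuousOn.intervalIntegrable_Ioi (hsl x) ht hu)
        ((hsl x).stronglyMeasurableAtFilter isOpen_Ioi u hu)
        ((hsl x).continuousAt (Ioi_mem_nhds hu))
    have h := (((hprim (t + ε) (by linarith)).comp_add_const t ε).fun_sub
      (hprim t ht)).const_mul ε⁻¹
    refine h.congr_of_eventuallyEq ?_
    filter_upwards [Ioi_mem_nhds ht] with u hu
    have hu : 0 < u := hu
    rw [timeAverage, intervalIntegral.integral_interval_sub_left
      (ContinuousOn.intervalIntegrable_Ioi (hsl x) ht (by linarith))
      (ContinuousOn.intervalIntegrable_Ioi (hsl x) ht hu)]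
  · intro x t ht
    refine ((hF t ht x).1.const_mul ε⁻¹).congr_deriv ?_
    simp only [timeAverage]; ring
  · intro x t ht
    exact (hF t ht x).2.const_mul ε⁻¹

theorem periodic_timeAverage (hpp : ∀ t, 0 < t → Function.Periodic (fun x => S x t) 1) {ε : ℝ}
    (hε : 0 < ε) : ∀ t, 0 < t → Function.Periodic (fun x => timeAverage ε S x t) 1 := by
  intro t ht x
  simp only [timeAverage]
  congr 1
  refine intervalIntegral.integral_congr fun s hs => ?_
  rw [uIcc_of_le (by linarith)] at hs
  exact hpp s (ht.trans_le hs.1) x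

theorem abs_timeAverage_sub_le {ε t v η : ℝ} {x : ℝ} (hε : 0 < ε)
    (hS : ContinuousOn (fun t => S x t) (Ioi 0)) (ht : 0 < t)
    (h : ∀ s ∈ Icc t (t + ε), |S x s - v| ≤ η) : |timeAverage ε S x t - v| ≤ η := by
  have e : timeAverage ε S x t - v = ε⁻¹ * ∫ s in t..(t + ε), (S x s - v) := by
    rw [intervalIntegral.integral_sub
      (ContinuousOn.intervalIntegrable_Ioi hS ht (by linarith)) intervalIntegrable_const,
      intervalIntegral.integral_const, timeAverage]
    simp only [add_sub_cancel_left, smul_eq_mul]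
    field_simp
  have hb := intervalIntegral.norm_integral_le_of_norm_le_const (a := t) (b := t + ε)
    (f := fun s => S x s - v) (C := η) fun s hs => by
      rw [uIoc_of_le (by linarith)] at hs
      exact h s (Ioc_subset_Icc_self hs)
  rw [add_sub_cancel_left, abs_of_pos hε, Real.norm_eq_abs] at hb
  rw [e, abs_mul, abs_of_pos (inv_pos.2 hε), inv_mul_le_iff₀ hε, mul_comm]
  exact hb

theorem tendsto_timeAverage (hS : ContinuousOn (fun z : ℝ × ℝ => S z.1 z.2) (univ ×ˢ Ioi 0))
    {t : ℝ} (ht : 0 < t) (x : ℝ) :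
    Tendsto (fun ε => timeAverage ε S x t) (𝓝[>] 0) (𝓝 (S x t)) := by
  have hsl := ContinuousOn.slice_right hS x
  rw [Metric.tendsto_nhds]
  intro η hη
  obtain ⟨δ, hδ, h⟩ := Metric.continuousAt_iff.1 (hsl.continuousAt (Ioi_mem_nhds ht)) (η / 2)
    (by positivity)
  filter_upwards [Ioo_mem_nhdsGT hδ] with ε hε
  refine (abs_timeAverage_sub_le hε.1 hsl ht fun s hs => ?_).trans_lt (half_lt_self hη)
  refine (h ?_).le
  rw [Real.dist_eq, abs_of_nonneg (by linarith [hs.1])]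
  linarith [hs.2, hε.2]

theorem IsMildSolution.integral_abs_le (hφ : ContDiff ℝ 2 φ) (hper : Function.Periodic φ 1)
    (hS : IsMildSolution φ f S) (hpp : ∀ t, 0 < t → Function.Periodic (fun x => S x t) 1)
    {s t : ℝ} (hs : 0 < s) (hst : s ≤ t) :
    ∫ x in (0 : ℝ)..1, |S x t| ≤ ∫ x in (0 : ℝ)..1, |S x s| := by
  have key : ∀ t, 0 < t → Tendsto (fun ε => ∫ x in (0 : ℝ)..1, |timeAverage ε S x t|) (𝓝[>] 0)
      (𝓝 (∫ x in (0 : ℝ)..1, |S x t|)) := by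
    intro t ht
    obtain ⟨B, hB⟩ := ((isCompact_Icc (a := (0 : ℝ)) (b := 1)).prod
      (isCompact_Icc (a := t) (b := t + 1))).exists_bound_of_continuousOn
      (hS.continuousOn.mono fun z hz => ⟨mem_univ _, mem_Ioi.2 (ht.trans_le hz.2.1)⟩)
    refine intervalIntegral.tendsto_integral_filter_of_dominated_convergence (fun _ => B) ?_ ?_
      intervalIntegrable_const ?_
    · filter_upwards [self_mem_nhdsWithin] with ε hε
      obtain ⟨F, hF⟩ := hS.isFluxSolution_timeAverage hε
      exact (hF.continuous_slice ht).abs.aestronglyMeasurable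
    · filter_upwards [Ioo_mem_nhdsGT (zero_lt_one' ℝ)] with ε hε
      refine ae_of_all _ fun x hx => ?_
      rw [uIoc_of_le zero_le_one] at hx
      rw [Real.norm_eq_abs, abs_abs, ← sub_zero (timeAverage ε S x t)]
      refine abs_timeAverage_sub_le hε.1 (ContinuousOn.slice_right hS.continuousOn x) ht
        fun s hs => ?_
      rw [sub_zero]
      exact hB (x, s) ⟨Ioc_subset_Icc_self hx, hs.1, by linarith [hs.2, hε.2]⟩
    · exact ae_of_all _ fun x _ => (tendsto_timeAverage hS.continuousOn ht x).abs
  refine le_of_tendsto_of_tendsto (key t (hs.trans_le hst)) (key s hs) ?_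
  filter_upwards [self_mem_nhdsWithin] with ε hε
  obtain ⟨F, hF⟩ := hS.isFluxSolution_timeAverage hε
  exact hF.integral_abs_le hφ hper (periodic_timeAverage hpp hε) hs hst

/-- The mass over a period is conserved. -/
theorem IsMildSolution.integral_eq (hper : Function.Periodic φ 1)
    (hS : IsMildSolution φ f S) (hpp : ∀ t, 0 < t → Function.Periodic (fun x => S x t) 1)
    {s t : ℝ} (hs : 0 < s) (hst : s < t) :
    ∫ x in (0 : ℝ)..1, S x t = ∫ x in (0 : ℝ)..1, S x s := by
  have hst' : 0 < t - s := sub_pos.2 hst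
  obtain ⟨F, hF⟩ := hS.isFluxSolution_timeAverage hst'
  have h := intervalIntegral.integral_eq_sub_of_hasDerivAt (a := 0) (b := 1)
    (fun x _ => hF.flux x s hs) ((hF.continuous_slice_time hs).intervalIntegrable _ _)
  have h1 : F 1 s = F 0 s := by
    simpa using hF.periodic_flux hper (periodic_timeAverage hpp hst') hs 0
  rw [h1, sub_self, add_sub_cancel, intervalIntegral.integral_const_mul,
    intervalIntegral.integral_sub
      ((ContinuousOn.slice_left hS.continuousOn (hs.trans hst)).intervalIntegrable _ _)
      ((ContinuousOn.slice_left hS.continuousOn hs).intervalIntegrable _ _)] at h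
  rcases mul_eq_zero.1 h with h | h
  · exact absurd h (inv_ne_zero hst'.ne')
  · exact sub_eq_zero.1 h

/-- Uniform exponential decay of periodic solutions of mean zero; the constants depend on `φ` and
`f` only, and the solution enters through its size at time `1`. -/
theorem IsFluxSolution.exists_uniform_decay (hφ : ContDiff ℝ 2 φ) (hper : Function.Periodic φ 1)
    (f : ℝ) : ∃ C l : ℝ, 0 ≤ C ∧ 0 < l ∧ ∀ p pₜ F : ℝ → ℝ → ℝ, IsFluxSolution φ f p pₜ F →
    (∀ t, 0 < t → Function.Periodic (fun x => p x t) 1) →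
    (∀ t, 0 < t → ∫ x in (0 : ℝ)..1, p x t = 0) → ∀ B : ℝ, (∀ x ∈ Icc (0 : ℝ) 1, |p x 1| ≤ B) →
    ∀ x t : ℝ, 2 ≤ t → p x t ^ 2 ≤ C * B ^ 2 * Real.exp (-(2 * l * (t - 2))) := by
  obtain ⟨l, U, hl0, hU0, hlU⟩ := exists_u0_bounds hφ hper f
  obtain ⟨C, hC0, hC⟩ := IsFluxSolution.exists_local_bound_sq hφ hper f zero_lt_one 1
  refine ⟨C * (4 * U) * l⁻¹, l, by positivity, hl0, fun p pₜ F hp hpp hmean B hB x t ht => ?_⟩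
  have hu := continuous_u0 hφ hper f
  have hupos := u0_pos hφ hper f
  have hu0 := fun x => (hupos x).ne'
  set E : ℝ → ℝ := fun t => ∫ x in (0 : ℝ)..1, u0 φ f x * (p x t / u0 φ f x) ^ 2 with hE
  have hEdecay : ∀ s, t - 1 ≤ s → E s ≤ Real.exp (-(2 * l * (t - 2))) * E 1 := fun s hs => by
    have h := hp.quadratic_entropy_decay hφ hper hpp hmean hl0 (fun x => (hlU x).1) zero_lt_one
      (by linarith : 1 ≤ s)
    have hE1 : 0 ≤ E 1 := intervalIntegral.integral_nonneg zero_le_one fun x _ =>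
      mul_nonneg (hupos x).le (sq_nonneg _)
    refine h.trans (mul_le_mul_of_nonneg_right ?_ hE1)
    rw [Real.exp_le_exp]
    nlinarith
  have hE1 : E 1 ≤ l⁻¹ * B ^ 2 := by
    have hpc := hp.continuous_slice one_pos
    have hgc : Continuous fun x => p x 1 / u0 φ f x := hpc.div hu hu0
    have : E 1 ≤ ∫ x in (0 : ℝ)..1, l⁻¹ * B ^ 2 := by
      refine intervalIntegral.integral_mono_on zero_le_one
        ((hu.mul (hgc.pow 2)).intervalIntegrable _ _) intervalIntegrable_const fun x hx => ?_
      have h1 : p x 1 ^ 2 ≤ B ^ 2 := by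
        rw [← sq_abs]; exact pow_le_pow_left₀ (abs_nonneg _) (hB x hx) 2
      have h2 : u0 φ f x * (p x 1 / u0 φ f x) ^ 2 = (u0 φ f x)⁻¹ * p x 1 ^ 2 := by
        have := hu0 x
        field_simp
      rw [h2]
      exact mul_le_mul (inv_anti₀ hl0 (hlU x).1) h1 (sq_nonneg _) (by positivity)
    simpa using this
  have hsq : ∀ s, 0 < s → ∫ y in (x - 1)..(x + 1), p y s ^ 2 ≤ 2 * U * E s := fun s hs => by
    have hpc := hp.continuous_slice hs
    have hgc : Continuous fun x => p x s / u0 φ f x := hpc.div hu hu0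
    have hper2 : Function.Periodic (fun y => p y s ^ 2) 1 := fun y => by
      have : p (y + 1) s = p y s := hpp s hs y
      simp only [this]
    have hi : ∀ a b, IntervalIntegrable (fun y => p y s ^ 2) volume a b := fun a b =>
      (hpc.pow 2).intervalIntegrable _ _
    have e1 := hper2.intervalIntegral_add_eq (x - 1) 0
    have e2 := hper2.intervalIntegral_add_eq x 0
    rw [sub_add_cancel, zero_add] at e1
    rw [zero_add] at e2
    rw [← intervalIntegral.integral_add_adjacent_intervals (hi _ x) (hi _ _), e1, e2]
    have h3 : ∫ y in (0 : ℝ)..1, p y s ^ 2 ≤ U * E s := by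
      rw [hE, ← intervalIntegral.integral_const_mul]
      refine intervalIntegral.integral_mono_on zero_le_one (hi _ _)
        (((hu.mul (hgc.pow 2)).const_mul U).intervalIntegrable _ _) fun y _ => ?_
      have h2 : u0 φ f y * (u0 φ f y * (p y s / u0 φ f y) ^ 2) = p y s ^ 2 := by
        have := hu0 y
        field_simp
      rw [← h2]
      exact mul_le_mul_of_nonneg_right (hlU y).2 (mul_nonneg (hupos y).le (sq_nonneg _))
    linarith
  set A := 2 * U * (Real.exp (-(2 * l * (t - 2))) * (l⁻¹ * B ^ 2)) with hA
  have hbound : ∀ s, t - 1 ≤ s → ∫ y in (x - 1)..(x + 1), p y s ^ 2 ≤ A := fun s hs => by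
    refine (hsq s (by linarith)).trans (mul_le_mul_of_nonneg_left ?_ (by positivity))
    exact (hEdecay s hs).trans (mul_le_mul_of_nonneg_left hE1 (Real.exp_pos _).le)
  have h := hC p pₜ F hp x (t - 1) t (by linarith) (by linarith) (by linarith)
  have hint : ∫ s in (t - 1)..t, ∫ y in (x - 1)..(x + 1), p y s ^ 2 ≤ A := by
    have hcont : ContinuousOn (fun s => ∫ y in (x - 1)..(x + 1), p y s ^ 2) (Ioi 0) :=
      continuousOn_intervalIntegral_param (g := fun y s => p y s ^ 2)
        ((hp.continuousOn.pow 2).mono (prod_mono (subset_univ _) subset_rfl))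
    have : ∫ s in (t - 1)..t, ∫ y in (x - 1)..(x + 1), p y s ^ 2 ≤ ∫ s in (t - 1)..t, A :=
      intervalIntegral.integral_mono_on (by linarith)
        (ContinuousOn.intervalIntegrable_Ioi hcont (by linarith) (by linarith))
        intervalIntegrable_const fun s hs => hbound s hs.1
    simpa using this
  calc p x t ^ 2 ≤ C * (A + A) :=
        h.trans (mul_le_mul_of_nonneg_left (add_le_add (hbound _ le_rfl) hint) hC0)
    _ = _ := by rw [hA]; ring

/-- Periodic mild solutions of mean zero decay exponentially, uniformly in space. -/
theorem IsMildSolution.exists_uniform_decay (hφ : ContDiff ℝ 2 φ) (hper : Function.Periodic φ 1)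
    (hS : IsMildSolution φ f S) (hpp : ∀ t, 0 < t → Function.Periodic (fun x => S x t) 1)
    (hmean : ∀ t, 0 < t → ∫ x in (0 : ℝ)..1, S x t = 0) :
    ∃ A l : ℝ, 0 < l ∧ ∀ x t : ℝ, 2 ≤ t → S x t ^ 2 ≤ A * Real.exp (-(2 * l * (t - 2))) := by
  obtain ⟨C, l, hC0, hl0, h⟩ := IsFluxSolution.exists_uniform_decay hφ hper f
  obtain ⟨B, hB⟩ := ((isCompact_Icc (a := (0 : ℝ)) (b := 1)).prod
      (isCompact_Icc (a := (1 : ℝ)) (b := 1 + 1))).exists_bound_of_continuousOn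
      (hS.continuousOn.mono fun z hz => ⟨mem_univ _, mem_Ioi.2 (one_pos.trans_le hz.2.1)⟩)
  refine ⟨C * B ^ 2, l, hl0, fun x t ht => ?_⟩
  have ht0 : 0 < t := by linarith
  refine le_of_tendsto ((tendsto_timeAverage hS.continuousOn ht0 x).pow 2) ?_
  filter_upwards [Ioo_mem_nhdsGT (zero_lt_one' ℝ)] with ε hε
  obtain ⟨F, hF⟩ := hS.isFluxSolution_timeAverage hε.1
  refine h _ _ F hF (periodic_timeAverage hpp hε.1) (fun t ht => ?_) B (fun x hx => ?_) x t ht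
  · -- the mean of a time average is a time average of means
    have hsw : ∫ x in (0 : ℝ)..1, timeAverage ε S x t
        = ε⁻¹ * ∫ s in t..(t + ε), ∫ x in (0 : ℝ)..1, S x s := by
      simp only [timeAverage]
      rw [intervalIntegral.integral_const_mul]
      congr 1
      refine intervalIntegral_intervalIntegral_swap ?_
      refine (ContinuousOn.integrableOn_compact (isCompact_uIcc.prod isCompact_uIcc)
        (hS.continuousOn.mono fun z hz => ⟨mem_univ _, ?_⟩)).mono_set
          (prod_mono uIoc_subset_uIcc uIoc_subset_uIcc)
      have h1 := hz.2.1
      rw [min_eq_left (by linarith [hε.1])] at h1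
      exact ht.trans_le h1
    rw [hsw, intervalIntegral.integral_congr (g := fun _ => 0)]
    · simp
    · intro s hs
      rw [uIcc_of_le (by linarith [hε.1])] at hs
      exact hmean s (ht.trans_le hs.1)
  · rw [← sub_zero (timeAverage ε S x 1)]
    refine abs_timeAverage_sub_le hε.1 (ContinuousOn.slice_right hS.continuousOn x) one_pos
        fun s hs => ?_
    rw [sub_zero]
    exact hB (x, s) ⟨hx, hs.1, by linarith [hs.2, hε.2]⟩

end Mild

/-! ### First moments of the density on the line -/

section Moment

variable {φ : ℝ → ℝ} {f : ℝ} {ρ : ℝ → ℝ → ℝ} {ρ₀ : ℝ → ℝ}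

theorem IsFokkerPlanckDensity.isFluxSolution (hφ : ContDiff ℝ 2 φ)
    (hρ : IsFokkerPlanckDensity φ f ρ₀ ρ) :
    IsFluxSolution φ f ρ (fun x t => deriv (fun s => ρ x s) t)
      (fun x t => (deriv φ x - f) * ρ x t + deriv (fun y => ρ y t) x) := by
  have hd : ∀ t, 0 < t → ∀ x, HasDerivAt (fun y => ρ y t) (deriv (fun y => ρ y t) x) x :=
    fun t ht x => ((hρ.contDiff_space t ht).differentiable (by norm_num) x).hasDerivAt
  refine ⟨hρ.continuousOn, hρ.continuousOn_deriv_time,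
    fun x t ht => (hρ.differentiableAt_time x t ht).hasDerivAt,
    fun x t ht => (hd t ht x).congr_deriv (by ring), fun x t ht => ?_⟩
  rw [hρ.equation x t ht]
  have h1 : DifferentiableAt ℝ (deriv fun y => ρ y t) x :=
    (contDiff_deriv_phi (hρ.contDiff_space t ht)).differentiable (by norm_num) x
  have h2 := hasDerivAt_deriv_phi hφ x
  exact (((h2.sub_const f).mul (hd t ht x)).add h1.hasDerivAt).differentiableAt.hasDerivAt

theorem initialDensity_of_mem {x : ℝ} (hx : x ∈ Icc (0 : ℝ) 1) :
    initialDensity φ f x = u0 φ f x := indicator_of_mem hx _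

theorem integrable_initialDensity (hφ : ContDiff ℝ 2 φ) (hper : Function.Periodic φ 1) (f : ℝ) :
    Integrable (initialDensity φ f) :=
  (continuous_u0 hφ hper f).integrableOn_Icc.integrable_indicator measurableSet_Icc

/-- The weight `√(1 + x²)` of the first moment. -/
noncomputable def momentWeight (x : ℝ) : ℝ := √(1 + x ^ 2)

theorem continuous_momentWeight : Continuous momentWeight := by
  unfold momentWeight; fun_prop

theorem one_le_momentWeight (x : ℝ) : 1 ≤ momentWeight x := by
  rw [momentWeight, Real.one_le_sqrt]; nlinarith

theorem momentWeight_pos (x : ℝ) : 0 < momentWeight x := one_pos.trans_le (one_le_momentWeight x)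

theorem abs_le_momentWeight (x : ℝ) : |x| ≤ momentWeight x :=
  Real.abs_le_sqrt (by linarith)

theorem momentWeight_le (x : ℝ) : momentWeight x ≤ 1 + |x| := by
  rw [momentWeight, Real.sqrt_le_left (by positivity), ← sq_abs x]
  nlinarith [abs_nonneg x]

theorem hasDerivAt_momentWeight (x : ℝ) :
    HasDerivAt momentWeight (x / momentWeight x) x := by
  have : HasDerivAt (fun x : ℝ => 1 + x ^ 2) (2 * x) x := by
    simpa using ((hasDerivAt_id x).fun_pow 2).const_add 1
  refine (this.sqrt (by positivity)).congr_deriv ?_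
  have h : √(1 + x ^ 2) ≠ 0 := (momentWeight_pos x).ne'
  unfold momentWeight
  field_simp

theorem hasDerivAt_momentWeight_two (x : ℝ) :
    HasDerivAt (fun x => x / momentWeight x) (1 / momentWeight x ^ 3) x := by
  have h := (momentWeight_pos x).ne'
  refine ((hasDerivAt_id x).div (hasDerivAt_momentWeight x) h).congr_deriv ?_
  have h2 : momentWeight x ^ 2 = 1 + x ^ 2 := Real.sq_sqrt (by positivity)
  simp only [id]
  field_simp
  rw [h2]; ring

/-- Growth of the integral of the density against a compactly supported test function `ψ`. -/
theorem IsFokkerPlanckDensity.integral_test_le (hφ : ContDiff ℝ 2 φ)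
    (hρ : IsFokkerPlanckDensity φ f ρ₀ ρ) {ψ ψ₁ ψ₂ : ℝ → ℝ} {R K : ℝ} (hR : 0 < R)
    (hK : 0 ≤ K)
    (hψ : ∀ x, HasDerivAt ψ (ψ₁ x) x) (hψ₁ : ∀ x, HasDerivAt ψ₁ (ψ₂ x) x) (hψ₂ : Continuous ψ₂)
    (hz : ψ R = 0 ∧ ψ (-R) = 0 ∧ ψ₁ R = 0 ∧ ψ₁ (-R) = 0)
    (hb : ∀ x ∈ Icc (-R) R, ψ₂ x - (deriv φ x - f) * ψ₁ x ≤ K) {s t : ℝ} (hs : 0 < s)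
    (hst : s ≤ t) :
    ∫ x in (-R)..R, ρ x t * ψ x ≤ (∫ x in (-R)..R, ρ x s * ψ x) + K * (t - s) := by
  have hp := hρ.isFluxSolution hφ
  have hψc : Continuous ψ := continuous_iff_continuousAt.2 fun x => (hψ x).continuousAt
  have hψ₁c : Continuous ψ₁ := continuous_iff_continuousAt.2 fun x => (hψ₁ x).continuousAt
  have hφ'c := (contDiff_deriv_phi hφ).continuous
  have hsub : uIcc (-R) R ×ˢ Ioi (0 : ℝ) ⊆ univ ×ˢ Ioi 0 :=
    prod_mono (subset_univ _) subset_rfl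
  have hψon : ContinuousOn (fun z : ℝ × ℝ => ψ z.1) (univ ×ˢ Ioi 0) :=
    (hψc.comp continuous_fst).continuousOn
  have hder : ∀ t, 0 < t → HasDerivAt (fun t => ∫ x in (-R)..R, ρ x t * ψ x)
      (∫ x in (-R)..R, deriv (fun s => ρ x s) t * ψ x) t := fun t ht =>
    hasDerivAt_intervalIntegral_param isOpen_Ioi (mem_Ioi.2 ht)
      ((hp.continuousOn.mul hψon).mono hsub) ((hp.continuousOn_time.mul hψon).mono hsub)
      fun x _ t ht => (hp.time x t ht).mul_const _
  have hle : ∀ t, 0 < t → ∫ x in (-R)..R, deriv (fun s => ρ x s) t * ψ x ≤ K := by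
    intro t ht
    have hpc := hp.continuous_slice ht
    have hptc := hp.continuous_slice_time ht
    have hbig : ∀ x, HasDerivAt (fun x => ((deriv φ x - f) * ρ x t + deriv (fun y => ρ y t) x) * ψ x
        - ρ x t * ψ₁ x) (deriv (fun s => ρ x s) t * ψ x
          - ρ x t * (ψ₂ x - (deriv φ x - f) * ψ₁ x)) x := fun x =>
      (((hp.flux x t ht).fun_mul (hψ x)).fun_sub
        ((hp.space x t ht).fun_mul (hψ₁ x))).congr_deriv (by ring)
    have hc1 : Continuous fun x => deriv (fun s => ρ x s) t * ψ x := hptc.mul hψc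
    have hc2 : Continuous fun x => ρ x t * (ψ₂ x - (deriv φ x - f) * ψ₁ x) := by fun_prop
    have h0 := intervalIntegral.integral_eq_sub_of_hasDerivAt (a := -R) (b := R)
      (fun x _ => hbig x) ((hc1.sub hc2).intervalIntegrable _ _)
    rw [hz.1, hz.2.1, hz.2.2.1, hz.2.2.2, intervalIntegral.integral_sub
      (hc1.intervalIntegrable _ _) (hc2.intervalIntegrable _ _)] at h0
    have h1 : ∫ x in (-R)..R, ρ x t * (ψ₂ x - (deriv φ x - f) * ψ₁ x)
        ≤ ∫ x in (-R)..R, ρ x t * K :=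
      intervalIntegral.integral_mono_on (by linarith) (hc2.intervalIntegrable _ _)
        ((hpc.mul_const K).intervalIntegrable _ _)
        fun x hx => mul_le_mul_of_nonneg_left (hb x hx) (hρ.nonneg x t ht)
    have h2 : ∫ x in (-R)..R, ρ x t ≤ 1 := by
      rw [intervalIntegral.integral_of_le (by linarith), ← hρ.mass t ht]
      exact setIntegral_le_integral (hρ.integrable t ht)
        (ae_of_all _ fun x => hρ.nonneg x t ht)
    rw [intervalIntegral.integral_mul_const] at h1
    nlinarith
  have hanti : AntitoneOn (fun t => (∫ x in (-R)..R, ρ x t * ψ x) - K * t) (Ioi 0) := by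
    have hd : ∀ t, 0 < t → HasDerivAt (fun t => (∫ x in (-R)..R, ρ x t * ψ x) - K * t)
        ((∫ x in (-R)..R, deriv (fun s => ρ x s) t * ψ x) - K) t := fun t ht => by
      simpa using (hder t ht).fun_sub ((hasDerivAt_id t).const_mul K)
    refine antitoneOn_of_deriv_nonpos (convex_Ioi 0)
      (fun t ht => (hd t ht).continuousAt.continuousWithinAt)
      (fun t ht => (hd t (interior_subset ht)).differentiableAt.differentiableWithinAt)
      fun t ht => ?_
    rw [(hd t (interior_subset ht)).deriv]
    linarith [hle t (interior_subset ht)]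
  have := hanti (mem_Ioi.2 hs) (mem_Ioi.2 (hs.trans_le hst)) hst
  simp only at this
  linarith

theorem abs_integral_mul_sub_le {g g₀ ψ : ℝ → ℝ} {a b M : ℝ} (hab : a ≤ b)
    (hg : Integrable g) (hg₀ : Integrable g₀) (hψ : Continuous ψ)
    (hM : ∀ x ∈ Icc a b, |ψ x| ≤ M) :
    |(∫ x in a..b, g x * ψ x) - ∫ x in a..b, g₀ x * ψ x| ≤ M * ∫ x, |g x - g₀ x| := by
  have hi : ∀ {g : ℝ → ℝ}, Integrable g → IntervalIntegrable (fun x => g x * ψ x) volume a b :=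
    fun hg => hg.intervalIntegrable.mul_continuousOn hψ.continuousOn
  have hM0 : 0 ≤ M := (abs_nonneg _).trans (hM a (left_mem_Icc.2 hab))
  rw [← intervalIntegral.integral_sub (hi hg) (hi hg₀)]
  calc |∫ x in a..b, (g x * ψ x - g₀ x * ψ x)|
      ≤ ∫ x in a..b, |g x * ψ x - g₀ x * ψ x| :=
        intervalIntegral.abs_integral_le_integral_abs hab
    _ ≤ ∫ x in a..b, M * |g x - g₀ x| := by
        refine intervalIntegral.integral_mono_on hab ((hi hg).sub (hi hg₀)).abs
          ((hg.sub hg₀).abs.const_mul M).intervalIntegrable fun x hx => ?_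
        rw [← sub_mul, abs_mul, mul_comm]
        exact mul_le_mul_of_nonneg_right (hM x hx) (abs_nonneg _)
    _ ≤ M * ∫ x, |g x - g₀ x| := by
        rw [intervalIntegral.integral_const_mul, intervalIntegral.integral_of_le hab]
        exact mul_le_mul_of_nonneg_left (setIntegral_le_integral (hg.sub hg₀).abs
          (ae_of_all _ fun x => abs_nonneg _)) hM0

/-- The first moment is finite and grows at most linearly, starting from its initial value. -/
theorem IsFokkerPlanckDensity.exists_moment_bound (hφ : ContDiff ℝ 2 φ)
    (hper : Function.Periodic φ 1)
    (hρ : IsFokkerPlanckDensity φ f (initialDensity φ f) ρ) : ∃ K : ℝ, 0 ≤ K ∧ ∀ t, 0 < t →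
      Integrable (fun x => ρ x t * momentWeight x) ∧
      ∫ x, ρ x t * momentWeight x
        ≤ (∫ x in (0 : ℝ)..1, initialDensity φ f x * momentWeight x) + K * t := by
  obtain ⟨χ, χ₁, χ₂, C, hC0, hχ, hχ₁, hχ₂, hχnn, hχle, hχin, -, hχout, hχ₁out, hχC⟩ :=
    exists_cutoff
  have hφ'c := (contDiff_deriv_phi hφ).continuous
  obtain ⟨B, hB0, hB⟩ := Periodic.exists_abs_le (g := fun x => deriv φ x - f)
    (fun x => by simp only [Periodic.deriv hper x]) (by fun_prop)
  have hχc : Continuous χ := continuous_iff_continuousAt.2 fun y => (hχ y).continuousAt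
  have hχ₁c : Continuous χ₁ := continuous_iff_continuousAt.2 fun y => (hχ₁ y).continuousAt
  have hmc := continuous_momentWeight
  have hm0 := fun x => (momentWeight_pos x).ne'
  have hi₀ := integrable_initialDensity hφ hper f
  have hi₀nn : ∀ x, 0 ≤ initialDensity φ f x := fun x =>
    indicator_nonneg (fun y _ => (u0_pos hφ hper f y).le) x
  set K := (1 + 4 * C) + B * (1 + 2 * C) with hK
  have hK0 : 0 ≤ K := by positivity
  set A := ∫ x in (0 : ℝ)..1, initialDensity φ f x * momentWeight x with hA
  have htest : ∀ R : ℝ, 1 ≤ R → ∀ t, 0 < t →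
      ∫ x in (-(R / 2))..(R / 2), ρ x t * momentWeight x ≤ A + K * t := by
    intro R hR t ht
    have hR0 : 0 < R := one_pos.trans_le hR
    set ψ : ℝ → ℝ := fun x => momentWeight x * χ (x / R) with hψdef
    set ψ₁ : ℝ → ℝ := fun x => x / momentWeight x * χ (x / R)
      + momentWeight x * (χ₁ (x / R) * R⁻¹) with hψ₁def
    set ψ₂ : ℝ → ℝ := fun x => 1 / momentWeight x ^ 3 * χ (x / R)
      + 2 * (x / momentWeight x * (χ₁ (x / R) * R⁻¹))
      + momentWeight x * (χ₂ (x / R) * R⁻¹ * R⁻¹) with hψ₂def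
    have hdiv : ∀ x, HasDerivAt (fun x : ℝ => x / R) R⁻¹ x := fun x => by
      simpa using (hasDerivAt_id x).div_const R
    have hψ : ∀ x, HasDerivAt ψ (ψ₁ x) x := fun x =>
      (hasDerivAt_momentWeight x).mul ((hχ _).comp x (hdiv x))
    have hψ₁ : ∀ x, HasDerivAt ψ₁ (ψ₂ x) x := fun x =>
      (((hasDerivAt_momentWeight_two x).fun_mul ((hχ _).comp x (hdiv x))).fun_add
        ((hasDerivAt_momentWeight x).fun_mul
          (((hχ₁ _).comp x (hdiv x)).mul_const R⁻¹))).congr_deriv (by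
            simp only [hψ₂def, Function.comp_apply]; ring)
    have hψc : Continuous ψ := by fun_prop
    have hψ₂c : Continuous ψ₂ := by
      refine ((Continuous.mul (continuous_const.div (hmc.pow 3) fun x => pow_ne_zero 3 (hm0 x))
        (by fun_prop)).add (continuous_const.mul (Continuous.mul
        (continuous_id.div hmc hm0) (by fun_prop)))).add (by fun_prop)
    have hψnn : ∀ x, 0 ≤ ψ x := fun x => mul_nonneg (momentWeight_pos x).le (hχnn _)
    have hψle : ∀ x, ψ x ≤ momentWeight x := fun x =>
      mul_le_of_le_one_right (momentWeight_pos x).le (hχle _)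
    have hz : ψ R = 0 ∧ ψ (-R) = 0 ∧ ψ₁ R = 0 ∧ ψ₁ (-R) = 0 := by
      have e1 : R / R = 1 := div_self hR0.ne'
      have e2 : -R / R = -1 := by rw [neg_div, e1]
      have a1 : (1 : ℝ) ≤ |1| := by norm_num
      have a2 : (1 : ℝ) ≤ |-1| := by norm_num
      simp only [hψdef, hψ₁def, e1, e2, hχout 1 a1, hχout (-1) a2, (hχ₁out 1 a1).1,
        (hχ₁out (-1) a2).1]
      simp
    have hb : ∀ x ∈ Icc (-R) R, ψ₂ x - (deriv φ x - f) * ψ₁ x ≤ K := by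
      intro x hx
      have hm1 := one_le_momentWeight x
      have hmR : momentWeight x * R⁻¹ ≤ 2 := by
        rw [← div_eq_mul_inv, div_le_iff₀ hR0]
        linarith [momentWeight_le x, abs_le.2 hx]
      have hmR0 : 0 ≤ momentWeight x * R⁻¹ := by
        have := momentWeight_pos x
        positivity
      have hRi : R⁻¹ ≤ 1 := inv_le_one_of_one_le₀ hR
      have hRi0 : 0 ≤ R⁻¹ := by positivity
      have hxm : |x / momentWeight x| ≤ 1 := by
        rw [abs_div, abs_of_pos (momentWeight_pos x)]
        exact div_le_one_of_le₀ (abs_le_momentWeight x) (momentWeight_pos x).le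
      have hm3 : |1 / momentWeight x ^ 3| ≤ 1 := by
        rw [abs_of_nonneg (by have := momentWeight_pos x; positivity)]
        exact div_le_one_of_le₀ (one_le_pow₀ hm1) (by have := momentWeight_pos x; positivity)
      have hχa : |χ (x / R)| ≤ 1 := by rw [abs_of_nonneg (hχnn _)]; exact hχle _
      have hχ₁a := (hχC (x / R)).1
      have hχ₂a := (hχC (x / R)).2
      have b1 : |ψ₁ x| ≤ 1 + 2 * C := by
        have e : ψ₁ x = x / momentWeight x * χ (x / R)
          + (momentWeight x * R⁻¹) * χ₁ (x / R) := by simp only [hψ₁def]; ring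
        rw [e]
        refine (abs_add_le _ _).trans ?_
        rw [abs_mul, abs_mul, abs_of_nonneg hmR0]
        calc _ ≤ 1 * 1 + 2 * C := by gcongr
          _ = _ := by ring
      have b2 : |ψ₂ x| ≤ 1 + 4 * C := by
        have e : ψ₂ x = 1 / momentWeight x ^ 3 * χ (x / R)
          + (2 * (x / momentWeight x)) * (χ₁ (x / R) * R⁻¹)
          + (momentWeight x * R⁻¹) * (χ₂ (x / R) * R⁻¹) := by simp only [hψ₂def]; ring
        rw [e]
        refine (abs_add_three _ _ _).trans ?_
        rw [abs_mul, abs_mul, abs_mul _ (χ₂ (x / R) * R⁻¹),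
          abs_mul (χ₁ _), abs_mul (χ₂ _), abs_mul 2, abs_of_nonneg hmR0, abs_of_nonneg hRi0,
          abs_of_pos (two_pos : (0 : ℝ) < 2)]
        calc _ ≤ 1 * 1 + (2 * 1) * (C * 1) + 2 * (C * 1) := by gcongr
          _ = _ := by ring
      have b3 : |(deriv φ x - f) * ψ₁ x| ≤ B * (1 + 2 * C) := by
        rw [abs_mul]
        exact mul_le_mul (hB x) b1 (abs_nonneg _) hB0
      linarith [abs_le.1 b2, abs_le.1 b3]
    -- let the initial time tend to zero
    have hM : ∀ x ∈ Icc (-R) R, |ψ x| ≤ 1 + R := fun x hx => by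
      rw [abs_of_nonneg (hψnn x)]
      linarith [hψle x, momentWeight_le x, abs_le.2 hx]
    have hlim : Tendsto (fun s => (∫ x in (-R)..R, initialDensity φ f x * ψ x)
        + (1 + R) * (∫ x, |ρ x s - initialDensity φ f x|) + K * (t - s)) (𝓝[>] 0)
        (𝓝 ((∫ x in (-R)..R, initialDensity φ f x * ψ x) + (1 + R) * 0 + K * (t - 0))) := by
      refine (tendsto_const_nhds.add (hρ.initial.const_mul _)).add ?_
      have : Continuous fun s => K * (t - s) := by fun_prop
      exact (this.tendsto 0).mono_left nhdsWithin_le_nhds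
    have h1 : ∫ x in (-R)..R, ρ x t * ψ x
        ≤ (∫ x in (-R)..R, initialDensity φ f x * ψ x) + (1 + R) * 0 + K * (t - 0) := by
      refine ge_of_tendsto hlim ?_
      filter_upwards [Ioo_mem_nhdsGT ht] with s hs
      have h2 := hρ.integral_test_le hφ hR0 hK0 hψ hψ₁ hψ₂c hz hb hs.1 hs.2.le
      have h3 := abs_integral_mul_sub_le (by linarith : -R ≤ R) (hρ.integrable s hs.1) hi₀ hψc hM
      linarith [(abs_le.1 h3).2]
    have h2 : ∫ x in (-R)..R, initialDensity φ f x * ψ x ≤ A := by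
      have hii : ∀ a b, IntervalIntegrable (fun x => initialDensity φ f x * ψ x) volume a b :=
        fun a b => hi₀.intervalIntegrable.mul_continuousOn hψc.continuousOn
      have e : ∫ x in (-R)..R, initialDensity φ f x * ψ x
          = ∫ x in (0 : ℝ)..1, initialDensity φ f x * ψ x := by
        rw [intervalIntegral.integral_of_le (by linarith), ← integral_Icc_eq_integral_Ioc,
          intervalIntegral.integral_of_le zero_le_one, ← integral_Icc_eq_integral_Ioc]
        refine setIntegral_eq_of_subset_of_forall_sdiff_eq_zero measurableSet_Icc
          (Icc_subset_Icc (by linarith) hR) fun x hx => ?_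
        rw [initialDensity, indicator_of_notMem hx.2, zero_mul]
      rw [e, hA]
      exact intervalIntegral.integral_mono_on zero_le_one (hii _ _)
        (hi₀.intervalIntegrable.mul_continuousOn hmc.continuousOn)
        fun x _ => mul_le_mul_of_nonneg_left (hψle x) (hi₀nn x)
    have hpc := (hρ.isFluxSolution hφ).continuous_slice ht
    have h3 : ∫ x in (-(R / 2))..(R / 2), ρ x t * momentWeight x ≤ ∫ x in (-R)..R, ρ x t * ψ x := by
      have e : ∫ x in (-(R / 2))..(R / 2), ρ x t * momentWeight x
          = ∫ x in (-(R / 2))..(R / 2), ρ x t * ψ x := by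
        refine intervalIntegral.integral_congr fun x hx => ?_
        rw [uIcc_of_le (by linarith)] at hx
        have : χ (x / R) = 1 := hχin _ (by
          rw [abs_div, abs_of_pos hR0, div_le_iff₀ hR0]
          linarith [abs_le.2 hx])
        simp only [hψdef, this, mul_one]
      rw [e, intervalIntegral.integral_of_le (by linarith),
        intervalIntegral.integral_of_le (by linarith)]
      exact setIntegral_mono_set (hpc.mul hψc).integrableOn_Ioc
        (ae_of_all _ fun x => mul_nonneg (hρ.nonneg x t ht) (hψnn x))
        (Eventually.of_forall (Ioc_subset_Ioc (by linarith) (by linarith)))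
    linarith
  refine ⟨K, hK0, fun t ht => ?_⟩
  have hpc := (hρ.isFluxSolution hφ).continuous_slice ht
  have hb : Tendsto (fun R : ℝ => R / 2) atTop atTop := tendsto_id.atTop_div_const two_pos
  have ha : Tendsto (fun R : ℝ => -(R / 2)) atTop atBot := tendsto_neg_atTop_atBot.comp hb
  have hint : Integrable fun x => ρ x t * momentWeight x := by
    refine integrable_of_intervalIntegral_norm_bounded (A + K * t)
      (fun R => (hpc.mul hmc).integrableOn_Ioc) ha hb ?_
    filter_upwards [eventually_ge_atTop (1 : ℝ)] with R hR
    refine le_trans (le_of_eq ?_) (htest R hR t ht)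
    refine intervalIntegral.integral_congr fun x _ => ?_
    exact Real.norm_of_nonneg (mul_nonneg (hρ.nonneg x t ht) (momentWeight_pos x).le)
  refine ⟨hint, le_of_tendsto (intervalIntegral_tendsto_integral hint ha hb) ?_⟩
  filter_upwards [eventually_ge_atTop (1 : ℝ)] with R hR using htest R hR t ht

/-- No first moment escapes from the unit cell at small times. -/
theorem IsFokkerPlanckDensity.tendsto_moment_outside (hφ : ContDiff ℝ 2 φ)
    (hper : Function.Periodic φ 1) (hρ : IsFokkerPlanckDensity φ f (initialDensity φ f) ρ) :
    Tendsto (fun t => (∫ x, ρ x t * momentWeight x) - ∫ x in (0 : ℝ)..1, ρ x t * momentWeight x)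
      (𝓝[>] 0) (𝓝 0) := by
  obtain ⟨K, hK0, hK⟩ := hρ.exists_moment_bound hφ hper
  have hlim : Tendsto (fun t => 2 * (∫ x, |ρ x t - initialDensity φ f x|) + K * t) (𝓝[>] 0)
      (𝓝 (2 * 0 + K * 0)) := by
    refine (hρ.initial.const_mul _).add ?_
    have : Continuous fun s => K * s := by fun_prop
    exact (this.tendsto 0).mono_left nhdsWithin_le_nhds
  rw [mul_zero, mul_zero, add_zero] at hlim
  refine tendsto_of_tendsto_of_tendsto_of_le_of_le' tendsto_const_nhds hlim ?_ ?_
  · filter_upwards [self_mem_nhdsWithin] with t ht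
    rw [sub_nonneg, intervalIntegral.integral_of_le zero_le_one]
    exact setIntegral_le_integral (hK t ht).1
      (ae_of_all _ fun x => mul_nonneg (hρ.nonneg x t ht) (momentWeight_pos x).le)
  · filter_upwards [self_mem_nhdsWithin] with t ht
    have h1 := abs_integral_mul_sub_le (zero_le_one' ℝ) (hρ.integrable t ht)
      (integrable_initialDensity hφ hper f) continuous_momentWeight (M := 2) fun x hx => by
        rw [abs_of_pos (momentWeight_pos x)]
        have := momentWeight_le x
        rw [abs_of_nonneg hx.1] at this
        linarith [hx.2]
    linarith [(abs_le.1 h1).1, (hK t ht).2]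

end Moment

/-! ### Periodized moments are mild solutions -/

section Series

variable {φ : ℝ → ℝ} {f : ℝ} {ρ : ℝ → ℝ → ℝ} {ρ₀ : ℝ → ℝ}

theorem sum_intervalIntegral_le {g : ℝ → ℝ} (hg : Integrable g) (hnn : ∀ x, 0 ≤ g x) (x₀ : ℝ)
    (J : Finset ℤ) : ∑ j ∈ J, ∫ y in (x₀ + j - 2)..(x₀ + j + 2), g y ≤ 4 * ∫ y, g y := by
  have h1 : ∀ z : ℝ, ∑ j ∈ J, ∫ y in (z + j)..(z + j + 1), g y ≤ ∫ y, g y := fun z =>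
    sum_le_hasSum J (fun j _ => intervalIntegral.integral_nonneg (by linarith) fun y _ => hnn y)
      (hg.hasSum_intervalIntegral z)
  have hi : ∀ a b, IntervalIntegrable g volume a b := fun a b => hg.intervalIntegrable
  have e : ∀ j : ℤ, ∫ y in (x₀ + j - 2)..(x₀ + j + 2), g y
      = (∫ y in (x₀ - 2 + j)..(x₀ - 2 + j + 1), g y)
        + (∫ y in (x₀ - 1 + j)..(x₀ - 1 + j + 1), g y)
        + (∫ y in (x₀ + j)..(x₀ + j + 1), g y)
        + (∫ y in (x₀ + 1 + j)..(x₀ + 1 + j + 1), g y) := fun j => by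
    have e1 : x₀ - 2 + j + 1 = x₀ - 1 + j := by ring
    have e2 : x₀ - 1 + j + 1 = x₀ + j := by ring
    have e3 : x₀ + j + 1 = x₀ + 1 + j := by ring
    have e4 : x₀ + 1 + j + 1 = x₀ + j + 2 := by ring
    have e5 : x₀ - 2 + j = x₀ + j - 2 := by ring
    rw [e1, e2, e3, e4, e5]
    rw [intervalIntegral.integral_add_adjacent_intervals (hi _ _) (hi _ _),
      intervalIntegral.integral_add_adjacent_intervals (hi _ _) (hi _ _),
      intervalIntegral.integral_add_adjacent_intervals (hi _ _) (hi _ _)]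
  simp only [e, Finset.sum_add_distrib]
  linarith [h1 (x₀ - 2), h1 (x₀ - 1), h1 x₀, h1 (x₀ + 1)]

/-- Locally uniform summable majorant: by the local bound for nonnegative solutions,
`(1 + |j|) ρ(j + x, t)` is controlled by the first moment carried by a neighbourhood of `j + x`. -/
theorem IsFokkerPlanckDensity.exists_summable_bound (hφ : ContDiff ℝ 2 φ)
    (hper : Function.Periodic φ 1) (hρ : IsFokkerPlanckDensity φ f (initialDensity φ f) ρ)
    (x₀ : ℝ) {a c : ℝ} (ha : 0 < a) (hac : a < c) : ∃ m : ℤ → ℝ, Summable m ∧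
      ∀ x, |x - x₀| ≤ 1 → ∀ t ∈ Icc a c, ∀ j : ℤ, (1 + |(j : ℝ)|) * ρ (j + x) t ≤ m j := by
  obtain ⟨K, hK0, hK⟩ := hρ.exists_moment_bound hφ hper
  obtain ⟨C, hC0, hC⟩ :=
    IsFluxSolution.exists_local_bound_of_nonneg hφ hper f (half_pos ha) c
  have hp := hρ.isFluxSolution hφ
  have hmc := continuous_momentWeight
  set s₀ := a / 2 with hs₀def
  have hs₀ : 0 < s₀ := half_pos ha
  have hs₀c : s₀ ≤ c := by linarith
  set D := 4 + |x₀| with hD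
  have hD0 : 0 ≤ D := by positivity
  set M := (∫ x in (0 : ℝ)..1, initialDensity φ f x * momentWeight x) + K * c with hM
  have hMle : ∀ s, 0 < s → s ≤ c → ∫ x, ρ x s * momentWeight x ≤ M := fun s hs hsc =>
    (hK s hs).2.trans (by rw [hM]; gcongr)
  set α : ℤ → ℝ → ℝ := fun j s =>
    ∫ y in (x₀ + j - 2)..(x₀ + j + 2), ρ y s * momentWeight y with hα
  have hρm : ∀ s, 0 < s → ∀ y, 0 ≤ ρ y s * momentWeight y := fun s hs y =>
    mul_nonneg (hρ.nonneg y s hs) (momentWeight_pos y).le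
  have hα0 : ∀ j s, 0 < s → 0 ≤ α j s := fun j s hs =>
    intervalIntegral.integral_nonneg (by linarith) fun y _ => hρm s hs y
  have hαsum : ∀ s, 0 < s → s ≤ c → ∀ J : Finset ℤ, ∑ j ∈ J, α j s ≤ 4 * M :=
    fun s hs hsc J => (sum_intervalIntegral_le (hK s hs).1 (hρm s hs) x₀ J).trans
      (by linarith [hMle s hs hsc])
  have hαc : ∀ j, ContinuousOn (α j) (Ioi 0) := fun j =>
    continuousOn_intervalIntegral_param (g := fun y s => ρ y s * momentWeight y)
      ((hp.continuousOn.mul (hmc.comp continuous_fst).continuousOn).mono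
        (prod_mono (subset_univ _) subset_rfl))
  have hαi : ∀ j u v, 0 < u → 0 < v → IntervalIntegrable (α j) volume u v :=
    fun j u v hu hv => ContinuousOn.intervalIntegrable_Ioi (hαc j) hu hv
  refine ⟨fun j => C * (D * (α j s₀ + ∫ s in s₀..c, α j s)), ?_, ?_⟩
  · refine Summable.mul_left _ (Summable.mul_left _ ?_)
    have hI0 : ∀ j, 0 ≤ ∫ s in s₀..c, α j s := fun j =>
      intervalIntegral.integral_nonneg hs₀c fun s hs => hα0 j s (hs₀.trans_le hs.1)
    refine summable_of_sum_le (c := 4 * M + (c - s₀) * (4 * M))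
      (fun j => add_nonneg (hα0 j s₀ hs₀) (hI0 j)) fun J => ?_
    rw [Finset.sum_add_distrib]
    refine add_le_add (hαsum s₀ hs₀ hs₀c J) ?_
    rw [← intervalIntegral.integral_finsetSum fun j _ => hαi j s₀ c hs₀ (ha.trans hac)]
    have : ∫ s in s₀..c, ∑ j ∈ J, α j s ≤ ∫ s in s₀..c, 4 * M := by
      refine intervalIntegral.integral_mono_on hs₀c ?_ intervalIntegrable_const
        fun s hs => hαsum s (hs₀.trans_le hs.1) hs.2 J
      exact ContinuousOn.intervalIntegrable_Ioi
        (continuousOn_finsetSum _ fun j _ => hαc j) hs₀ (ha.trans hac)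
    rwa [intervalIntegral.integral_const, smul_eq_mul] at this
  · intro x hx t ht j
    have hx' := abs_le.1 hx
    have ht0 : 0 < t := ha.trans_le ht.1
    have hmass : ∀ s, 0 < s →
        (1 + |(j : ℝ)|) * ∫ y in (j + x - 1)..(j + x + 1), ρ y s ≤ D * α j s := by
      intro s hs
      have hpc := hp.continuous_slice hs
      rw [hα, ← intervalIntegral.integral_const_mul, ← intervalIntegral.integral_const_mul]
      have e1 : ∫ y in (j + x - 1)..(j + x + 1), (1 + |(j : ℝ)|) * ρ y s
          ≤ ∫ y in (x₀ + j - 2)..(x₀ + j + 2), (1 + |(j : ℝ)|) * ρ y s := by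
        refine intervalIntegral.integral_mono_interval (by linarith) (by linarith) (by linarith)
          (ae_of_all _ fun y => mul_nonneg (by positivity) (hρ.nonneg y s hs))
          ((hpc.const_mul _).intervalIntegrable _ _)
      refine e1.trans (intervalIntegral.integral_mono_on (by linarith)
        ((hpc.const_mul _).intervalIntegrable _ _)
        (((hpc.mul hmc).const_mul _).intervalIntegrable _ _) fun y hy => ?_)
      have hj : |(j : ℝ)| ≤ |y| + |x₀| + 2 := by
        have h1 : |(j : ℝ) + x₀ - y| ≤ 2 := abs_le.2 ⟨by linarith [hy.2], by linarith [hy.1]⟩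
        have h2 : (j : ℝ) = ((j : ℝ) + x₀ - y) + y + (-x₀) := by ring
        rw [h2]
        refine (abs_add_three _ _ _).trans ?_
        rw [abs_neg]; linarith
      have hw : 1 + |(j : ℝ)| ≤ D * momentWeight y := by
        have h1 := abs_le_momentWeight y
        have h2 := one_le_momentWeight y
        rw [hD]
        nlinarith [abs_nonneg x₀]
      calc (1 + |(j : ℝ)|) * ρ y s ≤ D * momentWeight y * ρ y s :=
            mul_le_mul_of_nonneg_right hw (hρ.nonneg y s hs)
        _ = _ := by ring
    have hb := hC ρ _ _ hp hρ.nonneg (j + x) s₀ t hs₀ (by linarith [ht.1])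
      (by linarith [ht.2])
    have hI : (1 + |(j : ℝ)|) * ∫ s in s₀..t, ∫ y in (j + x - 1)..(j + x + 1), ρ y s
        ≤ D * ∫ s in s₀..c, α j s := by
      have hst : s₀ ≤ t := by linarith [ht.1]
      have hcont : ContinuousOn (fun s => ∫ y in (j + x - 1)..(j + x + 1), ρ y s) (Ioi 0) :=
        continuousOn_intervalIntegral_param
          (hp.continuousOn.mono (prod_mono (subset_univ _) subset_rfl))
      rw [← intervalIntegral.integral_const_mul, ← intervalIntegral.integral_const_mul]
      refine (intervalIntegral.integral_mono_on hst
        ((ContinuousOn.intervalIntegrable_Ioi hcont hs₀ ht0).const_mul _)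
        ((hαi j s₀ t hs₀ ht0).const_mul _) fun s hs => hmass s (hs₀.trans_le hs.1)).trans ?_
      refine intervalIntegral.integral_mono_interval le_rfl hst ht.2 ?_
        ((hαi j s₀ c hs₀ (ha.trans hac)).const_mul _)
      refine (ae_restrict_iff' measurableSet_Ioc).2 (ae_of_all _ fun s hs => ?_)
      exact mul_nonneg hD0 (hα0 j s (hs₀.trans hs.1))
    calc (1 + |(j : ℝ)|) * ρ (j + x) t
        ≤ (1 + |(j : ℝ)|) * (C * ((∫ y in (j + x - 1)..(j + x + 1), ρ y s₀)
          + ∫ s in s₀..t, ∫ y in (j + x - 1)..(j + x + 1), ρ y s)) :=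
          mul_le_mul_of_nonneg_left hb (by positivity)
      _ = C * ((1 + |(j : ℝ)|) * (∫ y in (j + x - 1)..(j + x + 1), ρ y s₀)
          + (1 + |(j : ℝ)|) * ∫ s in s₀..t, ∫ y in (j + x - 1)..(j + x + 1), ρ y s) := by ring
      _ ≤ C * (D * α j s₀ + D * ∫ s in s₀..c, α j s) :=
          mul_le_mul_of_nonneg_left (add_le_add (hmass s₀ hs₀) hI) hC0
      _ = _ := by ring

/-- The Fokker-Planck equation integrated over `[a, c]`, as a first order system in space. -/
theorem IsFokkerPlanckDensity.hasDerivAt_timeIntegral (hφ : ContDiff ℝ 2 φ)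
    (hρ : IsFokkerPlanckDensity φ f ρ₀ ρ) {a c : ℝ} (ha : 0 < a) (hac : a < c) (x : ℝ) :
    HasDerivAt (fun y => ∫ s in a..c, ρ y s)
      ((∫ s in a..c, ((deriv φ x - f) * ρ x s + deriv (fun y => ρ y s) x))
        - (deriv φ x - f) * ∫ s in a..c, ρ x s) x ∧
    HasDerivAt (fun x => ∫ s in a..c, ((deriv φ x - f) * ρ x s + deriv (fun y => ρ y s) x))
      (ρ x c - ρ x a) x := by
  have hp := hρ.isFluxSolution hφ
  have hφ'c := (contDiff_deriv_phi hφ).continuous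
  have hpos : ∀ s ∈ uIcc a c, 0 < s := fun s hs => by
    rw [uIcc_of_le hac.le] at hs; exact ha.trans_le hs.1
  have hswap : ∀ {g : ℝ → ℝ → ℝ}, ContinuousOn (fun z : ℝ × ℝ => g z.1 z.2) (univ ×ˢ Ioi 0) →
      ContinuousOn (fun z : ℝ × ℝ => g z.2 z.1) (uIcc a c ×ˢ univ) := fun {g} hg =>
    hg.comp (f := fun z : ℝ × ℝ => (z.2, z.1)) (by fun_prop)
      fun z hz => ⟨mem_univ _, hpos _ hz.1⟩
  have hbon : ContinuousOn (fun z : ℝ × ℝ => deriv φ z.1 - f) (univ ×ˢ Ioi 0) := by fun_prop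
  have hFon : ContinuousOn (fun z : ℝ × ℝ => (deriv φ z.1 - f) * ρ z.1 z.2
      + deriv (fun y => ρ y z.2) z.1) (univ ×ˢ Ioi 0) :=
    (hbon.mul hρ.continuousOn).add hρ.continuousOn_deriv_space
  have hslice : ∀ {g : ℝ → ℝ → ℝ}, ContinuousOn (fun z : ℝ × ℝ => g z.1 z.2) (univ ×ˢ Ioi 0) →
      IntervalIntegrable (fun s => g x s) volume a c := fun hg =>
    ContinuousOn.intervalIntegrable_Ioi (ContinuousOn.slice_right hg x) ha (ha.trans hac)
  constructor
  · rw [← intervalIntegral.integral_const_mul, ← intervalIntegral.integral_sub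
      (hslice (g := fun x s => (deriv φ x - f) * ρ x s + deriv (fun y => ρ y s) x) hFon)
      ((hslice hρ.continuousOn).const_mul _)]
    exact hasDerivAt_intervalIntegral_param isOpen_univ (mem_univ x)
      (g := fun s y => ρ y s) (g' := fun s y => (deriv φ y - f) * ρ y s
        + deriv (fun y => ρ y s) y - (deriv φ y - f) * ρ y s)
      (hswap hρ.continuousOn)
      ((hswap (g := fun x s => (deriv φ x - f) * ρ x s + deriv (fun y => ρ y s) x) hFon).sub
        (hswap (g := fun x s => (deriv φ x - f) * ρ x s) (hbon.mul hρ.continuousOn)))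
      fun s hs y _ => hp.space y s (hpos s hs)
  · rw [← intervalIntegral.integral_eq_sub_of_hasDerivAt
      (fun s hs => hp.time x s (hpos s hs))
      (hslice (g := fun x t => deriv (fun s => ρ x s) t) hp.continuousOn_time)]
    exact hasDerivAt_intervalIntegral_param isOpen_univ (mem_univ x)
      (g := fun s x => (deriv φ x - f) * ρ x s + deriv (fun y => ρ y s) x)
      (g' := fun s x => deriv (fun s => ρ x s) s)
      (hswap (g := fun x s => (deriv φ x - f) * ρ x s + deriv (fun y => ρ y s) x) hFon)
      (hswap (g := fun x t => deriv (fun s => ρ x s) t) hp.continuousOn_time)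
      fun s hs y _ => hp.flux y s (hpos s hs)

/-- The periodized sum `∑ αⱼ ρ(j + x, t)`. -/
noncomputable def periodizedSum (α : ℤ → ℝ) (ρ : ℝ → ℝ → ℝ) (x t : ℝ) : ℝ :=
  ∑' j : ℤ, α j * ρ (j + x) t

theorem IsFokkerPlanckDensity.exists_summable_bound_weighted (hφ : ContDiff ℝ 2 φ)
    (hper : Function.Periodic φ 1) (hρ : IsFokkerPlanckDensity φ f (initialDensity φ f) ρ)
    {α : ℤ → ℝ} (hα : ∀ j, |α j| ≤ 1 + |(j : ℝ)|)
    (x₀ : ℝ) {a c : ℝ} (ha : 0 < a) (hac : a < c) : ∃ m : ℤ → ℝ, Summable m ∧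
      ∀ x, |x - x₀| ≤ 1 → ∀ t ∈ Icc a c, ∀ j : ℤ, |α j * ρ (j + x) t| ≤ m j := by
  obtain ⟨m, hm, h⟩ := hρ.exists_summable_bound hφ hper x₀ ha hac
  refine ⟨m, hm, fun x hx t ht j => ?_⟩
  have hnn := hρ.nonneg (j + x) t (ha.trans_le ht.1)
  rw [abs_mul, abs_of_nonneg hnn]
  exact (mul_le_mul_of_nonneg_right (hα j) hnn).trans (h x hx t ht j)

theorem IsFokkerPlanckDensity.summable_weighted (hφ : ContDiff ℝ 2 φ)
    (hper : Function.Periodic φ 1) (hρ : IsFokkerPlanckDensity φ f (initialDensity φ f) ρ)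
    {α : ℤ → ℝ} (hα : ∀ j, |α j| ≤ 1 + |(j : ℝ)|) (x : ℝ) {t : ℝ} (ht : 0 < t) :
    Summable fun j : ℤ => α j * ρ (j + x) t := by
  obtain ⟨m, hm, h⟩ := hρ.exists_summable_bound_weighted hφ hper hα x ht (lt_add_one t)
  exact Summable.of_norm_bounded hm fun j => h x (by simp) t ⟨le_rfl, (lt_add_one t).le⟩ j

/-- Periodized sums are mild solutions. Only the density itself has locally uniform bounds; those
on the flux, which are needed to differentiate the series, are available after integration in
time, from the mean value theorem. -/
theorem IsFokkerPlanckDensity.isMildSolution_periodizedSum (hφ : ContDiff ℝ 2 φ)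
    (hper : Function.Periodic φ 1) (hρ : IsFokkerPlanckDensity φ f (initialDensity φ f) ρ)
    {α : ℤ → ℝ} (hα : ∀ j, |α j| ≤ 1 + |(j : ℝ)|) :
    IsMildSolution φ f (periodizedSum α ρ) := by
  have hterm : ∀ j : ℤ, ContinuousOn (fun z : ℝ × ℝ => α j * ρ (j + z.1) z.2) (univ ×ˢ Ioi 0) :=
    fun j => continuousOn_const.mul (hρ.continuousOn.comp
      (f := fun z : ℝ × ℝ => ((j : ℝ) + z.1, z.2)) (by fun_prop) fun z hz => ⟨mem_univ _, hz.2⟩)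
  refine ⟨?_, ?_⟩
  · rintro ⟨x, t⟩ ⟨-, ht⟩
    have ht : 0 < t := ht
    obtain ⟨m, hm, h⟩ := hρ.exists_summable_bound_weighted hφ hper hα x (half_pos ht)
      (by linarith : t / 2 < t + 1)
    have hc : ContinuousOn (fun z : ℝ × ℝ => periodizedSum α ρ z.1 z.2)
        (Metric.closedBall x 1 ×ˢ Icc (t / 2) (t + 1)) := by
      refine continuousOn_tsum (fun j => (hterm j).mono ?_) hm fun j z hz => ?_
      · exact fun z hz => ⟨mem_univ _, mem_Ioi.2 ((half_pos ht).trans_le hz.2.1)⟩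
      · exact h z.1 (by simpa [Real.dist_eq] using hz.1) z.2 hz.2 j
    refine (hc.continuousAt ?_).continuousWithinAt
    exact prod_mem_nhds (Metric.closedBall_mem_nhds x one_pos)
      (Icc_mem_nhds (by linarith) (by linarith))
  · intro a c ha hac
    have hφ'c := (contDiff_deriv_phi hφ).continuous
    obtain ⟨B, hB0, hB⟩ := Periodic.exists_abs_le (g := fun x => deriv φ x - f)
      (fun x => by simp only [Periodic.deriv hper x]) (by fun_prop)
    set P : ℤ → ℝ → ℝ := fun j y => α j * ∫ s in a..c, ρ (j + y) s with hP
    set G : ℤ → ℝ → ℝ := fun j y => α j * ∫ s in a..c, ((deriv φ (j + y) - f) * ρ (j + y) s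
      + deriv (fun y => ρ y s) (j + y)) with hG
    have hφ'per : ∀ (j : ℤ) y, deriv φ (j + y) = deriv φ y := fun j y => by
      have := (Periodic.deriv hper).int_mul j y
      rwa [mul_one, add_comm] at this
    have hPd : ∀ j y, HasDerivAt (P j) (G j y - (deriv φ y - f) * P j y) y := fun j y => by
      refine (((hρ.hasDerivAt_timeIntegral hφ ha hac (j + y)).1.comp_const_add
        (j : ℝ) y).const_mul (α j)).congr_deriv ?_
      simp only [hP, hG, hφ'per]; ring
    have hGd : ∀ j y, HasDerivAt (G j) (α j * ρ (j + y) c - α j * ρ (j + y) a) y := fun j y =>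
      (((hρ.hasDerivAt_timeIntegral hφ ha hac (j + y)).2.comp_const_add
        (j : ℝ) y).const_mul (α j)).congr_deriv (by ring)
    have hPsum : ∀ y, HasSum (fun j => P j y) (∫ s in a..c, periodizedSum α ρ y s) := by
      intro y
      obtain ⟨m, hm, h⟩ := hρ.exists_summable_bound_weighted hφ hper hα y ha hac
      simp only [hP, ← intervalIntegral.integral_const_mul]
      have hsl : ∀ j, ContinuousOn (fun s => α j * ρ (j + y) s) (Ioi 0) := fun j =>
        continuousOn_const.mul (ContinuousOn.slice_right hρ.continuousOn _)
      have hsub : uIoc a c ⊆ Icc a c := by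
        rw [uIoc_of_le hac.le]; exact Ioc_subset_Icc_self
      refine intervalIntegral.hasSum_integral_of_dominated_convergence (fun j _ => m j)
        (fun j => ?_) (fun j => ae_of_all _ fun s hs => h y (by simp) s (hsub hs) j)
        (ae_of_all _ fun _ _ => hm) intervalIntegrable_const
        (ae_of_all _ fun s hs => (hρ.summable_weighted hφ hper hα y
          (ha.trans_le (hsub hs).1)).hasSum)
      exact ((hsl j).mono fun s hs => ha.trans_le (hsub hs).1).aestronglyMeasurable
        measurableSet_uIoc
    refine ⟨fun y => ∑' j, G j y, fun x => ?_⟩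
    obtain ⟨m, hm, h⟩ := hρ.exists_summable_bound_weighted hφ hper hα x ha hac
    have hcapos : 0 < c - a := sub_pos.2 hac
    have hPb : ∀ j y, |y - x| ≤ 1 → |P j y| ≤ (c - a) * m j := fun j y hy => by
      simp only [hP, ← intervalIntegral.integral_const_mul]
      have := intervalIntegral.norm_integral_le_of_norm_le_const (a := a) (b := c)
        (f := fun s => α j * ρ (j + y) s) (C := m j) fun s hs => by
          rw [uIoc_of_le hac.le] at hs
          exact h y hy s (Ioc_subset_Icc_self hs) j
      rwa [abs_of_pos hcapos, mul_comm] at this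
    have hdb : ∀ j y, |y - x| ≤ 1 → |α j * ρ (j + y) c - α j * ρ (j + y) a| ≤ 2 * m j :=
      fun j y hy => by
        refine (abs_sub _ _).trans ?_
        linarith [h y hy c ⟨hac.le, le_rfl⟩ j, h y hy a ⟨le_rfl, hac.le⟩ j]
    have hm0 : ∀ j, 0 ≤ m j := fun j =>
      (abs_nonneg _).trans (h x (by simp) a ⟨le_rfl, hac.le⟩ j)
    have hGb : ∀ j y, |y - x| < 1 → |G j y| ≤ ((4 + B) * (c - a) + 4) * m j := by
      intro j y hy
      obtain ⟨ξ, hξ, hslope⟩ := exists_hasDerivAt_eq_slope (P j)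
        (fun y => G j y - (deriv φ y - f) * P j y) (by linarith : x < x + 1 / 2)
        (fun z _ => (hPd j z).continuousAt.continuousWithinAt) fun z _ => hPd j z
      have hξ1 : |ξ - x| ≤ 1 := abs_le.2 ⟨by linarith [hξ.1], by linarith [hξ.2]⟩
      have hGξ : |G j ξ| ≤ (4 + B) * (c - a) * m j := by
        have e : G j ξ = 2 * P j (x + 1 / 2) - 2 * P j x + (deriv φ ξ - f) * P j ξ := by
          have : (P j (x + 1 / 2) - P j x) / (x + 1 / 2 - x)
            = 2 * P j (x + 1 / 2) - 2 * P j x := by ring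
          rw [this] at hslope
          linarith
        have h1 := abs_le.1 (hPb j (x + 1 / 2) (by norm_num [abs_le]))
        have h2 := abs_le.1 (hPb j x (by simp))
        have h3 : |(deriv φ ξ - f) * P j ξ| ≤ B * ((c - a) * m j) := by
          rw [abs_mul]
          exact mul_le_mul (hB ξ) (hPb j ξ hξ1) (abs_nonneg _) hB0
        have h3 := abs_le.1 h3
        rw [e, abs_le]
        constructor <;> linarith [h1.1, h1.2, h2.1, h2.2, h3.1, h3.2]
      have hdiff : |G j y - G j ξ| ≤ 2 * m j * |y - ξ| := by
        refine (convex_closedBall x 1).norm_image_sub_le_of_norm_hasDerivWithin_le (f := G j)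
          (f' := fun y => α j * ρ (j + y) c - α j * ρ (j + y) a)
          (fun z _ => (hGd j z).hasDerivWithinAt)
          (fun z hz => hdb j z (by simpa [Real.dist_eq] using hz))
          (by simpa [Real.dist_eq] using hξ1) (by simpa [Real.dist_eq] using hy.le)
      have hyξ : |y - ξ| ≤ 2 := by
        have h1 := abs_le.1 hy.le
        have h2 := abs_le.1 hξ1
        exact abs_le.2 ⟨by linarith, by linarith⟩
      have h4 : 2 * m j * |y - ξ| ≤ 2 * m j * 2 :=
        mul_le_mul_of_nonneg_left hyξ (by linarith [hm0 j])
      have h5 : |G j y| ≤ |G j y - G j ξ| + |G j ξ| := by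
        simpa using abs_add_le (G j y - G j ξ) (G j ξ)
      linarith
    have hball : ∀ y ∈ Metric.ball x 1, |y - x| < 1 := fun y hy => by
      simpa [Real.dist_eq] using hy
    have hxb : x ∈ Metric.ball x 1 := Metric.mem_ball_self one_pos
    have hGs : Summable fun j => G j x :=
      Summable.of_norm_bounded (hm.mul_left _) fun j => hGb j x (by simp)
    constructor
    · have hd := hasDerivAt_tsum_of_isPreconnected
        (hm.mul_left ((4 + B) * (c - a) + 4 + B * (c - a))) Metric.isOpen_ball
        (convex_ball x 1).isPreconnected (fun j y _ => hPd j y) (fun j y hy => by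
          have h1 := hGb j y (hball y hy)
          have h2 : |(deriv φ y - f) * P j y| ≤ B * ((c - a) * m j) := by
            rw [abs_mul]
            exact mul_le_mul (hB y) (hPb j y (hball y hy).le) (abs_nonneg _) hB0
          refine (abs_sub _ _).trans ?_
          linarith) hxb (hPsum x).summable hxb
      rw [hGs.tsum_sub ((hPsum x).summable.mul_left _), tsum_mul_left, (hPsum x).tsum_eq] at hd
      refine hd.congr_of_eventuallyEq (Eventually.of_forall fun y => ?_)
      exact (hPsum y).tsum_eq.symm
    · have hd := hasDerivAt_tsum_of_isPreconnected (hm.mul_left 2) Metric.isOpen_ball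
        (convex_ball x 1).isPreconnected (fun j y _ => hGd j y)
        (fun j y hy => hdb j y (hball y hy).le) hxb hGs hxb
      rwa [(hρ.summable_weighted hφ hper hα x (ha.trans hac)).tsum_sub
        (hρ.summable_weighted hφ hper hα x ha)] at hd

end Series

/-! ### Identification of the limit -/

section Limit

variable {φ : ℝ → ℝ} {f : ℝ} {ρ : ℝ → ℝ → ℝ}

theorem isMildSolution_u0 (hφ : ContDiff ℝ 2 φ) (hper : Function.Periodic φ 1) (f : ℝ) :
    IsMildSolution φ f (fun x _ => u0 φ f x) := by
  refine ⟨((continuous_u0 hφ hper f).comp continuous_fst).continuousOn, fun a c _ _ => ?_⟩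
  refine ⟨fun _ => (c - a) * -J0 φ f, fun x => ⟨?_, ?_⟩⟩
  · simp only [intervalIntegral.integral_const, smul_eq_mul]
    exact ((hasDerivAt_u0 hφ hper f x).const_mul (c - a)).congr_deriv (by ring)
  · simpa using hasDerivAt_const x ((c - a) * -J0 φ f)

/-- The growing solution `u₀ J₀ t + u₁`, which `ρ₁` approaches. -/
theorem isMildSolution_u1 (hφ : ContDiff ℝ 2 φ) (hper : Function.Periodic φ 1) (hf : f ≠ 0) :
    IsMildSolution φ f (fun x t => u0 φ f x * J0 φ f * t + u1 φ f x) := by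
  have hu0 := continuous_u0 hφ hper f
  have hu1 := continuous_u1 hφ hper hf
  refine ⟨by fun_prop, fun a c _ _ => ?_⟩
  have e : ∀ y, ∫ s in a..c, (u0 φ f y * J0 φ f * s + u1 φ f y)
      = (c ^ 2 - a ^ 2) / 2 * J0 φ f * u0 φ f y + (c - a) * u1 φ f y := fun y => by
    rw [intervalIntegral.integral_add (Continuous.intervalIntegrable (by fun_prop) _ _)
      intervalIntegrable_const, intervalIntegral.integral_const_mul, integral_id,
      intervalIntegral.integral_const, smul_eq_mul]
    ring
  refine ⟨fun x => (c ^ 2 - a ^ 2) / 2 * J0 φ f * -J0 φ f + (c - a) * flux1 φ f x,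
    fun x => ⟨?_, ?_⟩⟩
  · simp only [e]
    exact (((hasDerivAt_u0 hφ hper f x).const_mul _).fun_add
      ((hasDerivAt_u1 hφ hper hf x).const_mul _)).congr_deriv (by ring)
  · exact (((hasDerivAt_flux1 hφ hper f x).const_mul (c - a)).const_add _).congr_deriv (by ring)

theorem abs_one_le_one_add (j : ℤ) : |(1 : ℝ)| ≤ 1 + |(j : ℝ)| := by
  rw [abs_one]; linarith [abs_nonneg (j : ℝ)]

theorem abs_intCast_le (j : ℤ) : |(j : ℝ)| ≤ 1 + |(j : ℝ)| := by linarith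

theorem periodizedSum_one_add_one (ρ : ℝ → ℝ → ℝ) (x t : ℝ) :
    periodizedSum (fun _ => 1) ρ (x + 1) t = periodizedSum (fun _ => 1) ρ x t := by
  unfold periodizedSum
  rw [← (Equiv.addRight (1 : ℤ)).tsum_eq fun j : ℤ => 1 * ρ (j + x) t]
  refine tsum_congr fun j => ?_
  simp only [Equiv.coe_addRight, Int.cast_add, Int.cast_one]
  congr 2; ring

theorem IsFokkerPlanckDensity.periodizedSum_id_add_one (hφ : ContDiff ℝ 2 φ)
    (hper : Function.Periodic φ 1) (hρ : IsFokkerPlanckDensity φ f (initialDensity φ f) ρ)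
    (x : ℝ) {t : ℝ} (ht : 0 < t) :
    periodizedSum (fun j => (j : ℝ)) ρ (x + 1) t
      = periodizedSum (fun j => (j : ℝ)) ρ x t - periodizedSum (fun _ => 1) ρ x t := by
  unfold periodizedSum
  rw [← (hρ.summable_weighted hφ hper abs_intCast_le x ht).tsum_sub
    (hρ.summable_weighted hφ hper abs_one_le_one_add x ht),
    ← (Equiv.addRight (1 : ℤ)).tsum_eq fun j : ℤ => (j : ℝ) * ρ (j + x) t - 1 * ρ (j + x) t]
  refine tsum_congr fun j => ?_
  simp only [Equiv.coe_addRight, Int.cast_add, Int.cast_one]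
  rw [← sub_mul, add_sub_cancel_right]
  congr 2; ring

theorem IsFokkerPlanckDensity.hasSum_integral_periodizedSum (hφ : ContDiff ℝ 2 φ)
    (hper : Function.Periodic φ 1) (hρ : IsFokkerPlanckDensity φ f (initialDensity φ f) ρ)
    {α : ℤ → ℝ} (hα : ∀ j, |α j| ≤ 1 + |(j : ℝ)|) {t : ℝ} (ht : 0 < t) :
    HasSum (fun j : ℤ => α j * ∫ x in (0 : ℝ)..1, ρ (x + j) t)
      (∫ x in (0 : ℝ)..1, periodizedSum α ρ x t) := by
  obtain ⟨m, hm, h⟩ := hρ.exists_summable_bound_weighted hφ hper hα 0 ht (lt_add_one t)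
  have hpc := (hρ.isFluxSolution hφ).continuous_slice ht
  simp only [← intervalIntegral.integral_const_mul]
  refine intervalIntegral.hasSum_integral_of_dominated_convergence (fun j _ => m j)
    (fun j => Continuous.aestronglyMeasurable (by fun_prop))
    (fun j => ae_of_all _ fun x hx => ?_) (ae_of_all _ fun _ _ => hm) intervalIntegrable_const
    (ae_of_all _ fun x _ => ?_)
  · rw [uIoc_of_le zero_le_one] at hx
    rw [add_comm x]
    exact h x (by rw [sub_zero, abs_of_pos hx.1]; exact hx.2) t ⟨le_rfl, (lt_add_one t).le⟩ j
  · simp only [add_comm x]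
    exact (hρ.summable_weighted hφ hper hα x ht).hasSum

theorem IsFokkerPlanckDensity.integral_periodizedSum_one (hφ : ContDiff ℝ 2 φ)
    (hper : Function.Periodic φ 1) (hρ : IsFokkerPlanckDensity φ f (initialDensity φ f) ρ)
    {t : ℝ} (ht : 0 < t) : ∫ x in (0 : ℝ)..1, periodizedSum (fun _ => 1) ρ x t = 1 := by
  have h1 := hρ.hasSum_integral_periodizedSum hφ hper abs_one_le_one_add ht
  have h2 := (hρ.integrable t ht).hasSum_intervalIntegral_comp_add_int
  rw [hρ.mass t ht] at h2
  simp only [one_mul] at h1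
  exact h1.unique h2

/-- The periodized density does not move: it starts from the steady state `u₀`, and the `L¹`
distance to `u₀` cannot grow. -/
theorem IsFokkerPlanckDensity.periodizedSum_one_eq (hφ : ContDiff ℝ 2 φ)
    (hper : Function.Periodic φ 1) (hρ : IsFokkerPlanckDensity φ f (initialDensity φ f) ρ)
    (x : ℝ) {t : ℝ} (ht : 0 < t) : periodizedSum (fun _ => 1) ρ x t = u0 φ f x := by
  set D : ℝ → ℝ → ℝ := fun x t => periodizedSum (fun _ => 1) ρ x t - u0 φ f x with hD
  have hR := hρ.isMildSolution_periodizedSum hφ hper abs_one_le_one_add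
  have hDm : IsMildSolution φ f D := hR.sub (isMildSolution_u0 hφ hper f)
  have hDp : ∀ t, 0 < t → Function.Periodic (fun x => D x t) 1 := fun t _ x => by
    simp only [hD, periodizedSum_one_add_one, periodic_u0 hper f x]
  have hu := continuous_u0 hφ hper f
  have hi₀ := integrable_initialDensity hφ hper f
  have hle : ∀ s, 0 < s →
      ∫ x in (0 : ℝ)..1, |D x s| ≤ 2 * ∫ x, |ρ x s - initialDensity φ f x| := by
    intro s hs
    have hpc := (hρ.isFluxSolution hφ).continuous_slice hs
    have hRc : Continuous fun x => periodizedSum (fun _ => 1) ρ x s :=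
      ContinuousOn.slice_left hR.continuousOn hs
    have hpt : ∀ x, |D x s| ≤ |ρ x s - u0 φ f x|
        + (periodizedSum (fun _ => 1) ρ x s - ρ x s) := fun x => by
      have hsum := hρ.summable_weighted hφ hper abs_one_le_one_add x hs
      have h0 : ρ x s ≤ periodizedSum (fun _ => 1) ρ x s := by
        have := hsum.le_tsum 0 fun j _ => by
          rw [one_mul]; exact hρ.nonneg _ s hs
        simpa [periodizedSum] using this
      have e : D x s = (ρ x s - u0 φ f x) + (periodizedSum (fun _ => 1) ρ x s - ρ x s) := by
        simp only [hD]; ring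
      rw [e]
      refine (abs_add_le _ _).trans ?_
      rw [abs_of_nonneg (sub_nonneg.2 h0)]
    have h1 : ∫ x in (0 : ℝ)..1, |D x s| ≤ ∫ x in (0 : ℝ)..1, (|ρ x s - u0 φ f x|
        + (periodizedSum (fun _ => 1) ρ x s - ρ x s)) :=
      intervalIntegral.integral_mono_on zero_le_one
        ((ContinuousOn.slice_left hDm.continuousOn hs).abs.intervalIntegrable _ _)
        (Continuous.intervalIntegrable (by fun_prop) _ _) fun x _ => hpt x
    rw [intervalIntegral.integral_add (Continuous.intervalIntegrable (by fun_prop) _ _)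
      (Continuous.intervalIntegrable (by fun_prop) _ _), intervalIntegral.integral_sub
      (hRc.intervalIntegrable _ _) (hpc.intervalIntegrable _ _),
      hρ.integral_periodizedSum_one hφ hper hs] at h1
    have h2 : ∫ x in (0 : ℝ)..1, |ρ x s - u0 φ f x| ≤ ∫ x, |ρ x s - initialDensity φ f x| := by
      have e : ∫ x in (0 : ℝ)..1, |ρ x s - u0 φ f x|
          = ∫ x in (0 : ℝ)..1, |ρ x s - initialDensity φ f x| := by
        refine intervalIntegral.integral_congr fun x hx => ?_
        rw [uIcc_of_le zero_le_one] at hx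
        simp only [initialDensity_of_mem hx]
      rw [e, intervalIntegral.integral_of_le zero_le_one]
      exact setIntegral_le_integral ((hρ.integrable s hs).sub hi₀).abs
        (ae_of_all _ fun x => abs_nonneg _)
    have h3 := abs_integral_mul_sub_le (zero_le_one' ℝ) (hρ.integrable s hs) hi₀
      (continuous_const (y := (1 : ℝ))) (M := 1) fun x _ => by simp
    have h4 : ∫ x in (0 : ℝ)..1, initialDensity φ f x * 1 = 1 := by
      refine Eq.trans ?_ (integral_u0 hφ hper f)
      refine intervalIntegral.integral_congr fun x hx => ?_
      rw [uIcc_of_le zero_le_one] at hx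
      simp only [initialDensity_of_mem hx, mul_one]
    rw [h4] at h3
    simp only [mul_one, one_mul] at h3
    linarith [(abs_le.1 h3).1]
  have hzero : ∫ x in (0 : ℝ)..1, |D x t| ≤ 0 := by
    have hlim := hρ.initial.const_mul 2
    rw [mul_zero] at hlim
    refine ge_of_tendsto hlim ?_
    filter_upwards [Ioo_mem_nhdsGT ht] with s hs
    exact (hDm.integral_abs_le hφ hper hDp hs.1 hs.2.le).trans (hle s hs.1)
  have hDc := ContinuousOn.slice_left hDm.continuousOn ht
  obtain ⟨y, hy, hxy⟩ := (hDp t ht).exists_mem_Ico₀ one_pos x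
  have hDy : D y t = 0 := by
    by_contra hne
    exact absurd hzero (not_le.2 (intervalIntegral.integral_pos zero_lt_one
      hDc.abs.continuousOn (fun _ _ => abs_nonneg _) ⟨y, Ico_subset_Icc_self hy, abs_pos.2 hne⟩))
  have : D x t = 0 := by simpa only [hDy] using hxy
  exact sub_eq_zero.1 this

/-- The mass of `ρ₁` over `[0, 1]` is `∑ⱼ j ∫ ρ` over the cells `[j, j + 1]`: the cell `j = 0` does
not count, and on the others `|j|` is at most twice the moment weight. -/
theorem IsFokkerPlanckDensity.tendsto_integral_periodizedSum_id (hφ : ContDiff ℝ 2 φ)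
    (hper : Function.Periodic φ 1) (hρ : IsFokkerPlanckDensity φ f (initialDensity φ f) ρ) :
    Tendsto (fun t => ∫ x in (0 : ℝ)..1, periodizedSum (fun j => (j : ℝ)) ρ x t)
      (𝓝[>] 0) (𝓝 0) := by
  obtain ⟨K, -, hK⟩ := hρ.exists_moment_bound hφ hper
  have hlim := (hρ.tendsto_moment_outside hφ hper).const_mul 2
  rw [mul_zero] at hlim
  refine squeeze_zero_norm' ?_ hlim
  filter_upwards [self_mem_nhdsWithin] with t ht
  have ht : 0 < t := ht
  have hpc := (hρ.isFluxSolution hφ).continuous_slice ht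
  have hmc := continuous_momentWeight
  set β : ℤ → ℝ := fun j => ∫ x in (0 : ℝ)..1, ρ (x + j) t * momentWeight (x + j) with hβ
  have hβsum : HasSum β (∫ x, ρ x t * momentWeight x) :=
    (hK t ht).1.hasSum_intervalIntegral_comp_add_int
  have hβ0 : β 0 = ∫ x in (0 : ℝ)..1, ρ x t * momentWeight x := by simp [hβ]
  have hsum := ((hβsum.sub (hasSum_ite_eq (0 : ℤ) (β 0))).mul_left 2)
  rw [← (hρ.hasSum_integral_periodizedSum hφ hper abs_intCast_le ht).tsum_eq, ← hβ0]
  refine tsum_of_norm_bounded hsum fun j => ?_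
  by_cases hj : j = 0
  · subst hj; simp
  · rw [if_neg hj, sub_zero, hβ, ← intervalIntegral.integral_const_mul,
      ← intervalIntegral.integral_const_mul]
    refine (intervalIntegral.norm_integral_le_integral_norm zero_le_one).trans
      (intervalIntegral.integral_mono_on zero_le_one
        (Continuous.intervalIntegrable (by fun_prop) _ _)
        (Continuous.intervalIntegrable (by fun_prop) _ _) fun x hx => ?_)
    have hnn := hρ.nonneg (x + j) t ht
    rw [norm_mul, Real.norm_of_nonneg hnn, Real.norm_eq_abs]
    have h1 : |(j : ℝ)| ≤ 2 * momentWeight (x + j) := by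
      have e : (j : ℝ) = (x + j) + -x := by ring
      have h2 : |(j : ℝ)| ≤ |x + j| + |x| := by
        calc |(j : ℝ)| = |(x + j) + -x| := by rw [← e]
          _ ≤ |x + j| + |-x| := abs_add_le _ _
          _ = |x + j| + |x| := by rw [abs_neg]
      rw [abs_of_nonneg hx.1] at h2
      linarith [abs_le_momentWeight (x + j), one_le_momentWeight (x + j), hx.2]
    calc |(j : ℝ)| * ρ (x + j) t ≤ 2 * momentWeight (x + j) * ρ (x + j) t :=
          mul_le_mul_of_nonneg_right h1 hnn
      _ = _ := by ring

theorem IsFokkerPlanckDensity.tendstoUniformly_periodizedMoment_one (hφ : ContDiff ℝ 2 φ)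
    (hper : Function.Periodic φ 1) (hf : f ≠ 0)
    (hρ : IsFokkerPlanckDensity φ f (initialDensity φ f) ρ) :
    TendstoUniformly (fun (t : ℝ) (x : ℝ) => periodizedMoment 1 ρ x t - u0 φ f x * J0 φ f * t)
      (u1 φ f) atTop := by
  have hmom : ∀ x t, periodizedMoment 1 ρ x t = periodizedSum (fun j => (j : ℝ)) ρ x t :=
    fun x t => by simp only [periodizedMoment, periodizedSum, pow_one]
  set q : ℝ → ℝ → ℝ := fun x t => periodizedSum (fun j => (j : ℝ)) ρ x t
    - (u0 φ f x * J0 φ f * t + u1 φ f x) with hq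
  have hR := hρ.isMildSolution_periodizedSum hφ hper abs_intCast_le
  have hqm : IsMildSolution φ f q := hR.sub (isMildSolution_u1 hφ hper hf)
  have hqp : ∀ t, 0 < t → Function.Periodic (fun x => q x t) 1 := fun t ht x => by
    simp only [hq]
    rw [hρ.periodizedSum_id_add_one hφ hper x ht, hρ.periodizedSum_one_eq hφ hper x ht,
      u1_add_one hφ hper f, periodic_u0 hper f]
    ring
  have hu0 := continuous_u0 hφ hper f
  have hu1 := continuous_u1 hφ hper hf
  have hint : ∀ s, 0 < s → ∫ x in (0 : ℝ)..1, q x s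
      = (∫ x in (0 : ℝ)..1, periodizedSum (fun j => (j : ℝ)) ρ x s) - J0 φ f * s := by
    intro s hs
    simp only [hq]
    rw [intervalIntegral.integral_sub
      ((ContinuousOn.slice_left hR.continuousOn hs).intervalIntegrable _ _)
      (Continuous.intervalIntegrable (by fun_prop) _ _), intervalIntegral.integral_add
      (Continuous.intervalIntegrable (by fun_prop) _ _) (hu1.intervalIntegrable _ _),
      integral_u1 hφ hper f, intervalIntegral.integral_mul_const,
      intervalIntegral.integral_mul_const, integral_u0 hφ hper f]
    ring
  have hmean : ∀ t, 0 < t → ∫ x in (0 : ℝ)..1, q x t = 0 := by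
    intro t ht
    have hlim : Tendsto (fun s => (∫ x in (0 : ℝ)..1, periodizedSum (fun j => (j : ℝ)) ρ x s)
        - J0 φ f * s) (𝓝[>] 0) (𝓝 (0 - J0 φ f * 0)) := by
      refine (hρ.tendsto_integral_periodizedSum_id hφ hper).sub ?_
      have : Continuous fun s => J0 φ f * s := by fun_prop
      exact (this.tendsto 0).mono_left nhdsWithin_le_nhds
    rw [mul_zero, sub_zero] at hlim
    refine tendsto_nhds_unique (tendsto_const_nhds.congr' ?_) hlim
    filter_upwards [Ioo_mem_nhdsGT ht] with s hs
    rw [hqm.integral_eq hper hqp hs.1 hs.2, hint s hs.1]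
  obtain ⟨A, l, hl, hA⟩ := hqm.exists_uniform_decay hφ hper hqp hmean
  have hexp : Tendsto (fun t : ℝ => A * Real.exp (-(2 * l * (t - 2)))) atTop (𝓝 (A * 0)) := by
    refine Tendsto.const_mul A (Real.tendsto_exp_neg_atTop_nhds_zero.comp ?_)
    exact (tendsto_atTop_add_const_right _ (-2) tendsto_id).const_mul_atTop (by positivity)
  rw [mul_zero] at hexp
  rw [Metric.tendstoUniformly_iff]
  intro ε hε
  filter_upwards [hexp.eventually (gt_mem_nhds (by positivity : 0 < ε ^ 2)),
    eventually_ge_atTop (2 : ℝ)] with t ht1 ht2 x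
  have e : u1 φ f x - (periodizedMoment 1 ρ x t - u0 φ f x * J0 φ f * t) = -q x t := by
    simp only [hq, hmom]; ring
  rw [Real.dist_eq, e, abs_neg]
  exact abs_lt_of_sq_lt_sq ((hA x t ht2).trans_lt ht1) hε.le

end Limit

end PeriodicPotential

open PeriodicPotential
theorem mainTheorem3 (φ : ℝ → ℝ) (hφ : ContDiff ℝ 2 φ) (hper : Function.Periodic φ 1)
    (f : ℝ) (hf : f ≠ 0) :
    -- the flux of `u₁`
    (Differentiable ℝ (u1 φ f) ∧
      ∀ x : ℝ, flux φ f (u1 φ f) x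
        = M1 φ f / M0 φ f ^ 3 + J0 φ f / 2 - J0 φ f * ∫ s in (0 : ℝ)..x, u0 φ f s) ∧
    -- `u₁` is a steady state of the problem that governs `p₁ = ρ₁ - u₀ J₀ t`
    ((∀ x : ℝ, HasDerivAt (fun y => (deriv φ y - f) * u1 φ f y + deriv (u1 φ f) y)
        (J0 φ f * u0 φ f x) x) ∧
      (∀ x : ℝ, u1 φ f (x + 1) = u1 φ f x - u0 φ f x) ∧
      ∫ x in (0 : ℝ)..1, u1 φ f x = 0) ∧
    -- `ρ₁` is well defined and `p₁` converges to `u₁`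
    (∀ ρ : ℝ → ℝ → ℝ, IsFokkerPlanckDensity φ f (initialDensity φ f) ρ →
      (∀ x : ℝ, ∀ t : ℝ, 0 < t → Summable (fun j : ℤ => (j : ℝ) ^ 1 * ρ (j + x) t)) ∧
      TendstoUniformly
        (fun (t : ℝ) (x : ℝ) => periodizedMoment 1 ρ x t - u0 φ f x * J0 φ f * t)
        (u1 φ f) atTop) := by
  have hd := hasDerivAt_u1 hφ hper hf
  have hflux : (fun y => (deriv φ y - f) * u1 φ f y + deriv (u1 φ f) y) = flux1 φ f := by
    funext y
    rw [(hd y).deriv]; ring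
  refine ⟨⟨fun x => (hd x).differentiableAt, fun x => ?_⟩, ⟨fun x => ?_, u1_add_one hφ hper f,
    integral_u1 hφ hper f⟩, fun ρ hρ => ⟨fun x t ht => ?_, ?_⟩⟩
  · have : (deriv φ x - f) * u1 φ f x + deriv (u1 φ f) x = flux1 φ f x := congrFun hflux x
    rw [flux, this, flux1]; ring
  · rw [hflux]
    exact hasDerivAt_flux1 hφ hper f x
  · simpa only [pow_one] using hρ.summable_weighted hφ hper abs_intCast_le x ht
  · exact hρ.tendstoUniformly_periodizedMoment_one hφ hper hf
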